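/- **Conventions.** Let $n\ge 2$ and let $K$ be the $(n-2)$-skeleton of the $n$-simplex. Let $E(K)$ be the space of linear embeddings of $K$ in $\mathbb R^n$, topologized by the positions $p_0,\dots,p_n$ of the vertices, and let $C(K)=E(K)/S_{n+1}$ be the configuration space of unlabeled linearly embedded copies of $K$, with the quotient topology. Let $S\subset C(K)$ be the subspace of configurations spanning a nondegenerate $n$-simplex. In every other configuration exactly one vertex lies in the convex hull of the remaining ones. Let $P(K)\subset C(K)$ be the set of *pyramids*: for some vertex $v$ (the apex) the other $n$ vertices span a regular simplex $F$ with unit edges, $v$ lies on the line perpendicular to $F$ through the barycenter of $F$, the barycenter of all $n+1$ vertices is the origin, and the distance from $v$ to the barycenter of $F$ lies between $0$ and $\sqrt{(n+1)/(2n)}$, the height of the regular unit-edged $n$-simplex. Let $V=\tfrac12\mathrm{Vol}(S^{n-1})$. Let $\alpha:C(K)\to(0,V]$ be the greatest solid angle at a vertex, extended by $\alpha=V$ to degenerate configurations, let $\beta=3-4\alpha/V$, and let $\bar\beta=\min(1,\max(0,\beta))$. If $\alpha(x)>V/2$, the *preferred apex* of $x$ is the unique vertex whose solid angle exceeds $V/2$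 or, if $x$ is degenerate, the unique vertex in the convex hull of the others. A *regularizing deformation retraction of simplices* is a continuous map $R:[0,1]\times S\to S$ with $R_0=\mathrm{id}$, with $R_1(x)$ regular for every $x$, and with $R_t(x)$ regular for every $t$ whenever $x$ is regular. (A regular simplex may have any edge length.) **Proposition.** For every regularizing deformation retraction of simplices $R$ there is a continuous map $H:[0,1]\times C(K)\to C(K)$ with $H_0=\mathrm{id}$ and $H_1(C(K))\subseteq P(K)$ that glues $R$ to a preferred-apex retraction, in the following sense. 1. For $t\le\frac12$: $H_t(x)=R_{2t\bar\beta(x)}(x)$ if $x\in S$, and $H_t(x)=x$ if $x\notin S$. In particular $H$ extends $R$ from the simplices with $\alpha(x)\le V/2$: there $H_t(x)=R_{2t}(x)$ for $t\le \frac12$. For these simplices and $t\ge\frac12$, $H_t(x)$ is obtained from the regular simplex $R_1(x)$ by scaling by a positive factor and translating. 2. Suppose $\alpha(x)>V/2$. Label the vertices of $x$, let $v$ be the preferred apex of $x$, and follow the vertices continuously along $t\mapsto H_t(x)$; let $F$ be the face opposite $v$. For $\frac12\le t\le\frac34$ the face $F$ is fixed, and $v$ moves (affinely in $t$) along the straight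 segment parallel to $F$ to the point over the barycenter of $F$. For $\frac34\le t\le 1$ the vertex $v$ stays on the perpendicular line through the barycenter of $F$ and the direction space of $F$ is constant. At $t=1$ the configuration is a pyramid with apex $v$. 3. Pyramids with $\beta\le0$ do not move under $H$. Other pyramids may move under $H$. This can be repaired by changing $H$ only near $P(K)$: for every open $U\supseteq P(K)$ there is a strong deformation retraction $G:[0,1]\times C(K)\to C(K)$ of $C(K)$ onto $P(K)$ ($G$ continuous, $G_0=\mathrm{id}$, $G_1(C(K))\subseteq P(K)$, and $G_t(y)=y$ for all $y\in P(K)$ and all $t$) with $G_t(x)=H_t(x)$ for all $t$ and all $x\notin U$. -/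

import Mathlib

open MeasureTheory Topology

noncomputable section

namespace SkeletonConfig

/-- Euclidean `n`-space. -/
abbrev Eucl (n : ℕ) : Type := EuclideanSpace ℝ (Fin n)

/-! ### The configuration space -/

/-- The geometric realization of `K`, the `(n-2)`-skeleton of the `n`-simplex, in barycentric
coordinates: at most `n - 1` of the `n + 1` coordinates are nonzero. -/
def skeletonK (n : ℕ) : Set (Fin (n + 1) → ℝ) :=
  {w | w ∈ stdSimplex ℝ (Fin (n + 1)) ∧ {i | w i ≠ 0}.ncard + 1 ≤ n}

/-- The vertices `p 0, …, p n` determine a linear embedding of `K`: the map `K → ℝⁿ` which is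
linear on simplices and sends the `i`-th vertex to `p i` is injective
(hence a topological embedding, as `K` is compact). -/
def IsLinearEmbedding {n : ℕ} (p : Fin (n + 1) → Eucl n) : Prop :=
  Set.InjOn (fun w : Fin (n + 1) → ℝ => ∑ i, w i • p i) (skeletonK n)

/-- The space of linear embeddings of `K` in `ℝⁿ`, topologized by the positions of the vertices. -/
abbrev EK (n : ℕ) : Type := {p : Fin (n + 1) → Eucl n // IsLinearEmbedding p}

/-- Two embeddings are identified when they differ by an automorphism of `K`,
that is, by a permutation of the vertices. -/
def relabelSetoid (n : ℕ) : Setoid (EK n) where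
  r p q := ∃ σ : Equiv.Perm (Fin (n + 1)), q.1 = p.1 ∘ σ
  iseqv :=
    { refl := fun _ => ⟨1, rfl⟩
      symm := by
        rintro p q ⟨σ, h⟩
        exact ⟨σ⁻¹, by rw [h]; funext i; simp⟩
      trans := by
        rintro p q r ⟨σ, h⟩ ⟨τ, h'⟩
        exact ⟨σ * τ, by rw [h', h]; funext i; simp⟩ }

/-- The configuration space `C(K)` of unlabeled linearly embedded copies of `K` in `ℝⁿ`,
with the quotient topology. -/
def CK (n : ℕ) : Type := Quotient (relabelSetoid n)

instance (n : ℕ) : TopologicalSpace (CK n) :=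
  inferInstanceAs (TopologicalSpace (Quotient (relabelSetoid n)))

/-- The unlabeled configuration of a labeled one. -/
def unlabel {n : ℕ} (p : EK n) : CK n := Quotient.mk (relabelSetoid n) p

/-- The configuration spans a nondegenerate `n`-simplex. -/
def IsSimplex {n : ℕ} (x : CK n) : Prop :=
  ∃ p : EK n, unlabel p = x ∧ AffineIndependent ℝ p.1

/-- The space of unlabeled nondegenerate simplices, as a subspace of `C(K)`. -/
abbrev SimplexSpace (n : ℕ) : Type := {x : CK n // IsSimplex x}

/-- All edges of the configuration have the same (positive) length. -/
def IsRegular {n : ℕ} (x : CK n) : Prop :=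
  ∃ p : EK n, unlabel p = x ∧ ∃ l : ℝ, 0 < l ∧ ∀ i j, i ≠ j → dist (p.1 i) (p.1 j) = l

/-- The subspace of regular simplices. -/
def regularSimplices (n : ℕ) : Set (SimplexSpace n) := {x | IsRegular x.1}

/-! ### Pyramids -/

/-- The direction space of the face opposite to the vertex `v`. -/
def faceDirection {n : ℕ} (p : Fin (n + 1) → Eucl n) (v : Fin (n + 1)) :
    Submodule ℝ (Eucl n) :=
  vectorSpan ℝ (p '' {v}ᶜ)

/-- The barycenter of the face opposite to the vertex `v`. -/
def faceBarycenter {n : ℕ} (p : Fin (n + 1) → Eucl n) (v : Fin (n + 1)) : Eucl n :=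
  (n : ℝ)⁻¹ • ∑ i ∈ Finset.univ.erase v, p i

/-- The vertex `v` lies on the line through the barycenter of its opposite face that is
perpendicular to this face. -/
def IsOverBarycenter {n : ℕ} (p : Fin (n + 1) → Eucl n) (v : Fin (n + 1)) : Prop :=
  p v - faceBarycenter p v ∈ (faceDirection p v)ᗮ

/-- A pyramid with apex `v`: the opposite face is regular with unit edges, the apex is over the
barycenter of that face, the barycenter of the whole configuration is the origin, and the height
is at most that of the regular `n`-simplex with unit edges. -/
def IsPyramid {n : ℕ} (p : Fin (n + 1) → Eucl n) (v : Fin (n + 1)) : Prop :=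
  (∀ i j, i ≠ v → j ≠ v → i ≠ j → dist (p i) (p j) = 1) ∧
    IsOverBarycenter p v ∧
    ∑ i, p i = 0 ∧
    dist (p v) (faceBarycenter p v) ≤ Real.sqrt (((n : ℝ) + 1) / (2 * n))

/-- The pyramidal space `P(K)`. -/
def PK (n : ℕ) : Set (CK n) := {x | ∃ p : EK n, ∃ v, unlabel p = x ∧ IsPyramid p.1 v}

/-! ### Solid angles -/

/-- The solid angle at the vertex `v`: the surface measure of the set of unit vectors in the cone
spanned by the edges emanating from `v`. -/
def solidAngle {n : ℕ} (p : Fin (n + 1) → Eucl n) (v : Fin (n + 1)) : ℝ :=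
  ((volume : Measure (Eucl n)).toSphere
    {u | ∃ a : Fin (n + 1) → ℝ, (∀ j, 0 ≤ a j) ∧ (u : Eucl n) = ∑ j, a j • (p j - p v)}).toReal

/-- Half of the surface measure of the unit sphere in `ℝⁿ`. -/
def halfSphere (n : ℕ) : ℝ :=
  ((volume : Measure (Eucl n)).toSphere Set.univ).toReal / 2

open Classical in
/-- The greatest solid angle of a labeled configuration; on degenerate configurations it is
extended by the value `halfSphere n`. -/
def maxSolidAngle {n : ℕ} (p : Fin (n + 1) → Eucl n) : ℝ :=
  if AffineIndependent ℝ p then ⨆ v, solidAngle p v else halfSphere n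

theorem solidAngle_comp {n : ℕ} (p : Fin (n + 1) → Eucl n) (σ : Equiv.Perm (Fin (n + 1)))
    (v : Fin (n + 1)) : solidAngle (p ∘ σ) v = solidAngle p (σ v) := by
  unfold solidAngle
  congr 2
  ext u
  constructor
  · rintro ⟨a, ha, h⟩
    refine ⟨a ∘ σ.symm, fun j => ha _, ?_⟩
    rw [h]
    exact Fintype.sum_equiv σ _ _ (fun j => by simp)
  · rintro ⟨a, ha, h⟩
    refine ⟨a ∘ σ, fun j => ha _, ?_⟩
    rw [h]
    exact (Fintype.sum_equiv σ _ _ (fun j => by simp)).symm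

theorem maxSolidAngle_comp {n : ℕ} (p : Fin (n + 1) → Eucl n)
    (σ : Equiv.Perm (Fin (n + 1))) : maxSolidAngle (p ∘ σ) = maxSolidAngle p := by
  unfold maxSolidAngle
  have h1 : AffineIndependent ℝ (p ∘ σ) ↔ AffineIndependent ℝ p :=
    affineIndependent_equiv σ
  have h2 : (⨆ v, solidAngle (p ∘ σ) v) = ⨆ v, solidAngle p v := by
    simp only [solidAngle_comp]
    exact σ.iSup_comp (g := fun v => solidAngle p v)
  by_cases h : AffineIndependent ℝ p
  · rw [if_pos h, if_pos (h1.2 h), h2]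
  · rw [if_neg h, if_neg (fun h' => h (h1.1 h'))]

/-- The function `α` on `C(K)`. -/
def alpha {n : ℕ} (x : CK n) : ℝ :=
  Quotient.lift (fun p : EK n => maxSolidAngle p.1)
    (by
      rintro p q ⟨σ, h⟩
      show maxSolidAngle p.1 = maxSolidAngle q.1
      rw [h, maxSolidAngle_comp]) x

/-- The reparametrization `β = 3 - 4 α / V` of `α`: it equals `1` where `α = V / 2` and `0` where
`α = 3 V / 4`. -/
def beta {n : ℕ} (x : CK n) : ℝ := 3 - 4 * alpha x / halfSphere n

/-- `v` is the preferred apex of the labeled configuration `p`: either `p` spans a simplex whose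
solid angle at `v` is greater than half of the maximal value, or `p` is degenerate and `v` lies
in the convex hull of the other vertices. -/
def IsPreferredApex {n : ℕ} (p : Fin (n + 1) → Eucl n) (v : Fin (n + 1)) : Prop :=
  (AffineIndependent ℝ p ∧ halfSphere n / 2 < solidAngle p v) ∨
    (¬ AffineIndependent ℝ p ∧ p v ∈ convexHull ℝ (p '' {v}ᶜ))

/-- The point over the barycenter of the face opposite to `v` which is reached from `p v` by moving
parallel to that face. -/
def apexTarget {n : ℕ} (p : Fin (n + 1) → Eucl n) (v : Fin (n + 1)) : Eucl n :=
  p v + (faceDirection p v).starProjection (faceBarycenter p v - p v)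

/-! ### Deformation retractions -/

/-- The point of the unit interval nearest to the real number `s`. -/
def clampI (s : ℝ) : unitInterval := Set.projIcc 0 1 zero_le_one s

/-- A deformation of `X` into `A`: the conditions common to all notions of deformation
retraction. -/
structure IsDeformationInto {X : Type*} [TopologicalSpace X] (A : Set X)
    (F : unitInterval → X → X) : Prop where
  continuous : Continuous (Function.uncurry F)
  zero : ∀ x, F 0 x = x
  one : ∀ x, F 1 x ∈ A

/-- A deformation retraction in the weak sense: the points of `A` may move, but within `A`. -/
structure IsWeakDeformationRetraction {X : Type*} [TopologicalSpace X] (A : Set X)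
    (F : unitInterval → X → X) : Prop extends IsDeformationInto A F where
  stays : ∀ t, ∀ a ∈ A, F t a ∈ A

/-- A (strong) deformation retraction: the points of `A` do not move. -/
structure IsDeformationRetraction {X : Type*} [TopologicalSpace X] (A : Set X)
    (F : unitInterval → X → X) : Prop extends IsDeformationInto A F where
  fixed : ∀ t, ∀ a ∈ A, F t a = a

/-- The second half of the gluing at configurations which have a preferred apex: the path
`q` of labeled configurations, on the times `[1/2, 1]`, is the preferred-apex
retraction. During `[1/2, 3/4]` the face opposite to `v` is fixed and `v` moves on a straight line
parallel to that face until it is over its barycenter. During `[3/4, 1]` it stays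
over the barycenter and the face stays parallel to itself, until a pyramid is reached. -/
structure IsPreferredApexPath {n : ℕ} (q : unitInterval → EK n) (v : Fin (n + 1)) : Prop where
  face : ∀ t : unitInterval, 1 / 2 ≤ (t : ℝ) → (t : ℝ) ≤ 3 / 4 → ∀ j, j ≠ v →
    (q t).1 j = (q (clampI (1 / 2))).1 j
  apex : ∀ t : unitInterval, 1 / 2 ≤ (t : ℝ) → (t : ℝ) ≤ 3 / 4 →
    (q t).1 v = AffineMap.lineMap ((q (clampI (1 / 2))).1 v)
      (apexTarget (q (clampI (1 / 2))).1 v) (4 * (t : ℝ) - 2)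
  overBarycenter : ∀ t : unitInterval, 3 / 4 ≤ (t : ℝ) → IsOverBarycenter (q t).1 v
  parallel : ∀ t : unitInterval, 3 / 4 ≤ (t : ℝ) →
    faceDirection (q t).1 v = faceDirection (q (clampI (3 / 4))).1 v
  pyramid : IsPyramid (q 1).1 v

/-- `H` is obtained by gluing the regularization `R` to a preferred-apex retraction by means of
the parameter `β`. -/
structure IsGluing {n : ℕ} (R : unitInterval → SimplexSpace n → SimplexSpace n)
    (H : unitInterval → CK n → CK n) : Prop where
  /-- Until time `1/2`, the fraction `β` (clamped to `[0, 1]`) of the regularization is done. -/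
  regularize : ∀ (t : unitInterval) (x : SimplexSpace n), (t : ℝ) ≤ 1 / 2 →
    H t x.1 = (R (clampI (2 * (t : ℝ) * (clampI (beta x.1) : ℝ))) x).1
  /-- Until time `1/2`, the degenerate configurations rest. -/
  rest : ∀ (t : unitInterval) (x : CK n), (t : ℝ) ≤ 1 / 2 → ¬ IsSimplex x → H t x = x
  /-- Where `β ≥ 1` (that is, `α ≤ V / 2`), the regular simplex reached at time `1/2` is thereafter
  only rescaled and translated. -/
  normalize : ∀ (t : unitInterval) (x : SimplexSpace n), 1 / 2 ≤ (t : ℝ) → 1 ≤ beta x.1 →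
    ∃ (p q : EK n) (c : ℝ) (b : Eucl n), unlabel p = (R 1 x).1 ∧ unlabel q = H t x.1 ∧
      0 < c ∧ ∀ i, q.1 i = c • p.1 i + b
  /-- Where there is a preferred apex (that is, `α > V / 2`), this vertex is followed along the
  path, and the second half of the path is the preferred-apex retraction. -/
  preferredApex : ∀ (p : EK n) (v : Fin (n + 1)), IsPreferredApex p.1 v →
    ∃ q : unitInterval → EK n, Continuous q ∧ q 0 = p ∧
      (∀ t, unlabel (q t) = H t (unlabel p)) ∧ IsPreferredApexPath q v
  /-- Pyramids with `β ≤ 0` do not move. -/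
  fixed : ∀ (t : unitInterval) (x : CK n), x ∈ PK n → beta x ≤ 0 → H t x = x

end SkeletonConfig

end

/-! An affine dependency among the vertices splits into its positive and negative parts, and these
are colliding points of `K` unless one of them involves `n` vertices. So the embeddings are the
configurations in which every nonzero dependency has one coefficient of sign opposite to all the
others (`isLinearEmbedding_iff`). Any `n` vertices are then affinely independent, and a degenerate
configuration has exactly one vertex, which lies in the interior of the simplex spanned by the
others. Permutations act freely on labeled configurations, so `unlabel` is a covering: homotopies
lift, and equivariant ones descend.

The engine is `IsApexChoice.glue`. A deformation `F` of labeled configurations is followed by an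
explicit retraction `phi` towards pyramids with a chosen apex. During `phi` the apex slides over the
barycenter of its face; then the configuration moves on a straight line to a pyramid whose face is
the symmetric orthonormalization of the given face, scaled to unit edges. Face and
orthonormalization differ by a positive definite matrix, and segments of positive definite matrices
stay positive definite, so the face stays independent and keeps its direction. The chosen apex is
locally constant where it exists. Where there is none, `F` must end in an equilateral simplex, on
which `phi` only scales and translates and hence does not depend on the apex
(`phi_of_isEquilateral`). This makes the glued map continuous.

For `H`, the map `F` lifts `R` slowed down by the clamped `β`, and the choice is the preferred apex.
The solid angle equals half of the normalized volume of a double cone described by signs of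
determinants. In this form it makes sense on all of `E(K)`, is continuous by dominated convergence,
and takes the value `V` at an interior vertex. Different double cones overlap in null sets, so two
angles add up to at most `V` and the preferred apex is unique. Since `β = -1` at degenerate
configurations, the slowed-down `R` rests near them and extends continuously.

For `G`, the same engine yields a strong deformation retraction `D` onto `P(K)`. The apex is now a
vertex of positive `flatness`, and `F` moves a simplex towards a regular simplex flattened along
that apex by just the amount that leaves pyramids where they are. A Urysohn function for `P(K)` and
the complement of `U` then interpolates between `H` and `D` (`exists_repair`). -/

open MeasureTheory Topology

noncomputable section

namespace SkeletonConfig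

set_option linter.unusedSectionVars false

/-! ### Symmetric orthonormalization of families with linear relations -/

section Polar

open Matrix
open scoped MatrixOrder

variable {ι : Type*} [Fintype ι] [DecidableEq ι]

/-- The inverse of the positive definite square root. -/
def invSqrt (A : Matrix ι ι ℝ) : Matrix ι ι ℝ := (CFC.sqrt A)⁻¹

theorem posDef_sqrt {A : Matrix ι ι ℝ} (hA : A.PosDef) : (CFC.sqrt A).PosDef :=
  isStrictlyPositive_iff_posDef.1 ((isStrictlyPositive_iff_posDef.2 hA).sqrt)

theorem posDef_invSqrt {A : Matrix ι ι ℝ} (hA : A.PosDef) : (invSqrt A).PosDef :=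
  (posDef_sqrt hA).inv

theorem sqrt_mul_invSqrt {A : Matrix ι ι ℝ} (hA : A.PosDef) : CFC.sqrt A * invSqrt A = 1 :=
  mul_nonsing_inv _ ((Matrix.isUnit_iff_isUnit_det _).1 (posDef_sqrt hA).isUnit)

theorem invSqrt_mul_sqrt {A : Matrix ι ι ℝ} (hA : A.PosDef) : invSqrt A * CFC.sqrt A = 1 :=
  nonsing_inv_mul _ ((Matrix.isUnit_iff_isUnit_det _).1 (posDef_sqrt hA).isUnit)

theorem sqrt_mul_sqrt {A : Matrix ι ι ℝ} (hA : A.PosDef) : CFC.sqrt A * CFC.sqrt A = A :=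
  CFC.sqrt_mul_sqrt_self A hA.posSemidef.nonneg

theorem invSqrt_mul_mul_invSqrt {A : Matrix ι ι ℝ} (hA : A.PosDef) :
    invSqrt A * A * invSqrt A = 1 := by
  calc _ = invSqrt A * (CFC.sqrt A * CFC.sqrt A) * invSqrt A := by rw [sqrt_mul_sqrt hA]
    _ = (invSqrt A * CFC.sqrt A) * (CFC.sqrt A * invSqrt A) := by simp only [mul_assoc]
    _ = 1 := by rw [invSqrt_mul_sqrt hA, sqrt_mul_invSqrt hA, one_mul]

theorem sqrt_eq_of_mul_self {A B : Matrix ι ι ℝ} (hB : B.PosDef) (h : B * B = A) :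
    CFC.sqrt A = B :=
  CFC.sqrt_unique h hB.posSemidef.nonneg

/-- Positive square roots are unique, so they commute with simultaneous permutations of rows and
columns. Equivariance of the orthonormalization under relabeling rests on this. -/
theorem invSqrt_submatrix {A : Matrix ι ι ℝ} (hA : A.PosDef) (σ : Equiv.Perm ι) :
    invSqrt (A.submatrix σ σ) = (invSqrt A).submatrix σ σ := by
  have h : CFC.sqrt (A.submatrix σ σ) = (CFC.sqrt A).submatrix σ σ := by
    apply sqrt_eq_of_mul_self ((posDef_sqrt hA).submatrix σ.injective)
    rw [submatrix_mul_equiv, sqrt_mul_sqrt hA]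
  rw [invSqrt, h, invSqrt, inv_submatrix_equiv]

section
open scoped Matrix.Norms.L2Operator

theorem continuousOn_invSqrt : ContinuousOn (invSqrt (ι := ι)) {A | A.PosDef} := by
  have h1 : ContinuousOn (CFC.sqrt : Matrix ι ι ℝ → Matrix ι ι ℝ) {A | A.PosDef} :=
    CFC.continuousOn_sqrt.mono fun A hA => hA.posSemidef.nonneg
  intro A hA
  have h2 := h1 A hA
  have h3 : ContinuousAt (fun B : Matrix ι ι ℝ => B⁻¹) (CFC.sqrt A) := by
    have hdet : (CFC.sqrt A).det ≠ 0 := (posDef_sqrt hA).det_pos.ne'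
    have : (fun B : Matrix ι ι ℝ => B⁻¹) = fun B => (B.det)⁻¹ • B.adjugate := by
      funext B
      rw [Matrix.inv_def, Ring.inverse_eq_inv']
    rw [this]
    exact ((continuous_id.matrix_det.continuousAt).inv₀ hdet).smul
      continuous_id.matrix_adjugate.continuousAt
  exact h3.comp_continuousWithinAt h2

end

variable {E : Type*} [NormedAddCommGroup E] [InnerProductSpace ℝ E]

/-- The family obtained from `f` by taking the linear combinations given by the columns of `B`. -/
def act (f : ι → E) (B : Matrix ι ι ℝ) : ι → E := fun j => ∑ i, B i j • f i

theorem act_act (f : ι → E) (A B : Matrix ι ι ℝ) : act (act f A) B = act f (A * B) := by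
  funext j
  simp only [act, Finset.smul_sum, smul_smul, mul_apply, Finset.sum_smul]
  rw [Finset.sum_comm]
  exact Finset.sum_congr rfl fun i _ => Finset.sum_congr rfl fun k _ => by rw [mul_comm]

theorem act_one (f : ι → E) : act f (1 : Matrix ι ι ℝ) = f := by
  funext j
  simp [act, Matrix.one_apply]

theorem act_add (f : ι → E) (A B : Matrix ι ι ℝ) : act f (A + B) = act f A + act f B := by
  funext j
  simp [act, add_smul, Finset.sum_add_distrib]

theorem act_smul (f : ι → E) (c : ℝ) (B : Matrix ι ι ℝ) : act f (c • B) = c • act f B := by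
  funext j
  simp [act, Finset.smul_sum, smul_smul]

theorem gram_act (f : ι → E) (B : Matrix ι ι ℝ) : gram ℝ (act f B) = Bᵀ * gram ℝ f * B := by
  ext i j
  simp only [gram_apply, act, sum_inner, inner_sum, mul_apply, transpose_apply, Finset.sum_mul,
    real_inner_smul_left, real_inner_smul_right]
  exact Finset.sum_congr rfl fun i _ => Finset.sum_congr rfl fun k _ => by ring

theorem act_comp (f : ι → E) (B : Matrix ι ι ℝ) (σ : Equiv.Perm ι) :
    act (f ∘ σ) (B.submatrix σ σ) = act f B ∘ σ := by
  funext j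
  exact Fintype.sum_equiv σ _ _ fun i => rfl

theorem gram_comp (f : ι → E) (σ : Equiv.Perm ι) :
    gram ℝ (f ∘ σ) = (gram ℝ f).submatrix σ σ := rfl

theorem gram_mul_eq_zero {f : ι → E} {N : Matrix ι ι ℝ} (h : act f N = 0) :
    gram ℝ f * N = 0 := by
  ext i j
  have : inner ℝ (f i) (act f N j) = 0 := by rw [h]; simp
  simp only [act, inner_sum, real_inner_smul_right] at this
  simp only [mul_apply, gram_apply, Matrix.zero_apply]
  rw [← this]
  exact Finset.sum_congr rfl fun k _ => mul_comm _ _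

/-- The family obtained from `f` by symmetric orthonormalization modulo the relations given by the
projection matrix `N`. -/
def polar (N : Matrix ι ι ℝ) (f : ι → E) : ι → E := act f (invSqrt (gram ℝ f + N))

/-- `N` is a symmetric projection onto the relations of the family `f`. -/
structure IsRelationProj (N : Matrix ι ι ℝ) (f : ι → E) : Prop where
  symm : Nᵀ = N
  idem : N * N = N
  act_eq : act f N = 0
  posDef : (gram ℝ f + N).PosDef

variable {N : Matrix ι ι ℝ} {f : ι → E}

/-- With `B` the square root, `B * B` fixes the range of `N`, so `(B + 1) * (B * N - N) = B * B * N
- N = 0`; and `B + 1` is invertible because `B` is positive. -/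
theorem IsRelationProj.sqrt_mul (h : IsRelationProj N f) :
    CFC.sqrt (gram ℝ f + N) * N = N := by
  set B := CFC.sqrt (gram ℝ f + N)
  have hB : B.PosDef := posDef_sqrt h.posDef
  have h1 : B * B * N = N := by
    rw [sqrt_mul_sqrt h.posDef, add_mul, gram_mul_eq_zero h.act_eq, h.idem, zero_add]
  have h2 : (B + 1) * (B * N - N) = 0 := by
    rw [add_mul, mul_sub, ← mul_assoc, h1, one_mul]
    abel
  have h3 : IsUnit (B + 1) := (hB.add Matrix.PosDef.one).isUnit
  have h4 := (h3.mul_right_eq_zero).1 h2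
  exact sub_eq_zero.1 h4

theorem IsRelationProj.invSqrt_mul (h : IsRelationProj N f) :
    invSqrt (gram ℝ f + N) * N = N := by
  have := congrArg (invSqrt (gram ℝ f + N) * ·) h.sqrt_mul
  simpa only [← mul_assoc, invSqrt_mul_sqrt h.posDef, one_mul] using this.symm

theorem IsRelationProj.act_polar (h : IsRelationProj N f) : act (polar N f) N = 0 := by
  rw [polar, act_act, h.invSqrt_mul, h.act_eq]

/-- The inverse square root fixes the range of `N`. So conjugating `gram ℝ f + N` to the identity
leaves the summand `N` unchanged, and it can be subtracted. -/
theorem IsRelationProj.gram_polar (h : IsRelationProj N f) : gram ℝ (polar N f) = 1 - N := by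
  have hs : (invSqrt (gram ℝ f + N))ᵀ = invSqrt (gram ℝ f + N) :=
    (posDef_invSqrt h.posDef).isHermitian
  have hN : invSqrt (gram ℝ f + N) * N * invSqrt (gram ℝ f + N) = N := by
    rw [h.invSqrt_mul]
    have := congrArg Matrix.transpose h.invSqrt_mul
    rwa [transpose_mul, hs, h.symm] at this
  rw [polar, gram_act, hs]
  have := invSqrt_mul_mul_invSqrt h.posDef
  rw [mul_add, add_mul, hN] at this
  exact eq_sub_of_add_eq this

theorem IsRelationProj.act_polar_sqrt (h : IsRelationProj N f) :
    act (polar N f) (CFC.sqrt (gram ℝ f + N)) = f := by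
  rw [polar, act_act, invSqrt_mul_sqrt h.posDef, act_one]

theorem gram_act_add {z : ι → E} {B : Matrix ι ι ℝ} (hB : B.PosDef) (hN : Nᵀ = N)
    (hBN : B * N = N) (hz : gram ℝ z = 1 - N) : gram ℝ (act z B) + N = B * B := by
  have hs : Bᵀ = B := hB.isHermitian
  have hNB : N * B = N := by
    have := congrArg Matrix.transpose hBN
    rwa [transpose_mul, hs, hN] at this
  rw [gram_act, hs, hz, mul_sub, sub_mul, mul_one, hBN, hNB, sub_add_cancel]

/-- Uniqueness of the polar decomposition: `B` is the positive square root of the corrected Gram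
matrix of `act z B`. Frames are identified below by guessing `z` and `B`. -/
theorem polar_act {z : ι → E} {B : Matrix ι ι ℝ} (hB : B.PosDef) (hN : Nᵀ = N)
    (hBN : B * N = N) (hz : gram ℝ z = 1 - N) : polar N (act z B) = z := by
  rw [polar, gram_act_add hB hN hBN hz, invSqrt, sqrt_eq_of_mul_self hB rfl, act_act,
    mul_nonsing_inv _ ((Matrix.isUnit_iff_isUnit_det _).1 hB.isUnit), act_one]

theorem polar_comp (h : IsRelationProj N f) (σ : Equiv.Perm ι) :
    polar (N.submatrix σ σ) (f ∘ σ) = polar N f ∘ σ := by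
  rw [polar, gram_comp, polar, ← act_comp, ← invSqrt_submatrix h.posDef]
  rfl

theorem continuous_polar {X : Type*} [TopologicalSpace X] {g : X → ι → E} (hg : Continuous g)
    (h : ∀ x, (gram ℝ (g x) + N).PosDef) : Continuous fun x => polar N (g x) := by
  have h1 : Continuous fun x => gram ℝ (g x) + N := by
    refine Continuous.add (continuous_matrix fun i j => ?_) continuous_const
    simp only [gram_apply]
    exact ((continuous_apply i).comp hg).inner ((continuous_apply j).comp hg)
  have h2 : Continuous fun x => invSqrt (gram ℝ (g x) + N) :=
    continuousOn_invSqrt.comp_continuous h1 h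
  refine continuous_pi fun j => ?_
  exact continuous_finsetSum _ fun i _ =>
    (h2.matrix_elem i j).smul ((continuous_apply i).comp hg)

theorem norm_sq_sum_smul (f : ι → E) (x : ι → ℝ) :
    ‖∑ i, x i • f i‖ ^ 2 = x ⬝ᵥ (gram ℝ f *ᵥ x) := by
  rw [← real_inner_self_eq_norm_sq]
  simp only [sum_inner, inner_sum, real_inner_smul_left, real_inner_smul_right, dotProduct,
    mulVec, gram_apply, Finset.mul_sum]
  exact Finset.sum_congr rfl fun i _ => Finset.sum_congr rfl fun k _ => by
    rw [real_inner_comm]; ring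

/-- Positive definiteness of `gram f + N` means that all relations of `f` are in the range
of `N`. -/
theorem posDef_gram_add (hs : Nᵀ = N) (hi : N * N = N)
    (h : ∀ x : ι → ℝ, ∑ i, x i • f i = 0 → N *ᵥ x = 0 → x = 0) : (gram ℝ f + N).PosDef := by
  refine Matrix.PosDef.of_dotProduct_mulVec_pos ?_ fun {x} hx => ?_
  · refine Matrix.IsHermitian.add ?_ ?_
    · ext i j
      simp [gram_apply, real_inner_comm]
    · ext i j
      simpa using congrFun (congrFun hs i) j
  · have e1 : x ⬝ᵥ (N *ᵥ x) = (N *ᵥ x) ⬝ᵥ (N *ᵥ x) := by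
      conv_lhs => rw [← hi, ← mulVec_mulVec, dotProduct_mulVec, ← mulVec_transpose, hs]
    have e : star x ⬝ᵥ ((gram ℝ f + N) *ᵥ x) =
        ‖∑ i, x i • f i‖ ^ 2 + (N *ᵥ x) ⬝ᵥ (N *ᵥ x) := by
      rw [add_mulVec, dotProduct_add, norm_sq_sum_smul, star_trivial, e1]
    rw [e]
    have h1 : 0 ≤ ‖∑ i, x i • f i‖ ^ 2 := by positivity
    have h2 : 0 ≤ (N *ᵥ x) ⬝ᵥ (N *ᵥ x) := by
      simpa using dotProduct_star_self_nonneg (N *ᵥ x)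
    by_contra hc
    have h3 : ‖∑ i, x i • f i‖ ^ 2 = 0 := by linarith
    have h4 : (N *ᵥ x) ⬝ᵥ (N *ᵥ x) = 0 := by linarith
    exact hx (h x (by simpa using h3) (dotProduct_self_eq_zero.1 h4))

end Polar

/-! ### Linear embeddings of the skeleton in terms of affine dependencies -/

section Dependencies

variable {n : ℕ}

/-- `c` is an affine dependency of the points of `p`. -/
def IsDep (p : Fin (n + 1) → Eucl n) (c : Fin (n + 1) → ℝ) : Prop :=
  ∑ i, c i = 0 ∧ ∑ i, c i • p i = 0

theorem IsDep.smul {p : Fin (n + 1) → Eucl n} {c : Fin (n + 1) → ℝ} (h : IsDep p c) (a : ℝ) :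
    IsDep p (a • c) := by
  constructor
  · simp [← Finset.mul_sum, h.1]
  · simp [mul_smul, ← Finset.smul_sum, h.2]

theorem IsDep.add {p : Fin (n + 1) → Eucl n} {c d : Fin (n + 1) → ℝ} (h : IsDep p c)
    (h' : IsDep p d) : IsDep p (c + d) := by
  constructor
  · simp [Finset.sum_add_distrib, h.1, h'.1]
  · simp [add_smul, Finset.sum_add_distrib, h.2, h'.2]

theorem affineIndependent_iff_isDep {p : Fin (n + 1) → Eucl n} :
    AffineIndependent ℝ p ↔ ∀ c, IsDep p c → c = 0 := by
  rw [affineIndependent_iff]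
  constructor
  · intro h c hc
    funext i
    exact h Finset.univ c hc.1 hc.2 i (Finset.mem_univ i)
  · intro h s w h1 h2 i hi
    have := h (fun j => if j ∈ s then w j else 0)
      ⟨by simpa using h1, by simpa [ite_smul] using h2⟩
    simpa [hi] using congrFun this i

/-- The coefficient at `v` has a sign opposite to the signs of all other coefficients. -/
def IsSplitAt (c : Fin (n + 1) → ℝ) (v : Fin (n + 1)) : Prop :=
  c v ≠ 0 ∧ ∀ j, j ≠ v → c j * c v < 0

theorem exists_isSplitAt_of_card {c : Fin (n + 1) → ℝ} (hn : 2 ≤ n) (h0 : ∑ i, c i = 0)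
    (hcard : n ≤ {i | 0 < c i}.ncard) : ∃ v, IsSplitAt c v := by
  classical
  have hneg : ∃ v, c v < 0 := by
    by_contra! hc
    have h1 := (Finset.sum_eq_zero_iff_of_nonneg fun i _ => hc i).1 h0
    have : {i | 0 < c i} = ∅ := by
      ext i
      simp [h1 i (Finset.mem_univ i)]
    rw [this, Set.ncard_empty] at hcard
    omega
  obtain ⟨v, hv⟩ := hneg
  refine ⟨v, hv.ne, fun j hj => mul_neg_of_pos_of_neg ?_ hv⟩
  have hsub : {i | 0 < c i} ⊆ {v}ᶜ := by
    intro i hi hiv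
    rw [Set.mem_singleton_iff.1 hiv] at hi
    exact absurd hi (not_lt.2 hv.le)
  have hc : ({v}ᶜ : Set (Fin (n + 1))).ncard = n := by
    rw [Set.ncard_compl]; simp
  have := Set.eq_of_subset_of_ncard_le hsub (by rw [hc]; exact hcard)
  have hj' : j ∈ ({v}ᶜ : Set (Fin (n + 1))) := hj
  rw [← this] at hj'
  exact hj'

/-- Points of the simplex with equal image differ by a dependency, and every dependency arises in
this way up to scaling. Only a split of `n` vertices against one cannot be realized by two points of
`K`, whose supports have at most `n - 1` elements. -/
theorem isLinearEmbedding_iff (hn : 2 ≤ n) {p : Fin (n + 1) → Eucl n} :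
    IsLinearEmbedding p ↔ ∀ c, IsDep p c → c ≠ 0 → ∃ v, IsSplitAt c v := by
  constructor
  · intro hp c hc hc0
    by_contra hno
    have hP : {i | 0 < c i}.ncard < n := by
      by_contra! h
      exact hno (exists_isSplitAt_of_card hn hc.1 h)
    have hQ : {i | 0 < (-c) i}.ncard < n := by
      by_contra! h
      obtain ⟨v, hv⟩ := exists_isSplitAt_of_card (c := -c) hn (by simp [hc.1]) h
      refine hno ⟨v, by simpa using hv.1, fun j hj => by simpa using hv.2 j hj⟩
    have hsum : ∑ i, max (c i) 0 = ∑ i, max (-c i) 0 := by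
      rw [← sub_eq_zero, ← Finset.sum_sub_distrib]
      refine Eq.trans ?_ hc.1
      refine Finset.sum_congr rfl fun i _ => ?_
      rcases le_total (c i) 0 with h | h
      · rw [max_eq_right h, max_eq_left (by linarith)]; ring
      · rw [max_eq_left h, max_eq_right (by linarith)]; ring
    have hsumv : ∑ i, max (c i) 0 • p i = ∑ i, max (-c i) 0 • p i := by
      rw [← sub_eq_zero, ← Finset.sum_sub_distrib]
      refine Eq.trans ?_ hc.2
      refine Finset.sum_congr rfl fun i _ => ?_
      rw [← sub_smul]
      congr 1
      rcases le_total (c i) 0 with h | h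
      · rw [max_eq_right h, max_eq_left (by linarith)]; ring
      · rw [max_eq_left h, max_eq_right (by linarith)]; ring
    set s := ∑ i, max (c i) 0 with hs
    have hspos : 0 < s := by
      by_contra! h
      have h0 : s = 0 := le_antisymm h (Finset.sum_nonneg fun i _ => le_max_right _ _)
      have h1 := (Finset.sum_eq_zero_iff_of_nonneg fun i _ => le_max_right (c i) 0).1 (hs ▸ h0)
      have h2 := (Finset.sum_eq_zero_iff_of_nonneg fun i _ => le_max_right (-c i) 0).1
        (hsum ▸ h0)
      apply hc0
      funext i
      have a := h1 i (Finset.mem_univ i)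
      have b := h2 i (Finset.mem_univ i)
      simp only [max_eq_right_iff] at a b
      exact le_antisymm a (neg_nonpos.1 b)
    -- The positive and negative parts, divided by their common sum `s`, are two points of `K` with
    -- the same image.
    have key := @hp (fun i => max (c i) 0 / s) ?_ (fun i => max (-c i) 0 / s) ?_ ?_
    · apply hc0
      funext i
      have := congrFun key i
      rw [div_left_inj' hspos.ne'] at this
      rcases le_total (c i) 0 with h | h
      · rw [max_eq_right h, max_eq_left (by linarith)] at this; simp; linarith
      · rw [max_eq_left h, max_eq_right (by linarith)] at this; simp; linarith
    · refine ⟨⟨fun i => by positivity, by rw [← Finset.sum_div, div_self hspos.ne']⟩, ?_⟩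
      refine Nat.lt_of_le_of_lt (Set.ncard_le_ncard ?_) hP
      intro i hi
      by_contra h
      exact hi (by simp only [Set.mem_ofPred_eq, not_lt] at h; simp [h])
    · refine ⟨⟨fun i => by positivity, by rw [← Finset.sum_div, ← hsum, div_self hspos.ne']⟩, ?_⟩
      refine Nat.lt_of_le_of_lt (Set.ncard_le_ncard ?_) hQ
      intro i hi
      by_contra h
      exact hi (by simp at h; simp [h])
    · simp only [div_eq_inv_mul, mul_smul, ← Finset.smul_sum, hsumv]
  · intro h w hw w' hw' he
    by_contra hne
    -- A point exceeding another one at every vertex except `v` has `n` nonzero coordinates and is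
    -- not in `K`.
    have key : ∀ (a b : Fin (n + 1) → ℝ), a ∈ skeletonK n → b ∈ skeletonK n →
        ∀ v, (∀ j, j ≠ v → b j < a j) → False := by
      intro a b ha hb v hv
      have hsub : ({v}ᶜ : Set (Fin (n + 1))) ⊆ {i | a i ≠ 0} := fun j hj =>
        ((hb.1.1 j).trans_lt (hv j hj)).ne'
      have h1 := Set.ncard_le_ncard hsub
      have hc : ({v}ᶜ : Set (Fin (n + 1))).ncard = n := by
        rw [Set.ncard_compl]; simp
      have := ha.2
      omega
    obtain ⟨v, hv0, hv⟩ := h (w - w')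
      ⟨by simp [hw.1.2, hw'.1.2], by simpa [sub_smul, sub_eq_zero] using he⟩ (sub_ne_zero.2 hne)
    rcases lt_or_gt_of_ne hv0 with h0 | h0
    · refine key w w' hw hw' v fun j hj => ?_
      have := pos_of_mul_neg_left (hv j hj) h0.le
      simpa using this
    · refine key w' w hw' hw v fun j hj => ?_
      have := neg_of_mul_neg_left (hv j hj) h0.le
      simpa using this

theorem isLinearEmbedding_of_affineIndependent (hn : 2 ≤ n) {p : Fin (n + 1) → Eucl n}
    (hp : AffineIndependent ℝ p) : IsLinearEmbedding p :=
  (isLinearEmbedding_iff hn).2 fun c hc h0 => absurd (affineIndependent_iff_isDep.1 hp c hc) h0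

/-- The points of `p` other than `p v` are affinely independent. -/
def FaceIndep (p : Fin (n + 1) → Eucl n) (v : Fin (n + 1)) : Prop :=
  ∀ c, IsDep p c → c v = 0 → c = 0

theorem IsSplitAt.apply_ne_zero {c : Fin (n + 1) → ℝ} {v : Fin (n + 1)} (h : IsSplitAt c v)
    (j : Fin (n + 1)) : c j ≠ 0 := by
  by_cases hj : j = v
  · rw [hj]; exact h.1
  · exact left_ne_zero_of_mul (h.2 j hj).ne

/-- A dependency split at a vertex has no zero coefficient, so none is supported on a face. -/
theorem faceIndep (hn : 2 ≤ n) {p : Fin (n + 1) → Eucl n} (hp : IsLinearEmbedding p)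
    (v : Fin (n + 1)) : FaceIndep p v := by
  intro c hc hv
  by_contra h0
  obtain ⟨u, hu⟩ := (isLinearEmbedding_iff hn).1 hp c hc h0
  exact hu.apply_ne_zero v hv

/-- The point `p v` lies in the interior of the simplex spanned by the other points. -/
def IsInterior (p : Fin (n + 1) → Eucl n) (v : Fin (n + 1)) : Prop :=
  ∃ c, IsDep p c ∧ c v = -1 ∧ ∀ j, j ≠ v → 0 < c j

theorem IsInterior.not_affineIndependent {p : Fin (n + 1) → Eucl n} {v : Fin (n + 1)}
    (h : IsInterior p v) : ¬ AffineIndependent ℝ p := by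
  intro hp
  obtain ⟨c, hc, hv, -⟩ := h
  rw [affineIndependent_iff_isDep.1 hp c hc] at hv
  norm_num at hv

/-- Once one face is independent, the dependencies form at most a line. -/
theorem FaceIndep.eq_smul {p : Fin (n + 1) → Eucl n} {v : Fin (n + 1)} (h : FaceIndep p v)
    {c d : Fin (n + 1) → ℝ} (hc : IsDep p c) (hd : IsDep p d) (hv : c v = -1) :
    d = (-d v) • c := by
  have := h (d + d v • c) (hd.add (hc.smul _)) (by simp [hv])
  rw [neg_smul]
  exact eq_neg_of_add_eq_zero_left this

theorem isLinearEmbedding_of_isInterior (hn : 2 ≤ n) {p : Fin (n + 1) → Eucl n}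
    {v : Fin (n + 1)} (hf : FaceIndep p v) (hi : IsInterior p v) : IsLinearEmbedding p := by
  refine (isLinearEmbedding_iff hn).2 fun d hd h0 => ⟨v, fun hv => h0 (hf d hd hv), ?_⟩
  intro j hj
  obtain ⟨c, hc, hv, hpos⟩ := hi
  have e := hf.eq_smul hc hd hv
  have hdv : d v ≠ 0 := fun hv => h0 (hf d hd hv)
  have := congrFun e j
  simp only [Pi.smul_apply, smul_eq_mul] at this
  rw [this]
  have h1 := hpos j hj
  have h2 : 0 < d v * d v := mul_self_pos.2 hdv
  nlinarith [mul_pos h1 h2]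

theorem exists_third (hn : 2 ≤ n) (v w : Fin (n + 1)) : ∃ u, u ≠ v ∧ u ≠ w := by
  have : ({v, w} : Finset (Fin (n + 1))).card < (Finset.univ : Finset (Fin (n + 1))).card := by
    have := Finset.card_le_two (a := v) (b := w)
    rw [Finset.card_univ, Fintype.card_fin]
    omega
  obtain ⟨u, -, hu⟩ := Finset.exists_mem_notMem_of_card_lt_card this
  simp at hu
  exact ⟨u, hu.1, hu.2⟩

/-- The two dependencies are proportional with positive factor `d v`, because `d v` is positive and
`c v = -1`. At a third vertex both coefficients are positive, while proportionality reads `d u = -(d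
v) * c u`. -/
theorem IsInterior.eq (hn : 2 ≤ n) {p : Fin (n + 1) → Eucl n} (hp : IsLinearEmbedding p)
    {v w : Fin (n + 1)} (hv : IsInterior p v) (hw : IsInterior p w) : v = w := by
  by_contra hne
  obtain ⟨c, hc, hcv, hcpos⟩ := hv
  obtain ⟨d, hd, hdw, hdpos⟩ := hw
  obtain ⟨u, huv, huw⟩ := exists_third hn v w
  have e := (faceIndep hn hp v).eq_smul hc hd hcv
  have h1 := congrFun e u
  simp only [Pi.smul_apply, smul_eq_mul] at h1
  have h2 := hdpos v hne
  have h3 := hdpos u huw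
  have h4 := hcpos u huv
  nlinarith [mul_pos h2 h4]

theorem affineIndependent_or_isInterior (hn : 2 ≤ n) {p : Fin (n + 1) → Eucl n}
    (hp : IsLinearEmbedding p) : AffineIndependent ℝ p ∨ ∃ v, IsInterior p v := by
  by_cases h : AffineIndependent ℝ p
  · exact Or.inl h
  · rw [affineIndependent_iff_isDep] at h
    push Not at h
    obtain ⟨c, hc, h0⟩ := h
    obtain ⟨v, hv0, hv⟩ := (isLinearEmbedding_iff hn).1 hp c hc h0
    refine Or.inr ⟨v, (-(c v)⁻¹) • c, hc.smul _, by simp [hv0], fun j hj => ?_⟩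
    have h1 := hv j hj
    have : (-(c v)⁻¹ • c) j = - (c j * c v) / (c v * c v) := by
      simp; field_simp
    rw [this]
    exact div_pos (by linarith) (mul_self_pos.2 hv0)

/-- Convex weights give a dependency with coefficient `-1` at `v` and nonnegative ones elsewhere.
The sign pattern forced by the embedding makes the latter strictly positive. -/
theorem mem_convexHull_iff_isInterior (hn : 2 ≤ n) {p : Fin (n + 1) → Eucl n}
    (hp : IsLinearEmbedding p) (v : Fin (n + 1)) :
    p v ∈ convexHull ℝ (p '' {v}ᶜ) ↔ IsInterior p v := by
  classical
  constructor
  · intro h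
    have hsub : convexHull ℝ (p '' {v}ᶜ) ⊆
        {x | ∃ w : Fin (n + 1) → ℝ, (∀ i, 0 ≤ w i) ∧ w v = 0 ∧ ∑ i, w i = 1 ∧
          ∑ i, w i • p i = x} := by
      refine convexHull_min ?_ ?_
      · rintro _ ⟨j, hj, rfl⟩
        refine ⟨Pi.single j 1, fun i => ?_, ?_, by simp, ?_⟩
        · by_cases hij : i = j
          · subst hij; simp
          · simp [hij]
        · exact Pi.single_eq_of_ne (Ne.symm hj) 1
        · simp [Pi.single_apply]
      · rintro _ ⟨w, hw, hwv, hws, rfl⟩ _ ⟨w', hw', hwv', hws', rfl⟩ a b ha hb hab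
        refine ⟨a • w + b • w', fun i => ?_, by simp [hwv, hwv'], ?_, ?_⟩
        · have := hw i
          have := hw' i
          simp only [Pi.add_apply, Pi.smul_apply, smul_eq_mul]
          positivity
        · simp [Finset.sum_add_distrib, ← Finset.mul_sum, hws, hws', hab]
        · simp [add_smul, mul_smul, Finset.sum_add_distrib, Finset.smul_sum]
    obtain ⟨w, hw, hwv, hws, hwp⟩ := hsub h
    set c : Fin (n + 1) → ℝ := w - Pi.single v 1 with hcdef
    have hc : IsDep p c := by
      constructor
      · simp [hcdef, hws]
      · simp [hcdef, sub_smul, hwp, Pi.single_apply]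
    have hcv : c v = -1 := by simp [hcdef, hwv]
    have hcj : ∀ j, j ≠ v → c j = w j := fun j hj => by simp [hcdef, hj]
    obtain ⟨u, hu0, hu⟩ := (isLinearEmbedding_iff hn).1 hp c hc
      (fun h => by rw [h] at hcv; norm_num at hcv)
    by_cases huv : u = v
    · subst huv
      refine ⟨c, hc, hcv, fun j hj => ?_⟩
      have := hu j hj
      rw [hcv] at this
      linarith
    -- If the exceptional vertex were `u ≠ v`, a third vertex would share the negative sign of `v`,
    -- against the nonnegativity of its weight.
    · exfalso
      obtain ⟨t, htu, htv⟩ := exists_third hn u v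
      have h1 := hu v (Ne.symm huv)
      have h2 := hu t htu
      rw [hcv] at h1
      rw [hcj t htv] at h2
      nlinarith [hw t]
  · rintro ⟨c, hc, hcv, hpos⟩
    have h1 : ∑ j ∈ Finset.univ.erase v, c j = 1 := by
      have := hc.1
      rw [← Finset.add_sum_erase _ _ (Finset.mem_univ v), hcv] at this
      linarith
    have h2 : p v = ∑ j ∈ Finset.univ.erase v, c j • p j := by
      have := hc.2
      rw [← Finset.add_sum_erase _ _ (Finset.mem_univ v), hcv] at this
      rw [neg_one_smul] at this
      exact (neg_add_eq_zero.1 this)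
    rw [h2]
    refine (convex_convexHull ℝ _).sum_mem (fun j hj => (hpos j (Finset.ne_of_mem_erase hj)).le)
      h1 fun j hj => subset_convexHull _ _ ⟨j, Finset.ne_of_mem_erase hj, rfl⟩

/-! ### Relabeling -/

theorem IsLinearEmbedding.comp {p : Fin (n + 1) → Eucl n}
    (hp : IsLinearEmbedding p) (σ : Equiv.Perm (Fin (n + 1))) : IsLinearEmbedding (p ∘ σ) := by
  have hmem : ∀ w ∈ skeletonK n, w ∘ σ.symm ∈ skeletonK n := by
    intro w hw
    refine ⟨⟨fun i => hw.1.1 _, (Equiv.sum_comp σ.symm w).trans hw.1.2⟩, ?_⟩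
    have : {i | (w ∘ σ.symm) i ≠ 0} = σ '' {i | w i ≠ 0} := by
      rw [Equiv.image_eq_preimage_symm]; rfl
    rw [this, Set.ncard_image_of_injective _ σ.injective]
    exact hw.2
  have hsum : ∀ w : Fin (n + 1) → ℝ,
      ∑ i, (w ∘ σ.symm) i • p i = ∑ i, w i • (p ∘ σ) i := fun w =>
    (Fintype.sum_equiv σ _ _ fun i => by simp).symm
  intro w hw w' hw' he
  have := hp (hmem w hw) (hmem w' hw') (by simp only [hsum]; exact he)
  exact σ.symm.surjective.injective_comp_right this

theorem IsLinearEmbedding.injective (hn : 2 ≤ n) {p : Fin (n + 1) → Eucl n}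
    (hp : IsLinearEmbedding p) : Function.Injective p := by
  classical
  intro i j hij
  by_contra hne
  obtain ⟨u, hui, huj⟩ := exists_third hn i j
  have := faceIndep hn hp u (Pi.single i 1 - Pi.single j 1)
    ⟨by simp, by simp [sub_smul, Pi.single_apply, hij]⟩ (by simp [hui, huj])
  have h := congrFun this i
  simp [hne] at h

/-- The configurations on which the preferred-apex retraction with apex `v` is defined. -/
def ApexDomain (p : Fin (n + 1) → Eucl n) (v : Fin (n + 1)) : Prop :=
  FaceIndep p v ∧ (AffineIndependent ℝ p ∨ IsInterior p v)

theorem ApexDomain.isLinearEmbedding (hn : 2 ≤ n) {p : Fin (n + 1) → Eucl n}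
    {v : Fin (n + 1)} (h : ApexDomain p v) : IsLinearEmbedding p := by
  rcases h.2 with h' | h'
  · exact isLinearEmbedding_of_affineIndependent hn h'
  · exact isLinearEmbedding_of_isInterior hn h.1 h'

end Dependencies

/-! ### The covering from labeled to unlabeled configurations -/

section Quotient

variable {n : ℕ}

/-- The labeled configuration `p` with its labels permuted by `σ`. -/
def relabel (p : EK n) (σ : Equiv.Perm (Fin (n + 1))) : EK n := ⟨p.1 ∘ σ, p.2.comp σ⟩

/-- Precomposition is a right action; the inverse turns it into a left one. -/
instance : MulAction (Equiv.Perm (Fin (n + 1))) (EK n) where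
  smul σ p := relabel p σ⁻¹
  one_smul p := by
    apply Subtype.ext
    change p.1 ∘ ((1 : Equiv.Perm (Fin (n + 1)))⁻¹ : Equiv.Perm (Fin (n + 1))) = p.1
    simp
  mul_smul σ τ p := by
    apply Subtype.ext
    change p.1 ∘ ((σ * τ)⁻¹ : Equiv.Perm (Fin (n + 1))) =
      (p.1 ∘ (τ⁻¹ : Equiv.Perm (Fin (n + 1)))) ∘ (σ⁻¹ : Equiv.Perm (Fin (n + 1)))
    rw [mul_inv_rev]
    rfl

theorem unlabel_eq_unlabel_iff {p q : EK n} :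
    unlabel p = unlabel q ↔ ∃ σ : Equiv.Perm (Fin (n + 1)), q = relabel p σ := by
  constructor
  · intro h
    obtain ⟨σ, hσ⟩ := Quotient.exact h
    exact ⟨σ, Subtype.ext hσ⟩
  · rintro ⟨σ, rfl⟩
    exact Quotient.sound ⟨σ, rfl⟩

theorem unlabel_relabel (p : EK n) (σ : Equiv.Perm (Fin (n + 1))) :
    unlabel (relabel p σ) = unlabel p :=
  (unlabel_eq_unlabel_iff.2 ⟨σ, rfl⟩).symm

theorem unlabel_surjective : Function.Surjective (unlabel : EK n → CK n) :=
  Quotient.mk_surjective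

theorem continuous_relabel (σ : Equiv.Perm (Fin (n + 1))) :
    Continuous fun p : EK n => relabel p σ := by
  refine Continuous.subtype_mk (f := fun p : EK n => p.1 ∘ σ) ?_ _
  exact continuous_pi fun i => (continuous_apply (σ i)).comp continuous_subtype_val

/-- The vertices of an embedding are distinct. If all vertices move by less than half of their
distances from the others, no vertex can come near the old position of another, so a nontrivial
permutation carries this neighborhood off itself. -/
theorem isQuotientCoveringMap_unlabel (hn : 2 ≤ n) :
    IsQuotientCoveringMap (unlabel : EK n → CK n) (Equiv.Perm (Fin (n + 1))) where
  toIsQuotientMap := isQuotientMap_quotient_mk'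
  continuous_const_smul σ := continuous_relabel σ⁻¹
  apply_eq_iff_mem_orbit {p q} := by
    rw [eq_comm, unlabel_eq_unlabel_iff, MulAction.mem_orbit_iff]
    constructor
    · rintro ⟨σ, rfl⟩
      refine ⟨σ⁻¹, ?_⟩
      change relabel q σ⁻¹⁻¹ = _
      rw [inv_inv]
    · rintro ⟨σ, rfl⟩
      exact ⟨σ⁻¹, rfl⟩
  disjoint p := by
    refine ⟨{q | ∀ i j, i ≠ j → dist (q.1 j) (p.1 j) < dist (p.1 i) (p.1 j) / 2}, ?_, ?_⟩
    · refine IsOpen.mem_nhds ?_ ?_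
      · simp only [Set.ofPred_forall]
        refine isOpen_iInter_of_finite fun i => isOpen_iInter_of_finite fun j =>
          isOpen_iInter_of_finite fun _ => isOpen_lt ?_ continuous_const
        exact ((continuous_apply j).comp continuous_subtype_val).dist continuous_const
      · intro i j hij
        rw [dist_self]
        exact half_pos (dist_pos.2 ((p.2.injective hn).ne hij))
    · rintro σ ⟨_, ⟨q, hq, rfl⟩, hq'⟩
      rw [← inv_eq_one]
      ext i
      congr 1
      change σ⁻¹ i = i
      by_contra hne
      have h1 := hq i (σ⁻¹ i) (Ne.symm hne)
      have h2 : dist (q.1 (σ⁻¹ i)) (p.1 i) < dist (p.1 (σ⁻¹ i)) (p.1 i) / 2 := hq' _ i hne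
      have h3 := dist_triangle_left (p.1 i) (p.1 (σ⁻¹ i)) (q.1 (σ⁻¹ i))
      rw [dist_comm (p.1 (σ⁻¹ i)) (p.1 i)] at h2
      linarith

theorem isOpenQuotientMap_unlabel (hn : 2 ≤ n) : IsOpenQuotientMap (unlabel : EK n → CK n) :=
  (isQuotientCoveringMap_unlabel hn).isOpenQuotientMap

theorem isCoveringMap_unlabel (hn : 2 ≤ n) : IsCoveringMap (unlabel : EK n → CK n) :=
  (isQuotientCoveringMap_unlabel hn).isCoveringMap

/-- A family of self-maps of labeled configurations commutes with relabeling. -/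
def IsEquivariant (F : unitInterval → EK n → EK n) : Prop :=
  ∀ t p σ, F t (relabel p σ) = relabel (F t p) σ

theorem exists_descend (hn : 2 ≤ n) {F : unitInterval → EK n → EK n}
    (hF : Continuous (Function.uncurry F)) (he : IsEquivariant F) :
    ∃ f : unitInterval → CK n → CK n, Continuous (Function.uncurry f) ∧
      ∀ t p, f t (unlabel p) = unlabel (F t p) := by
  refine ⟨fun t => Quotient.lift (fun p => unlabel (F t p)) ?_, ?_, fun t p => rfl⟩
  · rintro p q ⟨σ, h⟩
    have : q = relabel p σ := Subtype.ext h
    rw [this, he, unlabel_relabel]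
  · have hq := (IsOpenQuotientMap.id (X := unitInterval)).prodMap (isOpenQuotientMap_unlabel hn)
    rw [hq.isQuotientMap.continuous_iff]
    exact (isOpenQuotientMap_unlabel hn).continuous.comp hF

theorem exists_lift (hn : 2 ≤ n) {f : unitInterval → CK n → CK n}
    (hf : Continuous (Function.uncurry f)) (h0 : ∀ x, f 0 x = x) :
    ∃ F : unitInterval → EK n → EK n, Continuous (Function.uncurry F) ∧ (∀ p, F 0 p = p) ∧
      (∀ t p, unlabel (F t p) = f t (unlabel p)) ∧ IsEquivariant F := by
  have cov := isCoveringMap_unlabel hn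
  have hc := (isOpenQuotientMap_unlabel hn).continuous
  let H : C(unitInterval × EK n, CK n) := ⟨fun a => f a.1 (unlabel a.2),
    hf.comp (continuous_fst.prodMk (hc.comp continuous_snd))⟩
  let G := cov.liftHomotopy H (ContinuousMap.id _) fun p => h0 _
  have hG : ∀ t p, unlabel (G (t, p)) = f t (unlabel p) := fun t p =>
    congrFun (cov.liftHomotopy_lifts H (ContinuousMap.id _) fun p => h0 _) (t, p)
  have hG0 : ∀ p, G (0, p) = p := fun p => cov.liftHomotopy_zero H (ContinuousMap.id _) _ p
  refine ⟨fun t p => G (t, p), G.continuous, hG0, hG, fun t p σ => ?_⟩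
  have h1 : Continuous fun t => G (t, relabel p σ) := G.continuous.comp (by fun_prop)
  have h2 : Continuous fun t => relabel (G (t, p)) σ :=
    (continuous_relabel σ).comp (G.continuous.comp (by fun_prop))
  -- Both sides lift the same path and start at the same point, so equivariance follows from
  -- uniqueness of lifts.
  refine congrFun (cov.eq_of_comp_eq h1 h2 ?_ 0 ?_) t
  · funext t
    simp only [Function.comp_apply, hG, unlabel_relabel]
  · simp only [hG0]

end Quotient

/-! ### Positive definite recombinations and equidistant families -/

section MorePolar

open Matrix

variable {ι : Type*} [Fintype ι] [DecidableEq ι]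
variable {E : Type*} [NormedAddCommGroup E] [InnerProductSpace ℝ E]
variable {N : Matrix ι ι ℝ} {f : ι → E}

theorem posSemidef_of_symm_idem (hs : Nᵀ = N) (hi : N * N = N) : N.PosSemidef := by
  have := posSemidef_conjTranspose_mul_self N
  rwa [conjTranspose_eq_transpose_of_trivial, hs, hi] at this

theorem posSemidef_one_sub (hs : Nᵀ = N) (hi : N * N = N) : (1 - N).PosSemidef := by
  refine posSemidef_of_symm_idem (by rw [transpose_sub, transpose_one, hs]) ?_
  rw [sub_mul, one_mul, mul_sub, mul_one, hi, sub_self, sub_zero]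

theorem posDef_smul_one_sub_add (hs : Nᵀ = N) (hi : N * N = N) {a : ℝ} (ha : 0 < a) :
    (a • (1 - N) + N).PosDef := by
  -- The eigenvalues are `a` and `1`; their minimum times the identity splits off and leaves a
  -- positive semidefinite rest.
  have hμ : 0 < min a 1 := lt_min ha one_pos
  have e : a • (1 - N) + N =
      min a 1 • (1 : Matrix ι ι ℝ) + ((a - min a 1) • (1 - N) + (1 - min a 1) • N) := by
    module
  rw [e]
  refine (Matrix.PosDef.one.smul hμ).add_posSemidef (.add ?_ ?_)
  · exact (posSemidef_one_sub hs hi).smul (sub_nonneg.2 (min_le_left _ _))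
  · exact (posSemidef_of_symm_idem hs hi).smul (sub_nonneg.2 (min_le_right _ _))

theorem sum_smul_act (f : ι → E) (B : Matrix ι ι ℝ) (x : ι → ℝ) :
    ∑ j, x j • act f B j = ∑ i, (B *ᵥ x) i • f i := by
  simp only [act, Finset.smul_sum, smul_smul, mulVec, dotProduct, Finset.sum_smul]
  rw [Finset.sum_comm]
  exact Finset.sum_congr rfl fun i _ => Finset.sum_congr rfl fun j _ => by rw [mul_comm]

/-- Positive definite recombinations of an orthonormalized family have no new relations. -/
theorem eq_zero_of_sum_smul_act {z : ι → E} {B : Matrix ι ι ℝ} {t : ℝ} (hB : B.PosDef)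
    (hs : Nᵀ = N) (hBN : B * N = t • N) (hz : gram ℝ z = 1 - N) {x : ι → ℝ}
    (hN : N *ᵥ x = 0) (hx : ∑ j, x j • act z B j = 0) : x = 0 := by
  have hBs : Bᵀ = B := hB.isHermitian
  have hNB : N * B = t • N := by
    have := congrArg Matrix.transpose hBN
    rwa [transpose_mul, transpose_smul, hBs, hs] at this
  have h1 : N *ᵥ (B *ᵥ x) = 0 := by
    rw [mulVec_mulVec, hNB, smul_mulVec, hN, smul_zero]
  -- On the kernel of `N` the Gram form of `z` is the standard one, so this forces `B *ᵥ x = 0`.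
  have h2 : ‖∑ i, (B *ᵥ x) i • z i‖ ^ 2 = 0 := by rw [← sum_smul_act, hx]; simp
  rw [norm_sq_sum_smul, hz, sub_mulVec, one_mulVec, h1, sub_zero, dotProduct_self_eq_zero] at h2
  by_contra h0
  have := hB.dotProduct_mulVec_pos h0
  rw [h2] at this
  simp at this

theorem span_range_act_le (f : ι → E) (B : Matrix ι ι ℝ) :
    Submodule.span ℝ (Set.range (act f B)) ≤ Submodule.span ℝ (Set.range f) := by
  rw [Submodule.span_le]
  rintro _ ⟨j, rfl⟩
  exact Submodule.sum_mem _ fun i _ => Submodule.smul_mem _ _ (Submodule.subset_span ⟨i, rfl⟩)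

theorem span_range_act (f : ι → E) {B : Matrix ι ι ℝ} (hB : B.PosDef) :
    Submodule.span ℝ (Set.range (act f B)) = Submodule.span ℝ (Set.range f) := by
  refine le_antisymm (span_range_act_le f B) ?_
  have : f = act (act f B) B⁻¹ := by
    rw [act_act, mul_nonsing_inv _ ((Matrix.isUnit_iff_isUnit_det _).1 hB.isUnit), act_one]
  conv_lhs => rw [this]
  exact span_range_act_le _ _

/-- The Gram matrix of a family whose points are at distance `L` from each other and which has
barycenter zero. -/
theorem inner_of_equidistant {s : Finset ι} (f : ι → E) {L : ℝ} (h0 : ∑ i ∈ s, f i = 0)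
    (hL : ∀ i ∈ s, ∀ j ∈ s, i ≠ j → dist (f i) (f j) = L) {i j : ι} (hi : i ∈ s) (hj : j ∈ s) :
    inner ℝ (f i) (f j) = L ^ 2 / 2 * ((if i = j then 1 else 0) - (s.card : ℝ)⁻¹) := by
  have hpos : (0 : ℝ) < s.card := by exact_mod_cast Finset.card_pos.2 ⟨i, hi⟩
  set Q := ∑ k ∈ s, ‖f k‖ ^ 2 with hQ
  have hd : ∀ i ∈ s, ∀ j ∈ s, ‖f i - f j‖ ^ 2 = L ^ 2 - L ^ 2 * (if i = j then 1 else 0) := by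
    intro i hi j hj
    by_cases hij : i = j
    · simp [hij]
    · rw [← dist_eq_norm, hL i hi j hj hij]; simp [hij]
  have hn : ∀ i ∈ s, s.card * ‖f i‖ ^ 2 + Q = (s.card - 1) * L ^ 2 := by
    intro i hi
    -- Summing the squared distances from `f i` removes the inner products, because the barycenter
    -- is zero. A second summation over `i` then determines `Q`, hence all norms and all inner
    -- products.
    have h1 : ∑ j ∈ s, ‖f i - f j‖ ^ 2 = s.card * ‖f i‖ ^ 2 + Q := by
      simp only [norm_sub_sq_real, Finset.sum_add_distrib, Finset.sum_sub_distrib,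
        Finset.sum_const, nsmul_eq_mul, ← Finset.mul_sum, ← inner_sum, h0, inner_zero_right]
      ring
    rw [← h1, Finset.sum_congr rfl fun j hj => hd i hi j hj]
    simp [Finset.sum_sub_distrib, hi]
    ring
  have hQv : s.card * Q + s.card * Q = s.card * ((s.card - 1) * L ^ 2) := by
    have := Finset.sum_congr rfl hn
    simp only [Finset.sum_add_distrib, ← Finset.mul_sum, Finset.sum_const, nsmul_eq_mul] at this
    linarith
  have hQv' : Q = (s.card - 1) * L ^ 2 / 2 := by
    have : s.card * (Q - (s.card - 1) * L ^ 2 / 2) = 0 := by linarith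
    rcases mul_eq_zero.1 this with h | h
    · exact absurd h hpos.ne'
    · linarith
  have hi2 := hn i hi
  have hj2 := hn j hj
  have hij := hd i hi j hj
  rw [norm_sub_sq_real] at hij
  rw [hQv'] at hi2 hj2
  have e1 : ‖f i‖ ^ 2 = (s.card - 1) * L ^ 2 / 2 / s.card := by
    field_simp; linarith
  have e2 : ‖f j‖ ^ 2 = (s.card - 1) * L ^ 2 / 2 / s.card := by
    field_simp; linarith
  rw [e1, e2] at hij
  have : inner ℝ (f i) (f j) = ((s.card - 1) * L ^ 2 / s.card -
    (L ^ 2 - L ^ 2 * (if i = j then 1 else 0))) / 2 := by rw [← hij]; ring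
  rw [this]
  field_simp
  ring

end MorePolar

/-! ### The face opposite to a vertex and its orthonormal frame -/

section Face

open Matrix

variable {n : ℕ}

/-- The vertices of the face opposite to `v`, relative to its barycenter (and zero at `v`). -/
def faceVec (p : Fin (n + 1) → Eucl n) (v : Fin (n + 1)) : Fin (n + 1) → Eucl n :=
  fun j => if j = v then 0 else p j - faceBarycenter p v

/-- The projection onto the relations of `faceVec p v`. -/
def faceProj (v : Fin (n + 1)) : Matrix (Fin (n + 1)) (Fin (n + 1)) ℝ := fun i j =>
  if i = v then (if j = v then 1 else 0) else (if j = v then 0 else (n : ℝ)⁻¹)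

/-- The orthonormalization of `faceVec p v`. -/
def faceFrame (p : Fin (n + 1) → Eucl n) (v : Fin (n + 1)) : Fin (n + 1) → Eucl n :=
  polar (faceProj v) (faceVec p v)

theorem sum_eq_add_sum_ne (v : Fin (n + 1)) {M : Type*} [AddCommMonoid M]
    (g : Fin (n + 1) → M) : ∑ i, g i = g v + ∑ i ∈ Finset.univ.erase v, g i :=
  (Finset.add_sum_erase _ _ (Finset.mem_univ v)).symm

theorem card_erase (v : Fin (n + 1)) : (Finset.univ.erase v).card = n := by
  simp [Finset.card_erase_of_mem]

theorem faceProj_transpose (v : Fin (n + 1)) : (faceProj v)ᵀ = faceProj v := by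
  ext i j
  simp only [transpose_apply, faceProj]
  split_ifs <;> rfl

theorem sum_faceProj_mul (v i : Fin (n + 1)) (x : Fin (n + 1) → ℝ) :
    ∑ j, faceProj v i j * x j =
      if i = v then x v else (n : ℝ)⁻¹ * ∑ j ∈ Finset.univ.erase v, x j := by
  rw [sum_eq_add_sum_ne v]
  by_cases h : i = v
  · simp only [faceProj, h, if_true, one_mul]
    rw [Finset.sum_eq_zero fun j hj => by simp [Finset.ne_of_mem_erase hj], add_zero]
  · simp only [faceProj, h, if_false, if_true, zero_mul, zero_add]
    rw [Finset.mul_sum]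
    exact Finset.sum_congr rfl fun j hj => by simp [Finset.ne_of_mem_erase hj]

theorem faceProj_mul_self (hn : 2 ≤ n) (v : Fin (n + 1)) :
    faceProj v * faceProj v = faceProj v := by
  have hn0 : (n : ℝ) ≠ 0 := by positivity
  ext i j
  rw [mul_apply, sum_faceProj_mul]
  by_cases hi : i = v
  · simp [hi]
  · rw [if_neg hi]
    by_cases hj : j = v
    · rw [Finset.sum_eq_zero fun k hk => by simp [faceProj, Finset.ne_of_mem_erase hk, hj]]
      simp [faceProj, hi, hj]
    · rw [Finset.sum_congr rfl fun k hk => show faceProj v k j = (n : ℝ)⁻¹ by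
        simp [faceProj, Finset.ne_of_mem_erase hk, hj]]
      rw [Finset.sum_const, card_erase]
      simp [faceProj, hi, hj, hn0]

theorem sum_faceVec_erase (hn : 2 ≤ n) (p : Fin (n + 1) → Eucl n) (v : Fin (n + 1)) :
    ∑ j ∈ Finset.univ.erase v, faceVec p v j = 0 := by
  have hn0 : (n : ℝ) ≠ 0 := by positivity
  rw [Finset.sum_congr rfl fun j hj => show faceVec p v j = p j - faceBarycenter p v by
    simp [faceVec, Finset.ne_of_mem_erase hj]]
  rw [Finset.sum_sub_distrib, Finset.sum_const, card_erase, faceBarycenter, ← Nat.cast_smul_eq_nsmul ℝ,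
    smul_smul, mul_inv_cancel₀ hn0, one_smul, sub_self]

theorem faceVec_self (p : Fin (n + 1) → Eucl n) (v : Fin (n + 1)) : faceVec p v v = 0 := by
  simp [faceVec]

theorem sum_faceVec (hn : 2 ≤ n) (p : Fin (n + 1) → Eucl n) (v : Fin (n + 1)) :
    ∑ j, faceVec p v j = 0 := by
  rw [sum_eq_add_sum_ne v, faceVec_self, sum_faceVec_erase hn, add_zero]

theorem act_faceProj {f : Fin (n + 1) → Eucl n} {v : Fin (n + 1)} (hv : f v = 0)
    (h0 : ∑ j, f j = 0) : act f (faceProj v) = 0 := by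
  funext j
  have h1 : ∑ j ∈ Finset.univ.erase v, f j = 0 := by
    rw [sum_eq_add_sum_ne v, hv, zero_add] at h0; exact h0
  rw [act, sum_eq_add_sum_ne v, hv, smul_zero, zero_add]
  by_cases hj : j = v
  · exact Finset.sum_eq_zero fun k hk => by simp [faceProj, Finset.ne_of_mem_erase hk, hj]
  · rw [Finset.sum_congr rfl fun k hk => show faceProj v k j • f k = (n : ℝ)⁻¹ • f k by
      simp [faceProj, Finset.ne_of_mem_erase hk, hj], ← Finset.smul_sum, h1]
    simp

theorem faceProj_mulVec_eq_zero (hn : 2 ≤ n) {v : Fin (n + 1)} {x : Fin (n + 1) → ℝ} :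
    faceProj v *ᵥ x = 0 ↔ x v = 0 ∧ ∑ j, x j = 0 := by
  have hn0 : (n : ℝ) ≠ 0 := by positivity
  have e : ∀ i, (faceProj v *ᵥ x) i =
      if i = v then x v else (n : ℝ)⁻¹ * ∑ j ∈ Finset.univ.erase v, x j := fun i =>
    sum_faceProj_mul v i x
  constructor
  · intro h
    have h1 := congrFun h v
    rw [e, if_pos rfl] at h1
    obtain ⟨u, hu, -⟩ := exists_third hn v v
    have h2 := congrFun h u
    rw [e, if_neg hu] at h2
    refine ⟨by simpa using h1, ?_⟩
    rw [sum_eq_add_sum_ne v, h1, Pi.zero_apply, zero_add]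
    simpa [hn0] using h2
  · rintro ⟨h1, h2⟩
    rw [sum_eq_add_sum_ne v, h1, zero_add] at h2
    funext i
    rw [e, h1, h2]
    simp

theorem sum_smul_faceVec (p : Fin (n + 1) → Eucl n) {v : Fin (n + 1)} {x : Fin (n + 1) → ℝ}
    (hv : x v = 0) (h0 : ∑ j, x j = 0) : ∑ j, x j • faceVec p v j = ∑ j, x j • p j := by
  have h1 : ∑ j, x j • p j = ∑ j, x j • (p j - faceBarycenter p v) := by
    simp only [smul_sub, Finset.sum_sub_distrib, ← Finset.sum_smul, h0, zero_smul, sub_zero]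
  rw [h1]
  refine Finset.sum_congr rfl fun j _ => ?_
  by_cases hj : j = v
  · simp [hj, hv]
  · simp [faceVec, hj]

theorem faceIndep_iff (hn : 2 ≤ n) {p : Fin (n + 1) → Eucl n} {v : Fin (n + 1)} :
    FaceIndep p v ↔ ∀ x : Fin (n + 1) → ℝ, ∑ i, x i • faceVec p v i = 0 →
      faceProj v *ᵥ x = 0 → x = 0 := by
  constructor
  · intro h x hx hN
    obtain ⟨h1, h2⟩ := (faceProj_mulVec_eq_zero hn).1 hN
    exact h x ⟨h2, by rw [← sum_smul_faceVec p h1 h2, hx]⟩ h1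
  · intro h c hc hv
    exact h c (by rw [sum_smul_faceVec p hv hc.1, hc.2])
      ((faceProj_mulVec_eq_zero hn).2 ⟨hv, hc.1⟩)

theorem isRelationProj_faceVec (hn : 2 ≤ n) {p : Fin (n + 1) → Eucl n} {v : Fin (n + 1)}
    (h : FaceIndep p v) : IsRelationProj (faceProj v) (faceVec p v) where
  symm := faceProj_transpose v
  idem := faceProj_mul_self hn v
  act_eq := act_faceProj (faceVec_self p v) (sum_faceVec hn p v)
  posDef := posDef_gram_add (faceProj_transpose v) (faceProj_mul_self hn v)
    ((faceIndep_iff hn).1 h)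

theorem gram_faceFrame (hn : 2 ≤ n) {p : Fin (n + 1) → Eucl n} {v : Fin (n + 1)}
    (h : FaceIndep p v) : gram ℝ (faceFrame p v) = 1 - faceProj v :=
  (isRelationProj_faceVec hn h).gram_polar

theorem inner_faceFrame (hn : 2 ≤ n) {p : Fin (n + 1) → Eucl n} {v : Fin (n + 1)}
    (h : FaceIndep p v) (i j : Fin (n + 1)) :
    inner ℝ (faceFrame p v i) (faceFrame p v j) = (if i = j then 1 else 0) - faceProj v i j := by
  have := congrFun (congrFun (gram_faceFrame hn h) i) j
  rwa [gram_apply, Matrix.sub_apply, Matrix.one_apply] at this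

theorem faceFrame_self (hn : 2 ≤ n) {p : Fin (n + 1) → Eucl n} {v : Fin (n + 1)}
    (h : FaceIndep p v) : faceFrame p v v = 0 := by
  rw [← inner_self_eq_zero (𝕜 := ℝ), inner_faceFrame hn h]
  simp [faceProj]

theorem sum_faceFrame (hn : 2 ≤ n) {p : Fin (n + 1) → Eucl n} {v : Fin (n + 1)}
    (h : FaceIndep p v) : ∑ j, faceFrame p v j = 0 := by
  have hn0 : (n : ℝ) ≠ 0 := by positivity
  obtain ⟨u, hu, -⟩ := exists_third hn v v
  have h1 := congrFun (isRelationProj_faceVec hn h).act_polar u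
  change act (faceFrame p v) _ _ = _ at h1
  rw [act, sum_eq_add_sum_ne v] at h1
  rw [Finset.sum_congr rfl fun k hk => show faceProj v k u • faceFrame p v k =
    (n : ℝ)⁻¹ • faceFrame p v k by simp [faceProj, Finset.ne_of_mem_erase hk, hu],
    ← Finset.smul_sum, faceFrame_self hn h] at h1
  rw [sum_eq_add_sum_ne v, faceFrame_self hn h, zero_add]
  simpa [hn0] using h1

theorem span_faceVec (hn : 2 ≤ n) (p : Fin (n + 1) → Eucl n) (v : Fin (n + 1)) :
    Submodule.span ℝ (Set.range (faceVec p v)) = faceDirection p v := by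
  have hn0 : (n : ℝ) ≠ 0 := by positivity
  apply le_antisymm
  · rw [Submodule.span_le]
    rintro _ ⟨j, rfl⟩
    by_cases hj : j = v
    · rw [hj, faceVec_self]; exact Submodule.zero_mem _
    · have : faceVec p v j = (n : ℝ)⁻¹ • ∑ i ∈ Finset.univ.erase v, (p j - p i) := by
        rw [Finset.sum_sub_distrib, Finset.sum_const, card_erase, ← Nat.cast_smul_eq_nsmul ℝ,
          smul_sub, smul_smul, inv_mul_cancel₀ hn0, one_smul]
        simp [faceVec, hj, faceBarycenter]
      rw [this]
      refine Submodule.smul_mem _ _ (Submodule.sum_mem _ fun i hi => ?_)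
      exact vsub_mem_vectorSpan ℝ ⟨j, hj, rfl⟩ ⟨i, Finset.ne_of_mem_erase hi, rfl⟩
  · rw [faceDirection, vectorSpan_def, Submodule.span_le]
    rintro _ ⟨_, ⟨i, hi, rfl⟩, _, ⟨j, hj, rfl⟩, rfl⟩
    have hi' : i ≠ v := hi
    have hj' : j ≠ v := hj
    have : p i -ᵥ p j = faceVec p v i - faceVec p v j := by
      simp [faceVec, hi', hj']
    change p i -ᵥ p j ∈ _
    rw [this]
    exact Submodule.sub_mem _ (Submodule.subset_span ⟨i, rfl⟩) (Submodule.subset_span ⟨j, rfl⟩)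

theorem span_faceFrame (hn : 2 ≤ n) {p : Fin (n + 1) → Eucl n} {v : Fin (n + 1)}
    (h : FaceIndep p v) : Submodule.span ℝ (Set.range (faceFrame p v)) = faceDirection p v := by
  rw [← span_faceVec hn]
  exact span_range_act _ (posDef_invSqrt (isRelationProj_faceVec hn h).posDef)

theorem mem_orthogonal_faceDirection (hn : 2 ≤ n) {p : Fin (n + 1) → Eucl n}
    {v : Fin (n + 1)} (h : FaceIndep p v) {x : Eucl n} :
    x ∈ (faceDirection p v)ᗮ ↔ ∀ j, inner ℝ (faceFrame p v j) x = 0 := by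
  rw [← span_faceFrame hn h]
  constructor
  · intro hx j
    exact hx _ (Submodule.subset_span ⟨j, rfl⟩)
  · intro hx
    rw [Submodule.mem_orthogonal]
    intro u hu
    induction hu using Submodule.span_induction with
    | mem y hy => obtain ⟨j, rfl⟩ := hy; exact hx j
    | zero => simp
    | add y z _ _ hy hz => rw [inner_add_left, hy, hz, add_zero]
    | smul a y _ hy => rw [real_inner_smul_left, hy, mul_zero]

/-- The frame has `n` nonzero members in dimension `n - 1`, yet satisfies Parseval's identity: its
Gram matrix is `1 - faceProj v`, and `faceProj v` annihilates the vector of inner products with `x`.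
The formula shows that the projection depends continuously on `p`. -/
theorem starProjection_faceDirection (hn : 2 ≤ n) {p : Fin (n + 1) → Eucl n}
    {v : Fin (n + 1)} (h : FaceIndep p v) (x : Eucl n) :
    (faceDirection p v).starProjection x =
      ∑ j, inner ℝ (faceFrame p v j) x • faceFrame p v j := by
  apply Submodule.eq_starProjection_of_mem_orthogonal
  · rw [← span_faceFrame hn h]
    exact Submodule.sum_mem _ fun j _ => Submodule.smul_mem _ _ (Submodule.subset_span ⟨j, rfl⟩)
  · rw [mem_orthogonal_faceDirection hn h]
    intro k
    have h1 := congrFun (isRelationProj_faceVec hn h).act_polar k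
    change act (faceFrame p v) _ _ = _ at h1
    have h2 := congrArg (fun y => inner ℝ y x) h1
    simp only [act, sum_inner, real_inner_smul_left, Pi.zero_apply, inner_zero_left] at h2
    simp only [inner_sub_right, inner_sum, real_inner_smul_right, inner_faceFrame hn h, mul_sub,
      Finset.sum_sub_distrib, mul_ite, mul_one, mul_zero, Finset.sum_ite_eq, Finset.mem_univ,
      if_true, sub_sub_cancel]
    rw [← h2]
    refine Finset.sum_congr rfl fun j _ => ?_
    rw [mul_comm]
    congr 1
    exact congrFun (congrFun (faceProj_transpose v) j) k

theorem apexTarget_eq (hn : 2 ≤ n) {p : Fin (n + 1) → Eucl n} {v : Fin (n + 1)}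
    (h : FaceIndep p v) : apexTarget p v = p v +
      ∑ j, inner ℝ (faceFrame p v j) (faceBarycenter p v - p v) • faceFrame p v j := by
  rw [apexTarget, starProjection_faceDirection hn h]

end Face

/-! ### Configurations in terms of barycenter, face and axis -/

section Pyr

open Matrix

variable {n : ℕ}

/-- The coefficients of the displacement of the vertices of a pyramid with apex `v` along its axis,
keeping the barycenter fixed. -/
def axisCoeff (v : Fin (n + 1)) (j : Fin (n + 1)) : ℝ :=
  (if j = v then 1 else 0) - ((n : ℝ) + 1)⁻¹

/-- The configuration with barycenter `m`, face `f` opposite to `v` and axis vector `a`. -/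
def pyr (m : Eucl n) (f : Fin (n + 1) → Eucl n) (a : Eucl n) (v : Fin (n + 1)) :
    Fin (n + 1) → Eucl n := fun j => m + f j + axisCoeff v j • a

theorem sum_axisCoeff (v : Fin (n + 1)) : ∑ j, axisCoeff v j = 0 := by
  have : (n : ℝ) + 1 ≠ 0 := by positivity
  simp [axisCoeff, Finset.sum_sub_distrib, this]

theorem faceBarycenter_congr {p q : Fin (n + 1) → Eucl n} {v : Fin (n + 1)}
    (h : ∀ j, j ≠ v → p j = q j) : faceBarycenter p v = faceBarycenter q v := by
  rw [faceBarycenter, faceBarycenter,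
    Finset.sum_congr rfl fun j hj => h j (Finset.ne_of_mem_erase hj)]

theorem faceDirection_congr {p q : Fin (n + 1) → Eucl n} {v : Fin (n + 1)}
    (h : ∀ j, j ≠ v → p j = q j) : faceDirection p v = faceDirection q v := by
  rw [faceDirection, faceDirection, Set.image_congr (s := {v}ᶜ) (f := p) (g := q) fun j hj => h j hj]

theorem faceVec_congr {p q : Fin (n + 1) → Eucl n} {v : Fin (n + 1)}
    (h : ∀ j, j ≠ v → p j = q j) : faceVec p v = faceVec q v := by
  funext j
  by_cases hj : j = v
  · simp [faceVec, hj]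
  · simp [faceVec, hj, h j hj, faceBarycenter_congr h]

theorem FaceIndep.congr (hn : 2 ≤ n) {p q : Fin (n + 1) → Eucl n} {v : Fin (n + 1)}
    (hp : FaceIndep p v) (h : ∀ j, j ≠ v → p j = q j) : FaceIndep q v := by
  rw [faceIndep_iff hn] at hp ⊢
  rwa [← faceVec_congr h]

/-- The factor normalizes the coefficients to `1` at `v` and `-1 / n` elsewhere. -/
theorem sum_axisCoeff_smul (hn : 2 ≤ n) (p : Fin (n + 1) → Eucl n) (v : Fin (n + 1)) :
    ∑ j, (((n : ℝ) + 1) / n * axisCoeff v j) • p j = p v - faceBarycenter p v := by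
  have hn0 : (n : ℝ) ≠ 0 := by positivity
  have hn1 : (n : ℝ) + 1 ≠ 0 := by positivity
  rw [sum_eq_add_sum_ne v, Finset.sum_congr rfl fun j hj =>
    show (((n : ℝ) + 1) / n * axisCoeff v j) • p j = (-(n : ℝ)⁻¹) • p j by
      simp only [axisCoeff, Finset.ne_of_mem_erase hj, if_false]; congr 1; field_simp; ring]
  have : ((n : ℝ) + 1) / n * axisCoeff v v = 1 := by
    simp only [axisCoeff, if_true]; field_simp; ring
  rw [this, one_smul, ← Finset.smul_sum, neg_smul, ← sub_eq_add_neg, faceBarycenter]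

theorem mem_faceDirection (hn : 2 ≤ n) {p : Fin (n + 1) → Eucl n} {v : Fin (n + 1)}
    {x : Eucl n} : x ∈ faceDirection p v ↔
      ∃ c : Fin (n + 1) → ℝ, c v = 0 ∧ ∑ j, c j = 0 ∧ ∑ j, c j • p j = x := by
  rw [← span_faceVec hn, Submodule.mem_span_range_iff_exists_fun]
  constructor
  · rintro ⟨a, rfl⟩
    -- Removing the component along the relations of `faceVec p v` does not change the sum, and
    -- makes the coefficients vanish at `v` and add up to zero.
    set c := a - faceProj v *ᵥ a with hc
    obtain ⟨h1, h2⟩ := (faceProj_mulVec_eq_zero hn (v := v) (x := c)).1 (by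
      rw [hc, mulVec_sub, mulVec_mulVec, faceProj_mul_self hn, sub_self])
    refine ⟨c, h1, h2, ?_⟩
    rw [← sum_smul_faceVec p h1 h2]
    simp only [hc, Pi.sub_apply, sub_smul, Finset.sum_sub_distrib]
    rw [← sum_smul_act, act_faceProj (faceVec_self p v) (sum_faceVec hn p v)]
    simp
  · rintro ⟨c, h1, h2, rfl⟩
    exact ⟨c, sum_smul_faceVec p h1 h2⟩

theorem FaceIndep.affineIndependent_iff (hn : 2 ≤ n) {p : Fin (n + 1) → Eucl n}
    {v : Fin (n + 1)} (hf : FaceIndep p v) :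
    AffineIndependent ℝ p ↔ p v - faceBarycenter p v ∉ faceDirection p v := by
  have hn0 : (n : ℝ) ≠ 0 := by positivity
  have hn1 : (n : ℝ) + 1 ≠ 0 := by positivity
  have hβv : ((n : ℝ) + 1) / n * axisCoeff v v = 1 := by
    simp only [axisCoeff, if_true]; field_simp; ring
  have hβs : ∑ j, ((n : ℝ) + 1) / n * axisCoeff v j = 0 := by
    rw [← Finset.mul_sum, sum_axisCoeff, mul_zero]
  rw [affineIndependent_iff_isDep, mem_faceDirection hn]
  constructor
  · rintro h ⟨c, hcv, hcs, hcp⟩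
    have := h (fun j => ((n : ℝ) + 1) / n * axisCoeff v j - c j)
      ⟨by rw [Finset.sum_sub_distrib, hβs, hcs, sub_zero],
        by simp only [sub_smul, Finset.sum_sub_distrib, sum_axisCoeff_smul hn, hcp, sub_self]⟩
    have h1 := congrFun this v
    simp only [hβv, hcv] at h1
    norm_num at h1
  · intro h c hc
    by_contra h0
    have hcv : c v ≠ 0 := fun hv => h0 (hf c hc hv)
    refine h ⟨fun j => ((n : ℝ) + 1) / n * axisCoeff v j - (c v)⁻¹ * c j, ?_, ?_, ?_⟩
    · simp only [hβv, inv_mul_cancel₀ hcv, sub_self]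
    · rw [Finset.sum_sub_distrib, hβs, ← Finset.mul_sum, hc.1, mul_zero, sub_zero]
    · simp only [sub_smul, Finset.sum_sub_distrib, sum_axisCoeff_smul hn]
      simp only [mul_smul, ← Finset.smul_sum, hc.2, smul_zero, sub_zero]

section
variable {m : Eucl n} {f : Fin (n + 1) → Eucl n} {a : Eucl n} {v : Fin (n + 1)}

theorem sum_pyr (h0 : ∑ j, f j = 0) : ∑ j, pyr m f a v j = ((n : ℝ) + 1) • m := by
  simp only [pyr, Finset.sum_add_distrib, h0, ← Finset.sum_smul, sum_axisCoeff, zero_smul,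
    add_zero, Finset.sum_const, Finset.card_univ, Fintype.card_fin]
  rw [← Nat.cast_smul_eq_nsmul ℝ]
  push_cast
  rfl

theorem pyr_apply_ne {j : Fin (n + 1)} (hj : j ≠ v) :
    pyr m f a v j = m + f j - ((n : ℝ) + 1)⁻¹ • a := by
  simp [pyr, axisCoeff, hj, sub_eq_add_neg]

theorem faceBarycenter_pyr (hn : 2 ≤ n) (hv : f v = 0) (h0 : ∑ j, f j = 0) :
    faceBarycenter (pyr m f a v) v = m - ((n : ℝ) + 1)⁻¹ • a := by
  have hn0 : (n : ℝ) ≠ 0 := by positivity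
  have h1 : ∑ j ∈ Finset.univ.erase v, f j = 0 := by
    rw [sum_eq_add_sum_ne v, hv, zero_add] at h0; exact h0
  rw [faceBarycenter, Finset.sum_congr rfl fun j hj => pyr_apply_ne (Finset.ne_of_mem_erase hj),
    Finset.sum_sub_distrib, Finset.sum_add_distrib, h1, add_zero, Finset.sum_const,
    Finset.sum_const, card_erase, ← smul_sub, ← Nat.cast_smul_eq_nsmul ℝ, smul_smul,
    inv_mul_cancel₀ hn0, one_smul]

theorem faceVec_pyr (hn : 2 ≤ n) (hv : f v = 0) (h0 : ∑ j, f j = 0) :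
    faceVec (pyr m f a v) v = f := by
  funext j
  by_cases hj : j = v
  · simp [faceVec, hj, hv]
  · simp only [faceVec, hj, if_false, faceBarycenter_pyr hn hv h0, pyr_apply_ne hj]
    abel

theorem pyr_apex_sub (hn : 2 ≤ n) (hv : f v = 0) (h0 : ∑ j, f j = 0) :
    pyr m f a v v - faceBarycenter (pyr m f a v) v = a := by
  rw [faceBarycenter_pyr hn hv h0, pyr, hv, axisCoeff, if_pos rfl]
  module

/-- Every configuration has this form; the first argument is the barycenter of all vertices. -/
theorem eq_pyr (p : Fin (n + 1) → Eucl n) (v : Fin (n + 1)) :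
    p = pyr (faceBarycenter p v + ((n : ℝ) + 1)⁻¹ • (p v - faceBarycenter p v)) (faceVec p v)
      (p v - faceBarycenter p v) v := by
  funext j
  by_cases hj : j = v
  · subst hj
    simp only [pyr, faceVec, axisCoeff, if_true]
    module
  · rw [pyr_apply_ne hj]
    simp only [faceVec, hj, if_false]
    abel

theorem faceDirection_pyr (hn : 2 ≤ n) (hv : f v = 0) (h0 : ∑ j, f j = 0) :
    faceDirection (pyr m f a v) v = Submodule.span ℝ (Set.range f) := by
  rw [← span_faceVec hn, faceVec_pyr hn hv h0]

end

theorem isInterior_of_eq_faceBarycenter (hn : 2 ≤ n) {p : Fin (n + 1) → Eucl n}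
    {v : Fin (n + 1)} (h : p v = faceBarycenter p v) : IsInterior p v := by
  have hn0 : (0 : ℝ) < n := by positivity
  have hn1 : (0 : ℝ) < (n : ℝ) + 1 := by positivity
  refine ⟨fun j => -(((n : ℝ) + 1) / n * axisCoeff v j), ⟨?_, ?_⟩, ?_, fun j hj => ?_⟩
  · rw [Finset.sum_neg_distrib, ← Finset.mul_sum, sum_axisCoeff]; simp
  · simp only [neg_smul, Finset.sum_neg_distrib, sum_axisCoeff_smul hn, h, sub_self, neg_zero]
  · simp only [axisCoeff, if_true]; field_simp; ring
  · simp only [axisCoeff, hj, if_false, zero_sub]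
    rw [mul_neg, neg_neg]
    positivity

/-- A displacement perpendicular to the face is either zero, and then the apex is the barycenter of
the face, or does not lie in the direction of the face. This lets the height shrink or grow freely.
-/
theorem apexDomain_of_isOverBarycenter (hn : 2 ≤ n) {p : Fin (n + 1) → Eucl n}
    {v : Fin (n + 1)} (hf : FaceIndep p v) (h : IsOverBarycenter p v) : ApexDomain p v := by
  refine ⟨hf, ?_⟩
  by_cases h0 : p v - faceBarycenter p v = 0
  · exact Or.inr (isInterior_of_eq_faceBarycenter hn (sub_eq_zero.1 h0))
  · refine Or.inl ((hf.affineIndependent_iff hn).2 fun hW => h0 ?_)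
    have := h _ hW
    rwa [inner_self_eq_zero] at this

end Pyr

/-! ### The preferred-apex retraction -/

section Phi

open Matrix

open scoped MatrixOrder

variable {n : ℕ}

/-- The displacement from the barycenter of the face opposite to `v` to the apex target. -/
def apexVec (p : Fin (n + 1) → Eucl n) (v : Fin (n + 1)) : Eucl n :=
  apexTarget p v - faceBarycenter p v

/-- The height of the regular simplex with unit edges. -/
def regHeight (n : ℕ) : ℝ := Real.sqrt (((n : ℝ) + 1) / (2 * n))

/-- The quadratic mean of the edge lengths of the face opposite to `v`. -/
def faceScale (p : Fin (n + 1) → Eucl n) (v : Fin (n + 1)) : ℝ :=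
  Real.sqrt (2 / ((n : ℝ) - 1) * ∑ j, ‖faceVec p v j‖ ^ 2)

/-- The factor by which the height of `p` over the face opposite to `v` is multiplied by the
preferred-apex retraction. -/
def heightFactor (p : Fin (n + 1) → Eucl n) (v : Fin (n + 1)) : ℝ :=
  (max (faceScale p v) (‖apexVec p v‖ / regHeight n))⁻¹

/-- The pyramid with apex `v` in which the preferred-apex retraction ends. -/
def pyramidOf (p : Fin (n + 1) → Eucl n) (v : Fin (n + 1)) : Fin (n + 1) → Eucl n :=
  pyr 0 ((Real.sqrt 2)⁻¹ • faceFrame p v) (heightFactor p v • apexVec p v) v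

/-- The configuration `p` with `v` moved parallel to the opposite face for a fraction `s` of the
way to its target. -/
def slide (p : Fin (n + 1) → Eucl n) (v : Fin (n + 1)) (s : ℝ) : Fin (n + 1) → Eucl n :=
  Function.update p v (AffineMap.lineMap (p v) (apexTarget p v) s)

/-- The preferred-apex retraction, on the times `[1/2, 1]`. -/
def phi (t : unitInterval) (p : Fin (n + 1) → Eucl n) (v : Fin (n + 1)) :
    Fin (n + 1) → Eucl n :=
  AffineMap.lineMap (slide p v (clampI (4 * (t : ℝ) - 2))) (pyramidOf p v)
    (clampI (4 * (t : ℝ) - 3) : ℝ)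

theorem clampI_of_le {s : ℝ} (h : s ≤ 0) : clampI s = 0 := Set.projIcc_of_le_left _ h

theorem clampI_of_ge {s : ℝ} (h : 1 ≤ s) : clampI s = 1 := Set.projIcc_of_right_le _ h

theorem clampI_of_mem {s : ℝ} (h : 0 ≤ s) (h' : s ≤ 1) : (clampI s : ℝ) = s :=
  congrArg Subtype.val (Set.projIcc_of_mem zero_le_one (Set.mem_Icc.2 ⟨h, h'⟩))

theorem clampI_coe (t : unitInterval) : clampI t = t := Set.projIcc_val _ t

theorem continuous_clampI : Continuous clampI := continuous_projIcc (h := zero_le_one)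

theorem regHeight_pos (hn : 2 ≤ n) : 0 < regHeight n := by
  have : (0 : ℝ) < n := by positivity
  exact Real.sqrt_pos.2 (by positivity)

theorem slide_apply_ne (p : Fin (n + 1) → Eucl n) {v j : Fin (n + 1)} (s : ℝ) (hj : j ≠ v) :
    slide p v s j = p j := Function.update_of_ne hj _ _

theorem slide_apply_self (p : Fin (n + 1) → Eucl n) (v : Fin (n + 1)) (s : ℝ) :
    slide p v s v = AffineMap.lineMap (p v) (apexTarget p v) s := Function.update_self _ _ _

theorem slide_zero (p : Fin (n + 1) → Eucl n) (v : Fin (n + 1)) : slide p v 0 = p := by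
  rw [slide, AffineMap.lineMap_apply_zero, Function.update_eq_self]

theorem phi_of_le (t : unitInterval) (h : (t : ℝ) ≤ 1 / 2) (p : Fin (n + 1) → Eucl n)
    (v : Fin (n + 1)) : phi t p v = p := by
  rw [phi, clampI_of_le (by linarith), clampI_of_le (by linarith)]
  simp [slide_zero]

theorem phi_of_le' (t : unitInterval) (h : (t : ℝ) ≤ 3 / 4) (p : Fin (n + 1) → Eucl n)
    (v : Fin (n + 1)) : phi t p v = slide p v (clampI (4 * (t : ℝ) - 2)) := by
  rw [phi, clampI_of_le (s := 4 * (t : ℝ) - 3) (by linarith)]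
  simp

theorem apexVec_mem (p : Fin (n + 1) → Eucl n) (v : Fin (n + 1)) :
    apexVec p v ∈ (faceDirection p v)ᗮ := by
  have : apexVec p v = -((faceBarycenter p v - p v) -
      (faceDirection p v).starProjection (faceBarycenter p v - p v)) := by
    rw [apexVec, apexTarget]; abel
  rw [this]
  exact Submodule.neg_mem _ (Submodule.sub_starProjection_mem_orthogonal _)

theorem apexTarget_sub_mem (p : Fin (n + 1) → Eucl n) (v : Fin (n + 1)) :
    apexTarget p v - p v ∈ faceDirection p v := by
  rw [apexTarget, add_sub_cancel_left]
  exact Submodule.starProjection_apply_mem _ _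

theorem apexTarget_of_isOverBarycenter {p : Fin (n + 1) → Eucl n} {v : Fin (n + 1)}
    (h : IsOverBarycenter p v) : apexTarget p v = p v := by
  have h' : faceBarycenter p v - p v ∈ (faceDirection p v)ᗮ := by
    rw [← neg_sub]; exact Submodule.neg_mem _ h
  rw [apexTarget, (Submodule.starProjection_apply_eq_zero_iff _).2 h', add_zero]

theorem slide_of_isOverBarycenter {p : Fin (n + 1) → Eucl n} {v : Fin (n + 1)}
    (h : IsOverBarycenter p v) (s : ℝ) : slide p v s = p := by
  rw [slide, apexTarget_of_isOverBarycenter h, AffineMap.lineMap_same_apply,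
    Function.update_eq_self]

theorem slide_sub (p : Fin (n + 1) → Eucl n) (v : Fin (n + 1)) (s : ℝ) :
    slide p v s v - faceBarycenter (slide p v s) v =
      (p v - faceBarycenter p v) + s • (apexTarget p v - p v) := by
  rw [faceBarycenter_congr (q := p) fun j hj => slide_apply_ne p s hj, slide_apply_self,
    AffineMap.lineMap_apply]
  simp only [vsub_eq_sub, vadd_eq_add]
  abel

/-- The displacement of the apex changes only by directions of the face, so nondegeneracy persists.
For degenerate configurations the slide runs inside the convex open face, towards its barycenter. -/
theorem apexDomain_slide (hn : 2 ≤ n) {p : Fin (n + 1) → Eucl n} {v : Fin (n + 1)}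
    (h : ApexDomain p v) {s : ℝ} (h0 : 0 ≤ s) (h1 : s ≤ 1) : ApexDomain (slide p v s) v := by
  have hf : FaceIndep (slide p v s) v := h.1.congr hn fun j hj => (slide_apply_ne p s hj).symm
  have hW : faceDirection (slide p v s) v = faceDirection p v :=
    faceDirection_congr fun j hj => slide_apply_ne p s hj
  refine ⟨hf, ?_⟩
  by_cases ha : AffineIndependent ℝ p
  · left
    rw [hf.affineIndependent_iff hn, hW, slide_sub,
      Submodule.add_mem_iff_left _ (Submodule.smul_mem _ _ (apexTarget_sub_mem p v))]
    exact (h.1.affineIndependent_iff hn).1 ha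
  · right
    obtain ⟨c, hc, hcv, hpos⟩ := h.2.resolve_left ha
    have hmem : p v - faceBarycenter p v ∈ faceDirection p v := by
      by_contra hm
      exact ha ((h.1.affineIndependent_iff hn).2 hm)
    -- The displacement of the target lies in the direction of the face and is orthogonal to it.
    have htgt : apexTarget p v = faceBarycenter p v := by
      have := apexVec_mem p v
      have h2 : apexVec p v ∈ faceDirection p v := by
        have := Submodule.add_mem _ hmem (apexTarget_sub_mem p v)
        rwa [sub_add_sub_cancel', ← apexVec] at this
      have h3 := this _ h2
      rw [inner_self_eq_zero] at h3
      exact sub_eq_zero.1 h3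
    obtain ⟨d, hd, hdv, hdpos⟩ := isInterior_of_eq_faceBarycenter hn
      (p := Function.update p v (faceBarycenter p v)) (v := v) (by
        rw [Function.update_self]
        exact (faceBarycenter_congr fun j hj => by rw [Function.update_of_ne hj]).symm)
    -- Both dependencies have coefficient `-1` at `v`, so the barycentric coordinates of the moving
    -- apex are interpolated linearly.
    refine ⟨(1 - s) • c + s • d, ⟨?_, ?_⟩, ?_, fun j hj => ?_⟩
    · simp [Finset.sum_add_distrib, ← Finset.mul_sum, hc.1, hd.1]
    · have e1 := hc.2
      have e2 := hd.2
      rw [sum_eq_add_sum_ne v] at e1 e2 ⊢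
      rw [Function.update_self, Finset.sum_congr rfl fun j hj =>
        show d j • Function.update p v (faceBarycenter p v) j = d j • p j by
          rw [Function.update_of_ne (Finset.ne_of_mem_erase hj)]] at e2
      rw [Finset.sum_congr rfl fun j hj =>
        show ((1 - s) • c + s • d) j • slide p v s j = (1 - s) • c j • p j + s • d j • p j by
          rw [slide_apply_ne p s (Finset.ne_of_mem_erase hj)]
          simp [add_smul, mul_smul]]
      rw [Finset.sum_add_distrib, ← Finset.smul_sum, ← Finset.smul_sum,
        ← neg_eq_of_add_eq_zero_right e1, ← neg_eq_of_add_eq_zero_right e2, slide_apply_self,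
        htgt, AffineMap.lineMap_apply_module, Pi.add_apply, Pi.smul_apply, Pi.smul_apply, hcv, hdv]
      module
    · simp only [Pi.add_apply, Pi.smul_apply, hcv, hdv, smul_eq_mul]; ring
    · have hc' := hpos j hj
      have hd' := hdpos j hj
      simp only [Pi.add_apply, Pi.smul_apply, smul_eq_mul]
      rcases h0.eq_or_lt with rfl | hs
      · simpa using hc'
      · have := mul_pos hs hd'
        have := mul_nonneg (sub_nonneg.2 h1) hc'.le
        linarith

theorem faceScale_pos (hn : 2 ≤ n) {p : Fin (n + 1) → Eucl n} {v : Fin (n + 1)}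
    (h : FaceIndep p v) : 0 < faceScale p v := by
  have h2 : (2 : ℝ) ≤ n := by exact_mod_cast hn
  refine Real.sqrt_pos.2 (mul_pos (div_pos two_pos (by linarith)) ?_)
  refine lt_of_le_of_ne (Finset.sum_nonneg fun j _ => by positivity) fun h0 => ?_
  have hz : ∀ j, faceVec p v j = 0 := fun j => by
    have := (Finset.sum_eq_zero_iff_of_nonneg fun j _ => by positivity).1 h0.symm j
      (Finset.mem_univ j)
    simpa using this
  obtain ⟨i, hi, -⟩ := exists_third hn v v
  obtain ⟨j, hj, hji⟩ := exists_third hn v i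
  have := (faceIndep_iff hn).1 h (Pi.single i 1 - Pi.single j 1) (by simp [hz])
    ((faceProj_mulVec_eq_zero hn).2 ⟨by simp [Ne.symm hi, Ne.symm hj], by simp⟩)
  have := congrFun this i
  simp [Ne.symm hji] at this

theorem heightFactor_pos (hn : 2 ≤ n) {p : Fin (n + 1) → Eucl n} {v : Fin (n + 1)}
    (h : FaceIndep p v) : 0 < heightFactor p v :=
  inv_pos.2 (lt_max_of_lt_left (faceScale_pos hn h))

/-- The recombination of the frame of the face in the last part of the retraction. -/
def frameMatrix (p : Fin (n + 1) → Eucl n) (v : Fin (n + 1)) (s : ℝ) :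
    Matrix (Fin (n + 1)) (Fin (n + 1)) ℝ :=
  (1 - s) • CFC.sqrt (gram ℝ (faceVec p v) + faceProj v) + (s * (Real.sqrt 2)⁻¹) • 1

theorem posDef_frameMatrix (hn : 2 ≤ n) {p : Fin (n + 1) → Eucl n} {v : Fin (n + 1)}
    (h : FaceIndep p v) {s : ℝ} (h0 : 0 ≤ s) (h1 : s ≤ 1) : (frameMatrix p v s).PosDef := by
  have hs := posDef_sqrt (isRelationProj_faceVec hn h).posDef
  have h2 : 0 < (Real.sqrt 2)⁻¹ := by positivity
  rcases h0.eq_or_lt with rfl | h0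
  · simpa [frameMatrix] using hs
  · exact Matrix.PosDef.posSemidef_add (hs.posSemidef.smul (sub_nonneg.2 h1))
      (Matrix.PosDef.one.smul (mul_pos h0 h2))

theorem frameMatrix_mul (hn : 2 ≤ n) {p : Fin (n + 1) → Eucl n} {v : Fin (n + 1)}
    (h : FaceIndep p v) (s : ℝ) : frameMatrix p v s * faceProj v =
      ((1 - s) + s * (Real.sqrt 2)⁻¹) • faceProj v := by
  rw [frameMatrix, add_mul, smul_mul_assoc, smul_mul_assoc, one_mul,
    (isRelationProj_faceVec hn h).sqrt_mul, add_smul]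

/-- The face itself is the frame recombined by a positive square root. The segment from the face to
the scaled frame is thus the frame acted on by a segment of positive definite matrices. -/
theorem act_frameMatrix (hn : 2 ≤ n) {p : Fin (n + 1) → Eucl n} {v : Fin (n + 1)}
    (h : FaceIndep p v) (s : ℝ) : act (faceFrame p v) (frameMatrix p v s) =
      (1 - s) • faceVec p v + (s * (Real.sqrt 2)⁻¹) • faceFrame p v := by
  rw [frameMatrix, act_add, act_smul, act_smul, act_one, faceFrame,
    (isRelationProj_faceVec hn h).act_polar_sqrt]

/-- The form `pyr` is linear in barycenter, face and axis, so the straight line to the pyramid moves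
these three independently. -/
theorem lineMap_slide_one (p : Fin (n + 1) → Eucl n) (v : Fin (n + 1)) (s : ℝ) :
    AffineMap.lineMap (slide p v 1) (pyramidOf p v) s =
      pyr ((1 - s) • (faceBarycenter p v + ((n : ℝ) + 1)⁻¹ • apexVec p v))
        ((1 - s) • faceVec p v + (s * (Real.sqrt 2)⁻¹) • faceFrame p v)
        (((1 - s) + s * heightFactor p v) • apexVec p v) v := by
  have hb : faceBarycenter (slide p v 1) v = faceBarycenter p v :=
    faceBarycenter_congr fun j hj => slide_apply_ne p 1 hj
  have e : slide p v 1 v - faceBarycenter p v = apexVec p v := by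
    rw [slide_apply_self, AffineMap.lineMap_apply_one, apexVec]
  have h1 := eq_pyr (slide p v 1) v
  rw [hb, e, faceVec_congr (q := p) fun j hj => slide_apply_ne p 1 hj] at h1
  rw [h1, AffineMap.lineMap_apply_module, pyramidOf]
  funext j
  simp only [pyr, Pi.add_apply, Pi.smul_apply]
  module

section Late

open Matrix

variable {p : Fin (n + 1) → Eucl n} {v : Fin (n + 1)} {s : ℝ}

theorem lateFace_self (hn : 2 ≤ n) (h : FaceIndep p v) :
    ((1 - s) • faceVec p v + (s * (Real.sqrt 2)⁻¹) • faceFrame p v) v = 0 := by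
  simp [faceVec_self, faceFrame_self hn h]

theorem sum_lateFace (hn : 2 ≤ n) (h : FaceIndep p v) :
    ∑ j, ((1 - s) • faceVec p v + (s * (Real.sqrt 2)⁻¹) • faceFrame p v) j = 0 := by
  simp [Finset.sum_add_distrib, ← Finset.smul_sum, sum_faceVec hn, sum_faceFrame hn h]

theorem faceDirection_late (hn : 2 ≤ n) (h : FaceIndep p v) (h0 : 0 ≤ s) (h1 : s ≤ 1) :
    faceDirection (AffineMap.lineMap (slide p v 1) (pyramidOf p v) s) v = faceDirection p v := by
  rw [lineMap_slide_one, faceDirection_pyr hn (lateFace_self hn h) (sum_lateFace hn h),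
    ← act_frameMatrix hn h, span_range_act _ (posDef_frameMatrix hn h h0 h1),
    span_faceFrame hn h]

theorem isOverBarycenter_late (hn : 2 ≤ n) (h : FaceIndep p v) (h0 : 0 ≤ s) (h1 : s ≤ 1) :
    IsOverBarycenter (AffineMap.lineMap (slide p v 1) (pyramidOf p v) s) v := by
  rw [IsOverBarycenter, faceDirection_late hn h h0 h1, lineMap_slide_one,
    pyr_apex_sub hn (lateFace_self hn h) (sum_lateFace hn h)]
  exact Submodule.smul_mem _ _ (apexVec_mem p v)

/-- The moving face is a positive definite recombination of the frame, and such recombinations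
create no new relations. -/
theorem faceIndep_late (hn : 2 ≤ n) (h : FaceIndep p v) (h0 : 0 ≤ s) (h1 : s ≤ 1) :
    FaceIndep (AffineMap.lineMap (slide p v 1) (pyramidOf p v) s) v := by
  rw [faceIndep_iff hn, lineMap_slide_one, faceVec_pyr hn (lateFace_self hn h) (sum_lateFace hn h),
    ← act_frameMatrix hn h]
  intro x hx hN
  exact eq_zero_of_sum_smul_act (posDef_frameMatrix hn h h0 h1) (faceProj_transpose v)
    (frameMatrix_mul hn h s) (gram_faceFrame hn h) hN hx

end Late

theorem apexDomain_phi (hn : 2 ≤ n) {p : Fin (n + 1) → Eucl n} {v : Fin (n + 1)}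
    (h : ApexDomain p v) (t : unitInterval) : ApexDomain (phi t p v) v := by
  rcases le_total (t : ℝ) (3 / 4) with ht | ht
  · rw [phi_of_le' t ht]
    exact apexDomain_slide hn h (clampI _).2.1 (clampI _).2.2
  · rw [phi, clampI_of_ge (s := 4 * (t : ℝ) - 2) (by linarith)]
    exact apexDomain_of_isOverBarycenter hn (faceIndep_late hn h.1 (clampI _).2.1 (clampI _).2.2)
      (isOverBarycenter_late hn h.1 (clampI _).2.1 (clampI _).2.2)

theorem dist_faceFrame (hn : 2 ≤ n) {p : Fin (n + 1) → Eucl n} {v : Fin (n + 1)}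
    (h : FaceIndep p v) {i j : Fin (n + 1)} (hi : i ≠ v) (hj : j ≠ v) (hij : i ≠ j) :
    dist (faceFrame p v i) (faceFrame p v j) = Real.sqrt 2 := by
  rw [dist_eq_norm, ← Real.sqrt_sq (norm_nonneg _), norm_sub_sq_real,
    ← real_inner_self_eq_norm_sq, ← real_inner_self_eq_norm_sq]
  simp only [inner_faceFrame hn h, faceProj, hi, hj, hij, if_true, if_false]
  congr 1
  ring

/-- The second entry of the maximum in `heightFactor` caps the height at that of the regular
simplex; the first entry accounts for rescaling the face. -/
theorem norm_heightFactor_smul_le (hn : 2 ≤ n) {p : Fin (n + 1) → Eucl n} {v : Fin (n + 1)}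
    (h : FaceIndep p v) : ‖heightFactor p v • apexVec p v‖ ≤ regHeight n := by
  rw [norm_smul, Real.norm_of_nonneg (heightFactor_pos hn h).le, heightFactor, inv_mul_le_iff₀
    (lt_max_of_lt_left (faceScale_pos hn h))]
  have := le_max_right (faceScale p v) (‖apexVec p v‖ / regHeight n)
  rwa [div_le_iff₀ (regHeight_pos hn)] at this

theorem isPyramid_pyramidOf (hn : 2 ≤ n) {p : Fin (n + 1) → Eucl n} {v : Fin (n + 1)}
    (h : FaceIndep p v) : IsPyramid (pyramidOf p v) v := by
  have e : pyramidOf p v = AffineMap.lineMap (slide p v 1) (pyramidOf p v) (1 : ℝ) := by simp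
  have hv : ((Real.sqrt 2)⁻¹ • faceFrame p v) v = 0 := by simp [faceFrame_self hn h]
  have hs : ∑ j, ((Real.sqrt 2)⁻¹ • faceFrame p v) j = 0 := by
    simp [← Finset.smul_sum, sum_faceFrame hn h]
  refine ⟨fun i j hi hj hij => ?_, ?_, ?_, ?_⟩
  · rw [pyramidOf, pyr_apply_ne hi, pyr_apply_ne hj, dist_sub_right, zero_add, zero_add]
    simp only [Pi.smul_apply]
    rw [dist_smul₀, dist_faceFrame hn h hi hj hij, Real.norm_of_nonneg (by positivity),
      inv_mul_cancel₀ (by positivity)]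
  · rw [e]
    exact isOverBarycenter_late hn h zero_le_one le_rfl
  · rw [pyramidOf, sum_pyr hs, smul_zero]
  · rw [dist_eq_norm, pyramidOf, pyr_apex_sub hn hv hs]
    exact norm_heightFactor_smul_le hn h

theorem phi_one (p : Fin (n + 1) → Eucl n) (v : Fin (n + 1)) : phi 1 p v = pyramidOf p v := by
  rw [phi, clampI_of_ge (s := 4 * ((1 : unitInterval) : ℝ) - 3) (by simp; norm_num)]
  simp

end Phi

/-! ### The retraction on regular faces, its equivariance and its continuity -/

section PhiProperties

open Matrix

variable {n : ℕ}

/-! ### Regular faces -/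

theorem gram_smul {ι : Type*} [Fintype ι] {E : Type*} [NormedAddCommGroup E]
    [InnerProductSpace ℝ E] (c : ℝ) (f : ι → E) : gram ℝ (c • f) = c ^ 2 • gram ℝ f := by
  ext i j
  simp only [gram_apply, Pi.smul_apply, real_inner_smul_left, real_inner_smul_right,
    Matrix.smul_apply, smul_eq_mul]
  ring

theorem smul_act {ι : Type*} [Fintype ι] {E : Type*} [NormedAddCommGroup E]
    [InnerProductSpace ℝ E] (c : ℝ) (f : ι → E) (B : Matrix ι ι ℝ) :
    act (c • f) B = c • act f B := by
  funext j
  simp only [act, Pi.smul_apply, Finset.smul_sum]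
  exact Finset.sum_congr rfl fun i _ => smul_comm _ _ _

theorem gram_faceVec_of_regular (hn : 2 ≤ n) {p : Fin (n + 1) → Eucl n} {v : Fin (n + 1)} {L : ℝ}
    (h : ∀ i j, i ≠ v → j ≠ v → i ≠ j → dist (p i) (p j) = L) :
    gram ℝ (faceVec p v) = (L ^ 2 / 2) • (1 - faceProj v) := by
  ext i j
  rw [gram_apply, Matrix.smul_apply, Matrix.sub_apply, Matrix.one_apply, smul_eq_mul]
  by_cases hi : i = v
  · subst hi
    rw [faceVec_self, inner_zero_left, faceProj, if_pos rfl]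
    by_cases hj : j = i
    · simp [hj]
    · simp [hj, Ne.symm hj]
  · by_cases hj : j = v
    · subst hj
      simp [faceVec_self, faceProj, hi]
    · rw [inner_of_equidistant (s := Finset.univ.erase v) (L := L) _ (sum_faceVec_erase hn p v) ?_
        (by simpa using hi) (by simpa using hj), card_erase]
      · simp [faceProj, hi, hj]
      · intro i hi j hj hij
        have hi := Finset.ne_of_mem_erase hi
        have hj := Finset.ne_of_mem_erase hj
        simp [faceVec, hi, hj, h i j hi hj hij]

theorem faceFrame_of_regular (hn : 2 ≤ n) {p : Fin (n + 1) → Eucl n} {v : Fin (n + 1)} {L : ℝ}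
    (hL : 0 < L) (h : ∀ i j, i ≠ v → j ≠ v → i ≠ j → dist (p i) (p j) = L) :
    faceFrame p v = (Real.sqrt 2 / L) • faceVec p v := by
  have h2 : (0 : ℝ) < Real.sqrt 2 := by positivity
  have hs := faceProj_transpose v
  have hi := faceProj_mul_self hn v
  set z := (Real.sqrt 2 / L) • faceVec p v with hz
  have hzg : gram ℝ z = 1 - faceProj v := by
    rw [hz, gram_smul, gram_faceVec_of_regular hn h, smul_smul, div_pow,
      Real.sq_sqrt zero_le_two]
    have : 2 / L ^ 2 * (L ^ 2 / 2) = 1 := by field_simp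
    rw [this, one_smul]
  have hzN : act z (faceProj v) = 0 := by
    rw [hz, smul_act, act_faceProj (faceVec_self p v) (sum_faceVec hn p v), smul_zero]
  -- The face is a multiple of the candidate `z`. As `act z (faceProj v) = 0`, adding `faceProj v`
  -- to the matrix costs nothing and brings it into the form required by `polar_act`.
  have hf : faceVec p v = act z ((L / Real.sqrt 2) • (1 - faceProj v) + faceProj v) := by
    have : act z (1 - faceProj v) = z := by
      have h1 := act_add z (1 - faceProj v) (faceProj v)
      rw [sub_add_cancel, act_one, hzN, add_zero] at h1
      exact h1.symm
    rw [act_add, act_smul, this, hzN, add_zero, hz, smul_smul]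
    have : L / Real.sqrt 2 * (Real.sqrt 2 / L) = 1 := by field_simp
    rw [this, one_smul]
  rw [faceFrame, hf, polar_act (posDef_smul_one_sub_add hs hi (by positivity)) hs ?_ hzg]
  rw [add_mul, smul_mul_assoc, sub_mul, one_mul, hi, sub_self, smul_zero, zero_add]

theorem faceScale_of_regular (hn : 2 ≤ n) {p : Fin (n + 1) → Eucl n} {v : Fin (n + 1)} {L : ℝ}
    (hL : 0 < L) (h : ∀ i j, i ≠ v → j ≠ v → i ≠ j → dist (p i) (p j) = L) :
    faceScale p v = L := by
  have hn2 : (2 : ℝ) ≤ n := by exact_mod_cast hn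
  have hn0 : (n : ℝ) ≠ 0 := by positivity
  have hn1 : (n : ℝ) - 1 ≠ 0 := by intro h; linarith
  have : ∑ j, ‖faceVec p v j‖ ^ 2 = L ^ 2 / 2 * ((n : ℝ) - 1) := by
    have e : ∀ j, ‖faceVec p v j‖ ^ 2 = gram ℝ (faceVec p v) j j := fun j => by
      rw [gram_apply, real_inner_self_eq_norm_sq]
    simp only [e, gram_faceVec_of_regular hn h]
    rw [sum_eq_add_sum_ne v, Finset.sum_congr rfl fun j hj =>
      show ((L ^ 2 / 2) • (1 - faceProj v) : Matrix (Fin (n + 1)) (Fin (n + 1)) ℝ) j j =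
        L ^ 2 / 2 * (1 - (n : ℝ)⁻¹) by simp [faceProj, Finset.ne_of_mem_erase hj], Finset.sum_const, card_erase]
    simp [faceProj]
    field_simp
  rw [faceScale, this]
  have e : 2 / ((n : ℝ) - 1) * (L ^ 2 / 2 * ((n : ℝ) - 1)) = L ^ 2 := by field_simp
  rw [e, Real.sqrt_sq hL.le]

/-- For a regular face with edge `L` and height at most that of the regular simplex, the maximum in
`heightFactor` is `L`. Face and axis are then scaled by the same factor. -/
theorem pyramidOf_of_regular (hn : 2 ≤ n) {p : Fin (n + 1) → Eucl n} {v : Fin (n + 1)} {L : ℝ}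
    (hL : 0 < L) (h : ∀ i j, i ≠ v → j ≠ v → i ≠ j → dist (p i) (p j) = L)
    (ho : IsOverBarycenter p v) (hh : dist (p v) (faceBarycenter p v) ≤ L * regHeight n) :
    pyramidOf p v = pyr 0 (L⁻¹ • faceVec p v) (L⁻¹ • (p v - faceBarycenter p v)) v := by
  have ha : apexVec p v = p v - faceBarycenter p v := by
    rw [apexVec, apexTarget_of_isOverBarycenter ho]
  have hm : heightFactor p v = L⁻¹ := by
    rw [heightFactor, faceScale_of_regular hn hL h, ha, max_eq_left]
    rwa [div_le_iff₀ (regHeight_pos hn), ← dist_eq_norm]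
  rw [pyramidOf, ha, hm, faceFrame_of_regular hn hL h, smul_smul]
  have : (Real.sqrt 2)⁻¹ * (Real.sqrt 2 / L) = L⁻¹ := by field_simp
  rw [this]

theorem phi_of_isOverBarycenter {p : Fin (n + 1) → Eucl n} {v : Fin (n + 1)}
    (ho : IsOverBarycenter p v) (t : unitInterval) :
    phi t p v = AffineMap.lineMap p (pyramidOf p v) (clampI (4 * (t : ℝ) - 3) : ℝ) := by
  rw [phi, slide_of_isOverBarycenter ho]

theorem sum_eq_smul (hn : 2 ≤ n) (p : Fin (n + 1) → Eucl n) (v : Fin (n + 1)) :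
    ∑ j, p j = ((n : ℝ) + 1) •
      (faceBarycenter p v + ((n : ℝ) + 1)⁻¹ • (p v - faceBarycenter p v)) := by
  conv_lhs => rw [eq_pyr p v]
  rw [sum_pyr (sum_faceVec hn p v)]

theorem phi_of_isPyramid (hn : 2 ≤ n) {p : Fin (n + 1) → Eucl n} {v : Fin (n + 1)}
    (h : IsPyramid p v) (t : unitInterval) : phi t p v = p := by
  obtain ⟨h1, h2, h3, h4⟩ := h
  have hn1 : (n : ℝ) + 1 ≠ 0 := by positivity
  rw [phi_of_isOverBarycenter h2, pyramidOf_of_regular hn one_pos h1 h2 (by rwa [one_mul])]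
  have e := eq_pyr p v
  rw [sum_eq_smul hn p v] at h3
  rw [(smul_eq_zero.1 h3).resolve_left hn1] at e
  rw [inv_one, one_smul, one_smul, ← e, AffineMap.lineMap_same_apply]

/-- All edges of `p` have length `L`. -/
def IsEquilateral (p : Fin (n + 1) → Eucl n) (L : ℝ) : Prop :=
  ∀ i j, i ≠ j → dist (p i) (p j) = L

/-- Relative to the barycenter, the inner products of distinct vertices are all equal; hence
differences of vertices of the face are orthogonal to the vector of `v`. -/
theorem IsEquilateral.isOverBarycenter (hn : 2 ≤ n) {p : Fin (n + 1) → Eucl n} {L : ℝ}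
    (h : IsEquilateral p L) (v : Fin (n + 1)) : IsOverBarycenter p v := by
  rw [IsOverBarycenter, ← span_faceVec hn, Submodule.mem_orthogonal]
  have hn1 : (n : ℝ) + 1 ≠ 0 := by positivity
  have hn0 : (n : ℝ) ≠ 0 := by positivity
  set m := ((n : ℝ) + 1)⁻¹ • ∑ j, p j with hm
  set g : Fin (n + 1) → Eucl n := fun j => p j - m with hg
  have hg0 : ∑ j, g j = 0 := by
    rw [hg, Finset.sum_sub_distrib, Finset.sum_const, Finset.card_univ, Fintype.card_fin, hm,
      ← Nat.cast_smul_eq_nsmul ℝ, smul_smul]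
    push_cast
    rw [mul_inv_cancel₀ hn1, one_smul, sub_self]
  have hgd : ∀ i ∈ Finset.univ, ∀ j ∈ Finset.univ, i ≠ j → dist (g i) (g j) = L :=
    fun i _ j _ hij => by simp [hg, h i j hij]
  have hgi := fun i j => inner_of_equidistant g hg0 hgd (Finset.mem_univ i) (Finset.mem_univ j)
  have hmain : ∀ j, j ≠ v → inner ℝ (p j - faceBarycenter p v) (g v) = 0 := by
    intro j hj
    have e : p j - faceBarycenter p v = (n : ℝ)⁻¹ • ∑ i ∈ Finset.univ.erase v, (g j - g i) := by
      simp only [hg, sub_sub_sub_cancel_right]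
      rw [Finset.sum_sub_distrib, Finset.sum_const, card_erase, ← Nat.cast_smul_eq_nsmul ℝ,
        smul_sub, smul_smul, inv_mul_cancel₀ hn0, one_smul, faceBarycenter]
    rw [e, real_inner_smul_left, sum_inner, Finset.sum_eq_zero, mul_zero]
    intro i hi
    rw [inner_sub_left, hgi, hgi, if_neg hj, if_neg (Finset.ne_of_mem_erase hi), sub_self]
  have hv : p v - faceBarycenter p v = (((n : ℝ) + 1) / n) • g v := by
    have e : p v - faceBarycenter p v = g v - (n : ℝ)⁻¹ • ∑ i ∈ Finset.univ.erase v, g i := by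
      simp only [hg]
      rw [Finset.sum_sub_distrib, Finset.sum_const, card_erase, ← Nat.cast_smul_eq_nsmul ℝ,
        smul_sub, smul_smul, inv_mul_cancel₀ hn0, one_smul, faceBarycenter]
      abel
    have e2 : ∑ i ∈ Finset.univ.erase v, g i = - g v := by
      rw [sum_eq_add_sum_ne v] at hg0
      exact (neg_eq_of_add_eq_zero_right hg0).symm
    rw [e, e2, smul_neg, sub_neg_eq_add]
    have : ((n : ℝ) + 1) / n = 1 + (n : ℝ)⁻¹ := by field_simp
    rw [this, add_smul, one_smul]
  intro u hu
  rw [hv, real_inner_smul_right]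
  refine mul_eq_zero_of_right _ ?_
  induction hu using Submodule.span_induction with
  | mem y hy =>
    obtain ⟨j, rfl⟩ := hy
    by_cases hj : j = v
    · simp [hj, faceVec_self]
    · simpa [faceVec, hj] using hmain j hj
  | zero => simp
  | add y z _ _ hy hz => rw [inner_add_left, hy, hz, add_zero]
  | smul a y _ hy => rw [real_inner_smul_left, hy, mul_zero]

theorem IsEquilateral.dist_faceBarycenter (hn : 2 ≤ n) {p : Fin (n + 1) → Eucl n} {L : ℝ}
    (hL : 0 < L) (h : IsEquilateral p L) (v : Fin (n + 1)) :
    dist (p v) (faceBarycenter p v) = L * regHeight n := by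
  obtain ⟨u, hu, -⟩ := exists_third hn v v
  have hn0 : (n : ℝ) ≠ 0 := by positivity
  have ho := h.isOverBarycenter hn v
  have h1 : inner ℝ (faceVec p v u) (p v - faceBarycenter p v) = 0 := by
    refine ho _ ?_
    rw [← span_faceVec hn]
    exact Submodule.subset_span ⟨u, rfl⟩
  have h2 : ‖faceVec p v u‖ ^ 2 = L ^ 2 / 2 * (1 - (n : ℝ)⁻¹) := by
    have := congrFun (congrFun (gram_faceVec_of_regular hn
      (fun i j _ _ hij => h i j hij) (v := v)) u) u
    rw [gram_apply, real_inner_self_eq_norm_sq] at this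
    rw [this]
    simp [faceProj, hu]
  have h3 : L ^ 2 = ‖p v - faceBarycenter p v‖ ^ 2 + ‖faceVec p v u‖ ^ 2 := by
    have e : p v - p u = (p v - faceBarycenter p v) - faceVec p v u := by
      simp [faceVec, hu]
    rw [← h v u (Ne.symm hu), dist_eq_norm, e, norm_sub_sq_real, real_inner_comm, h1]
    ring
  rw [dist_eq_norm, ← Real.sqrt_sq (norm_nonneg _), regHeight]
  have h4 : ‖p v - faceBarycenter p v‖ ^ 2 = L ^ 2 * (((n : ℝ) + 1) / (2 * n)) := by
    rw [h2] at h3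
    field_simp at h3 ⊢
    linarith
  rw [h4, Real.sqrt_mul (sq_nonneg L), Real.sqrt_sq hL.le]

/-- On equilateral simplices, the preferred-apex retraction only scales and translates. -/
theorem phi_of_isEquilateral (hn : 2 ≤ n) {p : Fin (n + 1) → Eucl n} {L : ℝ} (hL : 0 < L)
    (h : IsEquilateral p L) (t : unitInterval) (v : Fin (n + 1)) :
    phi t p v = AffineMap.lineMap p (fun j => L⁻¹ • (p j - ((n : ℝ) + 1)⁻¹ • ∑ i, p i))
      (clampI (4 * (t : ℝ) - 3) : ℝ) := by
  have hn1 : (n : ℝ) + 1 ≠ 0 := by positivity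
  have ho := h.isOverBarycenter hn v
  rw [phi_of_isOverBarycenter ho, pyramidOf_of_regular hn hL (fun i j _ _ hij => h i j hij) ho
    (h.dist_faceBarycenter hn hL v).le]
  congr 2
  funext j
  rw [sum_eq_smul hn p v, smul_smul, inv_mul_cancel₀ hn1, one_smul]
  conv_rhs => rw [eq_pyr p v]
  have e := congrFun (eq_pyr p v) j
  rw [← eq_pyr p v, e, pyr, pyr, Pi.smul_apply]
  module

/-! ### Relabeling -/

variable (σ : Equiv.Perm (Fin (n + 1))) (p : Fin (n + 1) → Eucl n) (v : Fin (n + 1))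

theorem sum_erase_comp {M : Type*} [AddCommMonoid M] (g : Fin (n + 1) → M) :
    ∑ j ∈ Finset.univ.erase v, g (σ j) = ∑ j ∈ Finset.univ.erase (σ v), g j := by
  refine Finset.sum_bij (fun j _ => σ j) ?_ ?_ ?_ ?_
  · intro j hj; simpa using Finset.ne_of_mem_erase hj
  · intro i _ j _ h; exact σ.injective h
  · intro j hj
    exact ⟨σ.symm j, by simpa [Equiv.symm_apply_eq] using Finset.ne_of_mem_erase hj, by simp⟩
  · intro j _; rfl

theorem faceBarycenter_comp : faceBarycenter (p ∘ σ) v = faceBarycenter p (σ v) := by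
  rw [faceBarycenter, faceBarycenter, ← sum_erase_comp]
  rfl

theorem faceVec_comp : faceVec (p ∘ σ) v = faceVec p (σ v) ∘ σ := by
  funext j
  simp only [faceVec, faceBarycenter_comp, Function.comp_apply, σ.injective.eq_iff]

theorem faceProj_submatrix : (faceProj (σ v)).submatrix σ σ = faceProj v := by
  ext i j
  simp only [submatrix_apply, faceProj, σ.injective.eq_iff]

theorem faceDirection_comp : faceDirection (p ∘ σ) v = faceDirection p (σ v) := by
  rw [faceDirection, faceDirection, Set.image_comp, Set.image_compl_eq σ.bijective,
    Set.image_singleton]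

theorem apexTarget_comp : apexTarget (p ∘ σ) v = apexTarget p (σ v) := by
  rw [apexTarget, apexTarget, faceBarycenter_comp]
  simp only [faceDirection_comp, Function.comp_apply]

theorem apexVec_comp : apexVec (p ∘ σ) v = apexVec p (σ v) := by
  rw [apexVec, apexVec, apexTarget_comp, faceBarycenter_comp]

theorem faceScale_comp : faceScale (p ∘ σ) v = faceScale p (σ v) := by
  rw [faceScale, faceScale, faceVec_comp]
  congr 2
  exact Equiv.sum_comp σ fun j => ‖faceVec p (σ v) j‖ ^ 2

theorem heightFactor_comp : heightFactor (p ∘ σ) v = heightFactor p (σ v) := by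
  rw [heightFactor, heightFactor, faceScale_comp, apexVec_comp]

variable {p v}

theorem faceFrame_comp (hn : 2 ≤ n) (h : FaceIndep p (σ v)) :
    faceFrame (p ∘ σ) v = faceFrame p (σ v) ∘ σ := by
  rw [faceFrame, faceFrame, faceVec_comp, ← faceProj_submatrix σ v]
  exact polar_comp (isRelationProj_faceVec hn h) σ

theorem pyramidOf_comp (hn : 2 ≤ n) (h : FaceIndep p (σ v)) :
    pyramidOf (p ∘ σ) v = pyramidOf p (σ v) ∘ σ := by
  funext j
  simp only [pyramidOf, pyr, faceFrame_comp σ hn h, heightFactor_comp, apexVec_comp,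
    Function.comp_apply, Pi.smul_apply, axisCoeff, σ.injective.eq_iff]

theorem slide_comp (s : ℝ) : slide (p ∘ σ) v s = slide p (σ v) s ∘ σ := by
  funext j
  by_cases hj : j = v
  · subst hj
    rw [slide_apply_self, Function.comp_apply, Function.comp_apply, slide_apply_self,
      apexTarget_comp]
  · rw [slide_apply_ne _ _ hj, Function.comp_apply, Function.comp_apply,
      slide_apply_ne _ _ (σ.injective.ne hj)]

theorem phi_comp (hn : 2 ≤ n) (h : FaceIndep p (σ v)) (t : unitInterval) :
    phi t (p ∘ σ) v = phi t p (σ v) ∘ σ := by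
  funext j
  simp only [phi, pyramidOf_comp σ hn h, slide_comp, AffineMap.lineMap_apply_module,
    Pi.add_apply, Pi.smul_apply, Function.comp_apply]

/-! ### Continuity -/

variable (v)

theorem continuous_faceBarycenter : Continuous fun p : EK n => faceBarycenter p.1 v := by
  have : Continuous fun p : EK n => ∑ i ∈ Finset.univ.erase v, p.1 i :=
    continuous_finsetSum _ fun i _ => (continuous_apply i).comp continuous_subtype_val
  exact this.const_smul (n : ℝ)⁻¹

theorem continuous_vertex (j : Fin (n + 1)) : Continuous fun p : EK n => p.1 j :=
  (continuous_apply j).comp continuous_subtype_val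

theorem continuous_faceVec : Continuous fun p : EK n => faceVec p.1 v := by
  refine continuous_pi fun j => ?_
  by_cases hj : j = v
  · simp only [faceVec, hj, if_true]; exact continuous_const
  · simp only [faceVec, hj, if_false]
    exact (continuous_vertex j).sub (continuous_faceBarycenter v)

theorem continuous_faceFrame (hn : 2 ≤ n) : Continuous fun p : EK n => faceFrame p.1 v :=
  continuous_polar (continuous_faceVec v) fun p =>
    (isRelationProj_faceVec hn (faceIndep hn p.2 v)).posDef

theorem continuous_apexTarget (hn : 2 ≤ n) : Continuous fun p : EK n => apexTarget p.1 v := by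
  -- The subspace projected onto varies with `p`; expanding in the frame reduces continuity to that
  -- of the frame.
  have : (fun p : EK n => apexTarget p.1 v) = fun p : EK n => p.1 v +
      ∑ j, inner ℝ (faceFrame p.1 v j) (faceBarycenter p.1 v - p.1 v) • faceFrame p.1 v j := by
    funext p
    exact apexTarget_eq hn (faceIndep hn p.2 v)
  rw [this]
  have h1 := fun j => (continuous_apply j).comp (continuous_faceFrame v hn)
  refine (continuous_vertex v).add (continuous_finsetSum _ fun j _ => ?_)
  exact Continuous.smul
    (Continuous.inner (𝕜 := ℝ) (h1 j) ((continuous_faceBarycenter v).sub (continuous_vertex v)))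
    (h1 j)

theorem continuous_apexVec (hn : 2 ≤ n) : Continuous fun p : EK n => apexVec p.1 v :=
  (continuous_apexTarget v hn).sub (continuous_faceBarycenter v)

theorem continuous_faceScale : Continuous fun p : EK n => faceScale p.1 v := by
  unfold faceScale
  have h1 := fun j => (continuous_apply j).comp (continuous_faceVec v)
  exact (continuous_const.mul (continuous_finsetSum _ fun j _ => ((h1 j).norm.pow 2))).sqrt

theorem continuous_heightFactor (hn : 2 ≤ n) :
    Continuous fun p : EK n => heightFactor p.1 v := by
  unfold heightFactor
  refine ((continuous_faceScale v).max ((continuous_apexVec v hn).norm.div_const _)).inv₀ ?_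
  intro p
  exact (lt_max_of_lt_left (faceScale_pos hn (faceIndep hn p.2 v))).ne'

theorem continuous_pyramidOf (hn : 2 ≤ n) : Continuous fun p : EK n => pyramidOf p.1 v := by
  refine continuous_pi fun j => ?_
  have h1 := (continuous_apply j).comp (continuous_faceFrame v hn)
  have h2 : Continuous fun p : EK n => heightFactor p.1 v • apexVec p.1 v :=
    (continuous_heightFactor v hn).smul (continuous_apexVec v hn)
  exact (continuous_const.add (h1.const_smul _)).add (h2.const_smul (axisCoeff v j))

theorem continuous_phi (hn : 2 ≤ n) :
    Continuous fun x : unitInterval × EK n => phi x.1 x.2.1 v := by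
  have hc : ∀ a : ℝ, Continuous fun x : unitInterval × EK n =>
      (clampI (4 * (x.1 : ℝ) - a) : ℝ) := fun a =>
    continuous_subtype_val.comp (continuous_clampI.comp (by fun_prop))
  have hs : Continuous fun x : unitInterval × EK n =>
      slide x.2.1 v (clampI (4 * (x.1 : ℝ) - 2)) := by
    unfold slide
    refine Continuous.update (continuous_subtype_val.comp continuous_snd) v ?_
    exact ((continuous_vertex v).comp continuous_snd).lineMap
      ((continuous_apexTarget v hn).comp continuous_snd) (hc 2)
  exact hs.lineMap ((continuous_pyramidOf v hn).comp continuous_snd) (hc 3)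

end PhiProperties

/-! ### Gluing a deformation to the retraction along a choice of apex -/

section Gluing

variable {n : ℕ}

/-- The data needed for following a deformation `F` of labeled configurations by the
preferred-apex retraction: a locally constant choice of an apex, defined at least where `F` does not
end in an equilateral simplex. -/
structure IsApexChoice (F : unitInterval → EK n → EK n) (ap : EK n → Fin (n + 1) → Prop) :
    Prop where
  continuous : Continuous (Function.uncurry F)
  zero : ∀ p, F 0 p = p
  equivariant : IsEquivariant F
  isOpen : ∀ v, IsOpen {p | ap p v}
  unique : ∀ p v w, ap p v → ap p w → v = w
  relabel : ∀ p σ v, ap (relabel p σ) v ↔ ap p (σ v)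
  domain : ∀ p v, ap p v → ∀ s, ApexDomain (F s p).1 v
  indep : ∀ p, (∀ v, ¬ ap p v) → ∀ s, AffineIndependent ℝ (F s p).1
  equilateral : ∀ p, (∀ v, ¬ ap p v) → ∃ L, 0 < L ∧ IsEquilateral (F 1 p).1 L

variable {F : unitInterval → EK n → EK n} {ap : EK n → Fin (n + 1) → Prop}

open Classical in
/-- The chosen apex (or an arbitrary vertex if there is none). -/
def apexOf (ap : EK n → Fin (n + 1) → Prop) (p : EK n) : Fin (n + 1) :=
  if h : ∃ v, ap p v then h.choose else 0

/-- The vertices which may be used as apex: only the chosen one if there is one. -/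
def IsAllowed (ap : EK n → Fin (n + 1) → Prop) (p : EK n) (v : Fin (n + 1)) : Prop :=
  ap p v ∨ ∀ w, ¬ ap p w

theorem isAllowed_apexOf (p : EK n) : IsAllowed ap p (apexOf ap p) := by
  by_cases h : ∃ v, ap p v
  · left
    rw [apexOf, dif_pos h]
    exact h.choose_spec
  · exact Or.inr (not_exists.1 h)

namespace IsApexChoice

theorem apexDomain (hn : 2 ≤ n) (hF : IsApexChoice F ap) {p : EK n} {v : Fin (n + 1)}
    (hv : IsAllowed ap p v) (s : unitInterval) : ApexDomain (F s p).1 v := by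
  rcases hv with h | h
  · exact hF.domain p v h s
  · exact ⟨faceIndep hn (F s p).2 v, Or.inl (hF.indep p h s)⟩

/-- Independence of the apex where none is chosen: before time `1/2` the map `phi` is the identity,
and afterwards it acts on an equilateral simplex, where no vertex is distinguished. -/
theorem phi_eq (hn : 2 ≤ n) (hF : IsApexChoice F ap) {p : EK n} {v w : Fin (n + 1)}
    (hv : IsAllowed ap p v) (hw : IsAllowed ap p w) (t : unitInterval) :
    phi t (F (clampI (2 * (t : ℝ))) p).1 v = phi t (F (clampI (2 * (t : ℝ))) p).1 w := by
  rcases hv with hv | hv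
  · rcases hw with hw | hw
    · rw [hF.unique p v w hv hw]
    · exact absurd hv (hw v)
  · rcases le_total (t : ℝ) (1 / 2) with ht | ht
    · rw [phi_of_le t ht, phi_of_le t ht]
    · obtain ⟨L, hL, he⟩ := hF.equilateral p hv
      rw [clampI_of_ge (by linarith), phi_of_isEquilateral hn hL he,
        phi_of_isEquilateral hn hL he]

/-- The deformation `F` during `[0, 1/2]`, followed by the preferred-apex retraction. -/
def glue (hn : 2 ≤ n) (hF : IsApexChoice F ap) (t : unitInterval) (p : EK n) : EK n :=
  ⟨phi t (F (clampI (2 * (t : ℝ))) p).1 (apexOf ap p),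
    (apexDomain_phi hn (hF.apexDomain hn (isAllowed_apexOf p) _) t).isLinearEmbedding hn⟩

theorem glue_eq (hn : 2 ≤ n) (hF : IsApexChoice F ap) {p : EK n} {v : Fin (n + 1)}
    (hv : IsAllowed ap p v) (t : unitInterval) :
    (hF.glue hn t p).1 = phi t (F (clampI (2 * (t : ℝ))) p).1 v :=
  hF.phi_eq hn (isAllowed_apexOf p) hv t

/-- The function `apexOf` may jump where no apex is chosen. It suffices that near a given point it
takes only values allowed at that point, and that the finitely many branches of `phi` for allowed
values agree there. -/
theorem continuous_glue (hn : 2 ≤ n) (hF : IsApexChoice F ap) :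
    Continuous (Function.uncurry (hF.glue hn)) := by
  rw [continuous_induced_rng]
  have hcont : ∀ v, Continuous fun x : unitInterval × EK n =>
      phi x.1 (F (clampI (2 * (x.1 : ℝ))) x.2).1 v := by
    intro v
    have h0 : Continuous fun x : unitInterval × EK n => (clampI (2 * (x.1 : ℝ)), x.2) :=
      (continuous_clampI.comp (continuous_const.mul
        (continuous_subtype_val.comp continuous_fst))).prodMk continuous_snd
    have h1 : Continuous fun x : unitInterval × EK n =>
        (x.1, F (clampI (2 * (x.1 : ℝ))) x.2) :=
      continuous_fst.prodMk (hF.continuous.comp h0)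
    have h2 := (continuous_phi v hn).comp h1
    simpa only [Function.comp_def] using h2
  rw [continuous_iff_continuousAt]
  intro x₀
  change ContinuousAt (fun x : unitInterval × EK n =>
    phi x.1 (F (clampI (2 * (x.1 : ℝ))) x.2).1 (apexOf ap x.2)) x₀
  -- A chosen apex persists nearby by openness and is the only one by uniqueness; if there is none,
  -- every vertex is allowed.
  have hallowed : ∀ᶠ x : unitInterval × EK n in 𝓝 x₀,
      IsAllowed ap x₀.2 (apexOf ap x.2) := by
    by_cases h : ∃ v, ap x₀.2 v
    · obtain ⟨v, hv⟩ := h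
      have : ∀ᶠ p in 𝓝 x₀.2, ap p v := (hF.isOpen v).mem_nhds hv
      filter_upwards [continuous_snd.continuousAt.eventually this] with x hx
      rcases isAllowed_apexOf (ap := ap) x.2 with h | h
      · rw [hF.unique _ _ _ h hx]; exact Or.inl hv
      · exact absurd hx (h v)
    · exact Filter.Eventually.of_forall fun x => Or.inr (not_exists.1 h)
  rw [ContinuousAt, Filter.tendsto_def]
  intro N hN
  have hall : ∀ᶠ x : unitInterval × EK n in 𝓝 x₀, ∀ v, IsAllowed ap x₀.2 v →
      phi x.1 (F (clampI (2 * (x.1 : ℝ))) x.2).1 v ∈ N := by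
    refine Filter.eventually_all.2 fun v => ?_
    by_cases hv : IsAllowed ap x₀.2 v
    · have h1 := (hcont v).continuousAt (x := x₀)
      have h2 : phi x₀.1 (F (clampI (2 * (x₀.1 : ℝ))) x₀.2).1 v =
          phi x₀.1 (F (clampI (2 * (x₀.1 : ℝ))) x₀.2).1 (apexOf ap x₀.2) :=
        hF.phi_eq hn hv (isAllowed_apexOf x₀.2) x₀.1
      have h3 : N ∈ 𝓝 (phi x₀.1 (F (clampI (2 * (x₀.1 : ℝ))) x₀.2).1 v) := by rw [h2]; exact hN
      filter_upwards [h1 h3] with x hx _ using hx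
    · exact Filter.Eventually.of_forall fun x h => absurd h hv
  filter_upwards [hall, hallowed] with x h1 h2 using h1 _ h2

theorem isAllowed_relabel (hF : IsApexChoice F ap) {p : EK n}
    {σ : Equiv.Perm (Fin (n + 1))} {v : Fin (n + 1)} :
    IsAllowed ap (SkeletonConfig.relabel p σ) v ↔ IsAllowed ap p (σ v) := by
  rw [IsAllowed, IsAllowed, hF.relabel]
  refine or_congr_right ⟨fun h w => ?_, fun h w => ?_⟩
  · have := h (σ.symm w)
    rwa [hF.relabel, Equiv.apply_symm_apply] at this
  · rw [hF.relabel]; exact h _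

theorem isEquivariant_glue (hn : 2 ≤ n) (hF : IsApexChoice F ap) :
    IsEquivariant (hF.glue hn) := by
  intro t p σ
  have h1 := isAllowed_apexOf (ap := ap) (SkeletonConfig.relabel p σ)
  have h2 := hF.isAllowed_relabel.1 h1
  apply Subtype.ext
  rw [hF.glue_eq hn h1, hF.equivariant]
  change phi t ((F _ p).1 ∘ σ) _ = (hF.glue hn t p).1 ∘ σ
  rw [phi_comp σ hn (faceIndep hn (F _ p).2 _), hF.glue_eq hn h2]

theorem glue_zero (hn : 2 ≤ n) (hF : IsApexChoice F ap) (p : EK n) : hF.glue hn 0 p = p := by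
  apply Subtype.ext
  rw [hF.glue_eq hn (isAllowed_apexOf p), phi_of_le _ (by simp), clampI_of_le (by simp), hF.zero]

theorem isPyramid_glue_one (hn : 2 ≤ n) (hF : IsApexChoice F ap) {p : EK n} {v : Fin (n + 1)}
    (hv : IsAllowed ap p v) : IsPyramid (hF.glue hn 1 p).1 v := by
  rw [hF.glue_eq hn hv, phi_one]
  exact isPyramid_pyramidOf hn (faceIndep hn (F _ p).2 v)

theorem exists_deformation (hn : 2 ≤ n) (hF : IsApexChoice F ap) :
    ∃ H : unitInterval → CK n → CK n, IsDeformationInto (PK n) H ∧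
      ∀ t p, H t (unlabel p) = unlabel (hF.glue hn t p) := by
  obtain ⟨H, hH, he⟩ := exists_descend hn (hF.continuous_glue hn) (hF.isEquivariant_glue hn)
  refine ⟨H, ⟨hH, fun x => ?_, fun x => ?_⟩, he⟩
  · obtain ⟨p, rfl⟩ := unlabel_surjective x
    rw [he, hF.glue_zero]
  · obtain ⟨p, rfl⟩ := unlabel_surjective x
    rw [he]
    exact ⟨_, _, rfl, hF.isPyramid_glue_one hn (isAllowed_apexOf p)⟩

theorem isPreferredApexPath_glue (hn : 2 ≤ n) (hF : IsApexChoice F ap) {p : EK n}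
    {v : Fin (n + 1)} (hv : IsAllowed ap p v) :
    IsPreferredApexPath (fun t => hF.glue hn t p) v := by
  have hlate : ∀ t : unitInterval, 1 / 2 ≤ (t : ℝ) →
      (hF.glue hn t p).1 = phi t (F 1 p).1 v := fun t ht => by
    rw [hF.glue_eq hn hv, clampI_of_ge (by linarith)]
  have hhalf : (clampI (1 / 2) : ℝ) = 1 / 2 := clampI_of_mem (by norm_num) (by norm_num)
  have h34 : (clampI (3 / 4) : ℝ) = 3 / 4 := clampI_of_mem (by norm_num) (by norm_num)
  have hstart : (hF.glue hn (clampI (1 / 2)) p).1 = (F 1 p).1 := by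
    rw [hlate _ hhalf.ge, phi_of_le _ hhalf.le]
  have hfi := faceIndep hn (F 1 p).2 v
  have hend : ∀ t : unitInterval, 3 / 4 ≤ (t : ℝ) → (hF.glue hn t p).1 =
      AffineMap.lineMap (slide (F 1 p).1 v 1) (pyramidOf (F 1 p).1 v)
        (clampI (4 * (t : ℝ) - 3) : ℝ) := fun t ht => by
    rw [hlate t (by linarith), phi, clampI_of_ge (s := 4 * (t : ℝ) - 2) (by linarith)]
    rfl
  refine ⟨fun t h1 h2 j hj => ?_, fun t h1 h2 => ?_, fun t ht => ?_, fun t ht => ?_,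
    hF.isPyramid_glue_one hn hv⟩
  · rw [hstart, hlate t h1, phi_of_le' t h2, slide_apply_ne _ _ hj]
  · rw [hstart, hlate t h1, phi_of_le' t h2, slide_apply_self,
      clampI_of_mem (by linarith) (by linarith)]
  · simp only [hend t ht]
    exact isOverBarycenter_late hn hfi (clampI _).2.1 (clampI _).2.2
  · simp only [hend t ht, hend _ h34.ge]
    rw [faceDirection_late hn hfi (clampI _).2.1 (clampI _).2.2,
      faceDirection_late hn hfi (clampI _).2.1 (clampI _).2.2]

end IsApexChoice

end Gluing

/-! ### Solid angles as volumes of double cones; continuity of `α` -/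

section Angle

open Matrix Metric

variable {n : ℕ}

/-- The matrix whose columns are the points of `p` in homogeneous coordinates. -/
def homMatrix (p : Fin (n + 1) → Eucl n) : Matrix (Fin (n + 1)) (Fin (n + 1)) ℝ :=
  Matrix.of fun r j => Fin.cons (α := fun _ => ℝ) 1 (fun k => p j k) r

/-- A direction in homogeneous coordinates. -/
def homVec (u : Eucl n) : Fin (n + 1) → ℝ := Fin.cons (α := fun _ => ℝ) 0 fun k => u k

/-- The barycentric coordinates of the direction `u` with respect to `p`, multiplied by the
determinant of `p`. -/
def coordVec (p : Fin (n + 1) → Eucl n) (u : Eucl n) : Fin (n + 1) → ℝ :=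
  (homMatrix p).cramer (homVec u)

theorem homMatrix_mulVec_zero (p : Fin (n + 1) → Eucl n) (c : Fin (n + 1) → ℝ) :
    (homMatrix p *ᵥ c) 0 = ∑ j, c j := by
  simp [homMatrix, mulVec, dotProduct]

theorem homMatrix_mulVec_succ (p : Fin (n + 1) → Eucl n) (c : Fin (n + 1) → ℝ) (k : Fin n) :
    (homMatrix p *ᵥ c) k.succ = (∑ j, c j • p j) k := by
  simp [homMatrix, mulVec, dotProduct, mul_comm]

theorem homMatrix_mulVec_eq_iff (p : Fin (n + 1) → Eucl n) (c : Fin (n + 1) → ℝ) (u : Eucl n) :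
    homMatrix p *ᵥ c = homVec u ↔ ∑ j, c j = 0 ∧ ∑ j, c j • p j = u := by
  constructor
  · intro h
    refine ⟨by rw [← homMatrix_mulVec_zero p, h]; rfl, ?_⟩
    ext k
    rw [← homMatrix_mulVec_succ, h]
    rfl
  · rintro ⟨h1, h2⟩
    funext r
    refine Fin.cases ?_ (fun k => ?_) r
    · rw [homMatrix_mulVec_zero, h1]; rfl
    · rw [homMatrix_mulVec_succ, h2]; rfl

theorem homVec_smul (a : ℝ) (u : Eucl n) : homVec (a • u) = a • homVec u := by
  funext r
  refine Fin.cases ?_ (fun k => ?_) r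
  · simp [homVec]
  · simp [homVec]

theorem homVec_add (u w : Eucl n) : homVec (u + w) = homVec u + homVec w := by
  funext r
  refine Fin.cases ?_ (fun k => ?_) r
  · simp [homVec]
  · simp [homVec]

theorem isDep_iff_homMatrix {p : Fin (n + 1) → Eucl n} {c : Fin (n + 1) → ℝ} :
    IsDep p c ↔ homMatrix p *ᵥ c = 0 := by
  have : (0 : Fin (n + 1) → ℝ) = homVec 0 := by
    have := homVec_smul 0 (0 : Eucl n)
    rw [zero_smul, zero_smul] at this
    exact this.symm
  rw [this, homMatrix_mulVec_eq_iff, IsDep]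

theorem homMatrix_det_ne_zero_iff {p : Fin (n + 1) → Eucl n} :
    (homMatrix p).det ≠ 0 ↔ AffineIndependent ℝ p := by
  rw [affineIndependent_iff_isDep, ne_eq, ← exists_mulVec_eq_zero_iff]
  push Not
  exact ⟨fun h c hc => by_contra fun h0 => h c h0 (isDep_iff_homMatrix.1 hc),
    fun h c h0 hc => h0 (h c (isDep_iff_homMatrix.2 hc))⟩

theorem sum_coordVec (p : Fin (n + 1) → Eucl n) (u : Eucl n) :
    ∑ j, coordVec p u j = 0 ∧ ∑ j, coordVec p u j • p j = (homMatrix p).det • u := by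
  rw [← homMatrix_mulVec_eq_iff, coordVec, mulVec_cramer, homVec_smul]

theorem coordVec_neg (p : Fin (n + 1) → Eucl n) (u : Eucl n) :
    coordVec p (-u) = -coordVec p u := by
  rw [coordVec, ← neg_one_smul ℝ u, homVec_smul, map_smul, neg_one_smul, coordVec]

/-- A scaled barycentric coordinate as a linear functional. -/
def coordFun (p : Fin (n + 1) → Eucl n) (j : Fin (n + 1)) : Eucl n →ₗ[ℝ] ℝ where
  toFun u := coordVec p u j
  map_add' u w := by simp [coordVec, homVec_add]
  map_smul' a u := by simp [coordVec, homVec_smul]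

theorem faceDirection_ne_top (hn : 2 ≤ n) (p : Fin (n + 1) → Eucl n) (v : Fin (n + 1)) :
    faceDirection p v ≠ ⊤ := by
  classical
  intro h
  have h1 := finrank_vectorSpan_image_finset_le ℝ p (Finset.univ.erase v) (n := n - 1)
    (by rw [card_erase]; omega)
  have h2 : ((Finset.univ.erase v : Finset (Fin (n + 1))).image p : Set (Eucl n)) =
      p '' {v}ᶜ := by
    ext x; simp
  rw [h2] at h1
  change Module.finrank ℝ (faceDirection p v) ≤ n - 1 at h1
  rw [h, finrank_top, finrank_euclideanSpace_fin] at h1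
  omega

/-- By Cramer's rule, vanishing of the coordinate at a direction `u` outside the face gives a kernel
vector of the matrix with column `j` replaced by `u`. It would either express `u` in the direction
of the face or be a dependency of the face. Nondegeneracy of `p` is not needed. -/
theorem exists_coordVec_ne_zero (hn : 2 ≤ n) {p : Fin (n + 1) → Eucl n} {j : Fin (n + 1)}
    (h : FaceIndep p j) : ∃ u, coordVec p u j ≠ 0 := by
  obtain ⟨u, hu⟩ := not_forall.1 fun h => faceDirection_ne_top hn p j (eq_top_iff.2 fun u _ => h u)
  refine ⟨u, fun h0 => ?_⟩
  rw [coordVec, cramer_apply, ← exists_mulVec_eq_zero_iff] at h0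
  obtain ⟨x, hx0, hx⟩ := h0
  set c := Function.update x j 0 with hc
  have key : homMatrix p *ᵥ c = homVec ((-(x j)) • u) := by
    rw [homVec_smul]
    funext r
    have h1 := congrFun hx r
    simp only [mulVec, dotProduct, Pi.zero_apply] at h1
    rw [sum_eq_add_sum_ne j] at h1
    simp only [updateCol_self] at h1
    rw [Finset.sum_congr rfl fun i hi => show (homMatrix p).updateCol j (homVec u) r i * x i =
      homMatrix p r i * c i by
        rw [updateCol_ne (Finset.ne_of_mem_erase hi), hc,
          Function.update_of_ne (Finset.ne_of_mem_erase hi)]] at h1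
    simp only [mulVec, dotProduct, Pi.smul_apply, smul_eq_mul]
    rw [sum_eq_add_sum_ne j]
    have hcj : c j = 0 := by rw [hc, Function.update_self]
    rw [hcj]
    linarith
  rw [homMatrix_mulVec_eq_iff] at key
  have hcj : c j = 0 := by rw [hc, Function.update_self]
  by_cases hxj : x j = 0
  · have := h c ⟨key.1, by rw [key.2, hxj]; simp⟩ hcj
    apply hx0
    funext i
    by_cases hi : i = j
    · rw [hi, hxj]; rfl
    · have := congrFun this i
      rwa [hc, Function.update_of_ne hi] at this
  · have hm : (-(x j)) • u ∈ faceDirection p j :=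
      (mem_faceDirection hn).2 ⟨c, hcj, key.1, key.2⟩
    exact hu ((Submodule.smul_mem_iff _ (neg_ne_zero.2 hxj)).1 hm)

/-- Each coordinate is a nonzero linear functional, even at degenerate embeddings, and proper
subspaces are null sets. -/
theorem ae_coordVec_ne_zero (hn : 2 ≤ n) {p : Fin (n + 1) → Eucl n} (hp : IsLinearEmbedding p) :
    ∀ᵐ u : Eucl n, ∀ j, coordVec p u j ≠ 0 := by
  rw [ae_all_iff]
  intro j
  obtain ⟨u, hu⟩ := exists_coordVec_ne_zero hn (faceIndep hn hp j)
  have hne : LinearMap.ker (coordFun p j) ≠ ⊤ := by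
    intro h
    have : u ∈ LinearMap.ker (coordFun p j) := by rw [h]; trivial
    exact hu this
  have := Measure.addHaar_submodule (volume : Measure (Eucl n)) _ hne
  rw [ae_iff]
  convert this using 2
  ext u
  simp only [not_not, Set.mem_ofPred_eq, SetLike.mem_coe, LinearMap.mem_ker, ne_eq]
  exact Iff.rfl

/-- The union of the cone at the vertex `v` and of its opposite. -/
def doubleCone (p : Fin (n + 1) → Eucl n) (v : Fin (n + 1)) : Set (Eucl n) :=
  {u | (∀ j, j ≠ v → 0 ≤ coordVec p u j) ∨ (∀ j, j ≠ v → coordVec p u j ≤ 0)}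

/-- The solid angle at `v`, as half of the normalized volume of the double cone. -/
def angle (p : Fin (n + 1) → Eucl n) (v : Fin (n + 1)) : ℝ :=
  n / 2 * (volume (doubleCone p v ∩ ball 0 1)).toReal

theorem measurableSet_doubleCone (p : Fin (n + 1) → Eucl n) (v : Fin (n + 1)) :
    MeasurableSet (doubleCone p v) := by
  have hc : ∀ j, Continuous fun u => coordVec p u j := fun j =>
    (coordFun p j).continuous_of_finiteDimensional
  apply IsClosed.measurableSet
  refine IsClosed.union ?_ ?_
  · change IsClosed {u | ∀ j, j ≠ v → 0 ≤ coordVec p u j}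
    simp only [Set.ofPred_forall]
    exact isClosed_iInter fun j => isClosed_iInter fun _ => isClosed_le continuous_const (hc j)
  · change IsClosed {u | ∀ j, j ≠ v → coordVec p u j ≤ 0}
    simp only [Set.ofPred_forall]
    exact isClosed_iInter fun j => isClosed_iInter fun _ => isClosed_le (hc j) continuous_const

theorem volume_inter_ball_ne_top (s : Set (Eucl n)) : volume (s ∩ ball 0 1) ≠ ⊤ :=
  ((measure_mono Set.inter_subset_right).trans_lt measure_ball_lt_top).ne

theorem continuous_homMatrix : Continuous fun p : EK n => homMatrix p.1 := by
  refine continuous_matrix fun r j => ?_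
  refine Fin.cases ?_ (fun k => ?_) r
  · simp only [homMatrix, of_apply, Fin.cons_zero]; exact continuous_const
  · simp only [homMatrix, of_apply, Fin.cons_succ]
    have : Continuous fun x : Eucl n => x k := by fun_prop
    exact this.comp (continuous_vertex j)

theorem continuous_coordVec (u : Eucl n) (j : Fin (n + 1)) :
    Continuous fun p : EK n => coordVec p.1 u j := by
  simp only [coordVec, cramer_eq_adjugate_mulVec]
  exact (continuous_apply j).comp
    (continuous_homMatrix.matrix_adjugate.matrix_mulVec continuous_const)

/-- For almost every direction all scaled coordinates at `p₀` are nonzero, so their signs are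
locally constant in the configuration. The indicators of the double cones converge almost everywhere
inside the ball, and dominated convergence applies. -/
theorem continuous_angle (hn : 2 ≤ n) (v : Fin (n + 1)) :
    Continuous fun p : EK n => angle p.1 v := by
  rw [continuous_iff_continuousAt]
  intro p₀
  have h : Filter.Tendsto (fun p : EK n => volume (doubleCone p.1 v ∩ ball 0 1)) (𝓝 p₀)
      (𝓝 (volume (doubleCone p₀.1 v ∩ ball 0 1))) := by
    refine tendsto_measure_of_ae_tendsto_indicator (B := ball 0 1) (𝓝 p₀)
      ((measurableSet_doubleCone _ _).inter measurableSet_ball)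
      (fun p => (measurableSet_doubleCone _ _).inter measurableSet_ball) measurableSet_ball
      measure_ball_lt_top.ne (Filter.Eventually.of_forall fun p => Set.inter_subset_right) ?_
    filter_upwards [ae_coordVec_ne_zero hn p₀.2] with u hu
    have hs : ∀ᶠ p : EK n in 𝓝 p₀, ∀ j,
        (0 ≤ coordVec p.1 u j ↔ 0 ≤ coordVec p₀.1 u j) ∧
        (coordVec p.1 u j ≤ 0 ↔ coordVec p₀.1 u j ≤ 0) := by
      refine Filter.eventually_all.2 fun j => ?_
      have hc := (continuous_coordVec u j).continuousAt (x := p₀)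
      rcases lt_or_gt_of_ne (hu j) with h | h
      · filter_upwards [hc.eventually (gt_mem_nhds h)] with p hp
        exact ⟨iff_of_false (not_le.2 hp) (not_le.2 h), iff_of_true hp.le h.le⟩
      · filter_upwards [hc.eventually (lt_mem_nhds h)] with p hp
        exact ⟨iff_of_true hp.le h.le, iff_of_false (not_le.2 hp) (not_le.2 h)⟩
    filter_upwards [hs] with p hp
    simp only [doubleCone, Set.mem_inter_iff, Set.mem_ofPred_eq, hp]
  exact ((ENNReal.tendsto_toReal (volume_inter_ball_ne_top _)).comp h).const_mul _

/-- The cone at the vertex `v`. -/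
def cone (p : Fin (n + 1) → Eucl n) (v : Fin (n + 1)) : Set (Eucl n) :=
  {x | ∃ a : Fin (n + 1) → ℝ, (∀ j, 0 ≤ a j) ∧ x = ∑ j, a j • (p j - p v)}

theorem smul_mem_cone {p : Fin (n + 1) → Eucl n} {v : Fin (n + 1)} {x : Eucl n}
    (h : x ∈ cone p v) {c : ℝ} (hc : 0 ≤ c) : c • x ∈ cone p v := by
  obtain ⟨a, ha, rfl⟩ := h
  exact ⟨fun j => c * a j, fun j => mul_nonneg hc (ha j), by
    rw [Finset.smul_sum]; simp only [smul_smul]⟩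

theorem mem_cone_iff {p : Fin (n + 1) → Eucl n} (hp : AffineIndependent ℝ p) {v : Fin (n + 1)}
    {x : Eucl n} : x ∈ cone p v ↔ ∀ j, j ≠ v → 0 ≤ (homMatrix p).det * coordVec p x j := by
  have hdet := homMatrix_det_ne_zero_iff.2 hp
  obtain ⟨h1, h2⟩ := sum_coordVec p x
  constructor
  · rintro ⟨a, ha, hx⟩ j hj
    -- Cone coefficients become barycentric ones by choosing the coefficient at `v` so that the sum
    -- is zero; uniqueness then gives `coordVec p x j = det * a j`.
    set c : Fin (n + 1) → ℝ := fun i => a i - if i = v then ∑ k, a k else 0 with hc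
    have hcs : ∑ i, c i = 0 := by simp [hc, Finset.sum_sub_distrib]
    have hcp : ∑ i, c i • p i = x := by
      rw [hx]
      simp [hc, sub_smul, smul_sub, Finset.sum_sub_distrib, ite_smul, Finset.sum_smul]
    have hdep : IsDep p (coordVec p x + (-(homMatrix p).det) • c) := by
      constructor
      · simp [Finset.sum_add_distrib, h1, ← Finset.mul_sum, hcs]
      · simp [Finset.sum_add_distrib, add_smul, h2, mul_smul, ← Finset.smul_sum, hcp]
    have h0 := congrFun (affineIndependent_iff_isDep.1 hp _ hdep) j
    simp only [Pi.add_apply, Pi.smul_apply, smul_eq_mul, Pi.zero_apply] at h0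
    have hcj : c j = a j := by simp [hc, hj]
    rw [hcj] at h0
    have : coordVec p x j = (homMatrix p).det * a j := by linarith
    rw [this, ← mul_assoc]
    exact mul_nonneg (mul_self_nonneg _) (ha j)
  · intro h
    refine ⟨fun j => if j = v then 0 else (homMatrix p).det⁻¹ * coordVec p x j, fun j => ?_, ?_⟩
    · by_cases hj : j = v
      · simp [hj]
      · simp only [hj, if_false]
        have e : (homMatrix p).det⁻¹ * coordVec p x j =
            ((homMatrix p).det * coordVec p x j) / ((homMatrix p).det * (homMatrix p).det) := by
          field_simp
        rw [e]
        exact div_nonneg (h j hj) (mul_self_nonneg _)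
    · have e : ∀ j, (if j = v then 0 else (homMatrix p).det⁻¹ * coordVec p x j) • (p j - p v) =
          (homMatrix p).det⁻¹ • (coordVec p x j • p j - coordVec p x j • p v) := by
        intro j
        by_cases hj : j = v
        · simp [hj]
        · simp only [hj, if_false]
          rw [mul_smul, smul_sub]
      simp only [e]
      rw [← Finset.smul_sum, Finset.sum_sub_distrib, h2, ← Finset.sum_smul, h1, zero_smul,
        sub_zero, smul_smul, inv_mul_cancel₀ hdet, one_smul]

theorem measurableSet_cone {p : Fin (n + 1) → Eucl n} (hp : AffineIndependent ℝ p)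
    (v : Fin (n + 1)) : MeasurableSet (cone p v) := by
  have : cone p v = {x | ∀ j, j ≠ v → 0 ≤ (homMatrix p).det * coordVec p x j} :=
    Set.ext fun x => mem_cone_iff hp
  rw [this]
  apply IsClosed.measurableSet
  simp only [Set.ofPred_forall]
  exact isClosed_iInter fun j => isClosed_iInter fun _ => isClosed_le continuous_const
    (continuous_const.mul (coordFun p j).continuous_of_finiteDimensional)

open scoped Pointwise in
theorem solidAngle_eq_volume (hn : 2 ≤ n) (p : Fin (n + 1) → Eucl n) (v : Fin (n + 1))
    (hm : MeasurableSet (cone p v)) :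
    solidAngle p v = n * (volume (cone p v ∩ ball 0 1)).toReal := by
  have : Nonempty (Fin n) := ⟨⟨0, by omega⟩⟩
  have hs : MeasurableSet {u : sphere (0 : Eucl n) 1 | (u : Eucl n) ∈ cone p v} :=
    measurable_subtype_coe hm
  change ((volume : Measure (Eucl n)).toSphere
    {u : sphere (0 : Eucl n) 1 | (u : Eucl n) ∈ cone p v}).toReal = _
  rw [Measure.toSphere_apply' _ hs, finrank_euclideanSpace_fin]
  -- The spherical measure is `n` times the volume of the open radial segments over the set, which
  -- fill the cone inside the ball except for the origin.
  have : Set.Ioo (0 : ℝ) 1 • (Subtype.val '' {u : sphere (0 : Eucl n) 1 | (u : Eucl n) ∈ cone p v}) =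
      (cone p v ∩ ball 0 1) \ {0} := by
    ext x
    rw [Set.mem_smul]
    constructor
    · rintro ⟨r, hr, _, ⟨u, hu, rfl⟩, rfl⟩
      have hnorm : ‖(u : Eucl n)‖ = 1 := by simp
      refine ⟨⟨smul_mem_cone hu hr.1.le, ?_⟩, ?_⟩
      · rw [mem_ball_zero_iff, norm_smul, hnorm, mul_one, Real.norm_of_nonneg hr.1.le]
        exact hr.2
      · rw [Set.mem_singleton_iff, smul_eq_zero, not_or]
        exact ⟨hr.1.ne', fun h => by rw [h, norm_zero] at hnorm; exact zero_ne_one hnorm⟩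
    · rintro ⟨⟨hx, hb⟩, h0⟩
      have h0 : x ≠ 0 := h0
      have hpos : 0 < ‖x‖ := norm_pos_iff.2 h0
      refine ⟨‖x‖, ⟨hpos, by simpa using hb⟩, ‖x‖⁻¹ • x, ⟨⟨‖x‖⁻¹ • x, ?_⟩, ?_, rfl⟩, ?_⟩
      · rw [mem_sphere_zero_iff_norm, norm_smul, norm_inv, norm_norm, inv_mul_cancel₀ hpos.ne']
      · exact smul_mem_cone hx (by positivity)
      · rw [smul_smul, mul_inv_cancel₀ hpos.ne', one_smul]
  rw [this, measure_sdiff_null (measure_singleton _), ENNReal.toReal_mul, ENNReal.toReal_natCast]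

/-- The double cone is the union of the cone and its opposite, which have equal volume and overlap
in a null set. Doubling removes the dependence on the sign of the determinant and thus permits the
passage to degenerate configurations. -/
theorem solidAngle_eq_angle (hn : 2 ≤ n) {p : Fin (n + 1) → Eucl n} (hp : AffineIndependent ℝ p)
    (v : Fin (n + 1)) : solidAngle p v = angle p v := by
  have hdet := homMatrix_det_ne_zero_iff.2 hp
  have hm := measurableSet_cone hp v
  rw [solidAngle_eq_volume hn p v hm, angle]
  have hneg : volume (-(cone p v ∩ ball 0 1)) = volume (cone p v ∩ ball 0 1) :=
    Measure.measure_neg _ _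
  have hunion : doubleCone p v ∩ ball 0 1 = (cone p v ∩ ball 0 1) ∪ -(cone p v ∩ ball 0 1) := by
    ext x
    simp only [Set.mem_inter_iff, Set.mem_union, Set.mem_neg, mem_ball_zero_iff, norm_neg,
      ← or_and_right, mem_cone_iff hp, coordVec_neg, Pi.neg_apply, doubleCone, Set.mem_ofPred_eq]
    refine and_congr_left fun _ => ?_
    rcases lt_or_gt_of_ne hdet with h | h
    · rw [or_comm]
      refine or_congr (forall₂_congr fun j _ => ?_) (forall₂_congr fun j _ => ?_)
      · rw [← neg_mul_neg, mul_nonneg_iff_of_pos_left (neg_pos.2 h)]; simp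
      · rw [← neg_mul_neg, neg_neg, mul_nonneg_iff_of_pos_left (neg_pos.2 h)]
    · refine or_congr (forall₂_congr fun j _ => ?_) (forall₂_congr fun j _ => ?_)
      · rw [mul_nonneg_iff_of_pos_left h]
      · rw [mul_nonneg_iff_of_pos_left h]; simp
  have hdisj : AEDisjoint volume (cone p v ∩ ball 0 1) (-(cone p v ∩ ball 0 1)) := by
    refine measure_mono_null ?_ (ae_iff.1 (ae_coordVec_ne_zero hn
      (isLinearEmbedding_of_affineIndependent hn hp)))
    rintro x ⟨⟨h1, -⟩, ⟨h2, -⟩⟩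
    obtain ⟨j, hj, -⟩ := exists_third hn v v
    rw [mem_cone_iff hp] at h1 h2
    have h3 := h1 j hj
    have h4 := h2 j hj
    rw [coordVec_neg, Pi.neg_apply, mul_neg] at h4
    intro hx
    exact mul_ne_zero hdet (hx j) (le_antisymm (by linarith) h3)
  rw [hunion, measure_union₀ ((hm.inter measurableSet_ball).neg).nullMeasurableSet hdisj, hneg,
    ENNReal.toReal_add (volume_inter_ball_ne_top _) (volume_inter_ball_ne_top _)]
  ring

theorem halfSphere_eq (hn : 2 ≤ n) :
    halfSphere n = n / 2 * (volume (ball (0 : Eucl n) 1)).toReal := by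
  have : Nonempty (Fin n) := ⟨⟨0, by omega⟩⟩
  rw [halfSphere, Measure.toSphere_apply_univ, finrank_euclideanSpace_fin, ENNReal.toReal_mul,
    ENNReal.toReal_natCast]
  ring

theorem halfSphere_pos (hn : 2 ≤ n) : 0 < halfSphere n := by
  rw [halfSphere_eq hn]
  have : (0 : ℝ) < n := by positivity
  refine mul_pos (by positivity) (ENNReal.toReal_pos ?_ measure_ball_lt_top.ne)
  exact (measure_ball_pos _ _ one_pos).ne'

theorem angle_nonneg (p : Fin (n + 1) → Eucl n) (v : Fin (n + 1)) : 0 ≤ angle p v := by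
  unfold angle; positivity

/-- The coordinates of a direction sum to zero. If all are nonzero and those other than `v` have one
sign, then `v` has the other sign. Comparison with a third vertex shows that this cannot happen for
both `v` and `w`. -/
theorem angle_add_angle_le (hn : 2 ≤ n) {p : Fin (n + 1) → Eucl n} (hp : IsLinearEmbedding p)
    {v w : Fin (n + 1)} (hvw : v ≠ w) : angle p v + angle p w ≤ halfSphere n := by
  have hdisj : AEDisjoint volume (doubleCone p v ∩ ball 0 1) (doubleCone p w ∩ ball 0 1) := by
    refine measure_mono_null ?_ (ae_iff.1 (ae_coordVec_ne_zero hn hp))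
    rintro x ⟨⟨h1, -⟩, ⟨h2, -⟩⟩ hx
    obtain ⟨t, htv, htw⟩ := exists_third hn v w
    have hs := (sum_coordVec p x).1
    rw [sum_eq_add_sum_ne v] at hs
    rcases h1 with h1 | h1
    · have ht : 0 < coordVec p x t := (h1 t htv).lt_of_ne (hx t).symm
      have hpos : 0 < ∑ i ∈ Finset.univ.erase v, coordVec p x i :=
        Finset.sum_pos' (fun i hi => h1 i (Finset.ne_of_mem_erase hi))
          ⟨t, by simpa using htv, ht⟩
      rcases h2 with h2 | h2
      · linarith [h2 v hvw]
      · linarith [h2 t htw]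
    · have ht : coordVec p x t < 0 := (h1 t htv).lt_of_ne (hx t)
      have hpos : ∑ i ∈ Finset.univ.erase v, coordVec p x i < 0 :=
        Finset.sum_neg' (fun i hi => h1 i (Finset.ne_of_mem_erase hi))
          ⟨t, by simpa using htv, ht⟩
      rcases h2 with h2 | h2
      · linarith [h2 t htw]
      · linarith [h2 v hvw]
  rw [halfSphere_eq hn, angle, angle, ← mul_add,
    ← ENNReal.toReal_add (volume_inter_ball_ne_top _) (volume_inter_ball_ne_top _),
    ← measure_union₀ ((measurableSet_doubleCone p w).inter measurableSet_ball).nullMeasurableSet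
      hdisj]
  refine mul_le_mul_of_nonneg_left ?_ (by positivity)
  refine ENNReal.toReal_mono measure_ball_lt_top.ne (measure_mono ?_)
  exact Set.union_subset Set.inter_subset_right Set.inter_subset_right

/-- When the determinant vanishes, the scaled coordinates of any direction are a dependency, hence a
multiple of the one expressing `p v` by the others. Off `v` they have one sign, so every direction
lies in the double cone. -/
theorem angle_of_isInterior (hn : 2 ≤ n) {p : Fin (n + 1) → Eucl n} (hp : IsLinearEmbedding p)
    {v : Fin (n + 1)} (h : IsInterior p v) : angle p v = halfSphere n := by
  have hdet : (homMatrix p).det = 0 := by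
    by_contra h0
    exact h.not_affineIndependent (homMatrix_det_ne_zero_iff.1 h0)
  obtain ⟨c, hc, hcv, hpos⟩ := h
  have : doubleCone p v = Set.univ := by
    refine Set.eq_univ_of_forall fun u => ?_
    obtain ⟨h1, h2⟩ := sum_coordVec p u
    rw [hdet, zero_smul] at h2
    have e := (faceIndep hn hp v).eq_smul hc ⟨h1, h2⟩ hcv
    rcases le_total (coordVec p u v) 0 with h0 | h0
    · refine Or.inl fun j hj => ?_
      rw [congrFun e j]
      exact mul_nonneg (neg_nonneg.2 h0) (hpos j hj).le
    · refine Or.inr fun j hj => ?_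
      rw [congrFun e j]
      exact mul_nonpos_of_nonpos_of_nonneg (neg_nonpos.2 h0) (hpos j hj).le
  rw [angle, this, Set.univ_inter, halfSphere_eq hn]

theorem isPreferredApex_iff (hn : 2 ≤ n) {p : Fin (n + 1) → Eucl n} (hp : IsLinearEmbedding p)
    (v : Fin (n + 1)) : IsPreferredApex p v ↔ halfSphere n / 2 < angle p v := by
  have hV := halfSphere_pos hn
  rw [IsPreferredApex, mem_convexHull_iff_isInterior hn hp]
  by_cases ha : AffineIndependent ℝ p
  · simp [ha, solidAngle_eq_angle hn ha]
  · obtain ⟨w, hw⟩ := (affineIndependent_or_isInterior hn hp).resolve_left ha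
    simp only [ha, false_and, false_or, not_false_eq_true, true_and]
    constructor
    · intro h
      rw [angle_of_isInterior hn hp h]
      linarith
    · intro h
      by_cases hvw : v = w
      · rwa [hvw]
      · have := angle_add_angle_le hn hp hvw
        rw [angle_of_isInterior hn hp hw] at this
        linarith

/-- The value prescribed for `α` at degenerate configurations is the angle at the interior vertex,
which is the greatest possible. So one continuous formula holds everywhere. -/
theorem alpha_unlabel (hn : 2 ≤ n) (p : EK n) : alpha (unlabel p) = ⨆ v, angle p.1 v := by
  change maxSolidAngle p.1 = _
  rw [maxSolidAngle]
  split_ifs with ha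
  · simp only [solidAngle_eq_angle hn ha]
  · obtain ⟨w, hw⟩ := (affineIndependent_or_isInterior hn p.2).resolve_left ha
    have e := angle_of_isInterior hn p.2 hw
    refine le_antisymm ?_ (ciSup_le fun v => ?_)
    · rw [← e]
      exact le_ciSup (f := fun v => angle p.1 v) (Set.finite_range _).bddAbove w
    · obtain ⟨u, hu, -⟩ := exists_third hn v v
      linarith [angle_add_angle_le hn p.2 hu, angle_nonneg p.1 u]

theorem continuous_alpha (hn : 2 ≤ n) : Continuous (alpha : CK n → ℝ) := by
  rw [(isOpenQuotientMap_unlabel hn).isQuotientMap.continuous_iff]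
  have : (alpha ∘ unlabel : EK n → ℝ) =
      fun p => Finset.univ.sup' Finset.univ_nonempty fun v => angle p.1 v := by
    funext p
    rw [Function.comp_apply, alpha_unlabel hn, Finset.sup'_univ_eq_ciSup]
  rw [this]
  exact Continuous.finset_sup'_apply _ fun v _ => continuous_angle hn v

theorem half_lt_alpha_iff (hn : 2 ≤ n) (p : EK n) :
    halfSphere n / 2 < alpha (unlabel p) ↔ ∃ v, IsPreferredApex p.1 v := by
  simp only [isPreferredApex_iff hn p.2]
  rw [alpha_unlabel hn, lt_ciSup_iff (Set.finite_range _).bddAbove]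

theorem alpha_of_not_affineIndependent {p : EK n} (h : ¬ AffineIndependent ℝ p.1) :
    alpha (unlabel p) = halfSphere n := by
  change maxSolidAngle p.1 = _
  rw [maxSolidAngle, if_neg h]

theorem IsPreferredApex.eq (hn : 2 ≤ n) {p : Fin (n + 1) → Eucl n} (hp : IsLinearEmbedding p)
    {v w : Fin (n + 1)} (hv : IsPreferredApex p v) (hw : IsPreferredApex p w) : v = w := by
  by_contra h
  rw [isPreferredApex_iff hn hp] at hv hw
  linarith [angle_add_angle_le hn hp h]

theorem isPreferredApex_comp (p : Fin (n + 1) → Eucl n) (σ : Equiv.Perm (Fin (n + 1)))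
    (v : Fin (n + 1)) : IsPreferredApex (p ∘ σ) v ↔ IsPreferredApex p (σ v) := by
  have h1 : AffineIndependent ℝ (p ∘ σ) ↔ AffineIndependent ℝ p := affineIndependent_equiv σ
  rw [IsPreferredApex, IsPreferredApex, h1, solidAngle_comp, Set.image_comp,
    Set.image_compl_eq σ.bijective, Set.image_singleton, Function.comp_apply]

theorem isOpen_isPreferredApex (hn : 2 ≤ n) (v : Fin (n + 1)) :
    IsOpen {p : EK n | IsPreferredApex p.1 v} := by
  have : {p : EK n | IsPreferredApex p.1 v} = {p | halfSphere n / 2 < angle p.1 v} :=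
    Set.ext fun p => isPreferredApex_iff hn p.2 v
  rw [this]
  exact isOpen_lt continuous_const (continuous_angle hn v)

end Angle

/-! ### The preferred apex of a pyramid -/

section Symmetry

open Matrix Metric

variable {n : ℕ}

/-- The reflection exchanging the vertices `u` and `w`. -/
def vertexReflection (p : Fin (n + 1) → Eucl n) (u w : Fin (n + 1)) : Eucl n ≃ₗᵢ[ℝ] Eucl n :=
  ((ℝ ∙ (p u - p w))ᗮ).reflection

variable {p : Fin (n + 1) → Eucl n} {u w : Fin (n + 1)}

/-- The reflection in the hyperplane orthogonal to `p u - p w` is linear. Measured from a vertex `p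
k` equidistant from `p u` and `p w`, it realizes the transposition of these two vertices. -/
theorem vertexReflection_sub (h : ∀ j, j ≠ u → j ≠ w → dist (p j) (p u) = dist (p j) (p w))
    {k : Fin (n + 1)} (hku : k ≠ u) (hkw : k ≠ w) (j : Fin (n + 1)) :
    vertexReflection p u w (p j - p k) = p (Equiv.swap u w j) - p k := by
  have key : vertexReflection p u w (p u - p k) = p w - p k := by
    have h1 : ‖p u - p k‖ = ‖p w - p k‖ := by
      rw [← dist_eq_norm, ← dist_eq_norm, dist_comm _ (p k), dist_comm _ (p k), h k hku hkw]
    have := Submodule.reflection_sub h1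
    rwa [sub_sub_sub_cancel_right] at this
  by_cases hju : j = u
  · rw [hju, Equiv.swap_apply_left, key]
  by_cases hjw : j = w
  · rw [hjw, Equiv.swap_apply_right, ← key]
    exact Submodule.reflection_reflection _ _
  · rw [Equiv.swap_apply_of_ne_of_ne hju hjw]
    apply Submodule.reflection_mem_subspace_eq_self
    rw [Submodule.mem_orthogonal_singleton_iff_inner_right]
    have e1 := h j hju hjw
    have e2 := h k hku hkw
    rw [dist_eq_norm, dist_eq_norm, ← sq_eq_sq₀ (norm_nonneg _) (norm_nonneg _),
      ← real_inner_self_eq_norm_sq, ← real_inner_self_eq_norm_sq] at e1 e2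
    simp only [inner_sub_left, inner_sub_right] at e1 e2 ⊢
    have := real_inner_comm (p j) (p u)
    have := real_inner_comm (p j) (p w)
    have := real_inner_comm (p k) (p u)
    have := real_inner_comm (p k) (p w)
    linarith

theorem vertexReflection_mem_cone
    (h : ∀ j, j ≠ u → j ≠ w → dist (p j) (p u) = dist (p j) (p w))
    {k : Fin (n + 1)} (hku : k ≠ u) (hkw : k ≠ w) (v : Fin (n + 1)) {x : Eucl n}
    (hx : x ∈ cone p v) : vertexReflection p u w x ∈ cone p (Equiv.swap u w v) := by
  obtain ⟨a, ha, rfl⟩ := hx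
  refine ⟨a ∘ Equiv.swap u w, fun j => ha _, ?_⟩
  rw [map_sum]
  refine Fintype.sum_equiv (Equiv.swap u w) _ _ fun j => ?_
  rw [map_smul, ← sub_sub_sub_cancel_right (p j) (p v) (p k), map_sub,
    vertexReflection_sub h hku hkw, vertexReflection_sub h hku hkw, sub_sub_sub_cancel_right]
  simp

theorem solidAngle_eq_of_equidistant (hn : 2 ≤ n) (hp : AffineIndependent ℝ p)
    (h : ∀ j, j ≠ u → j ≠ w → dist (p j) (p u) = dist (p j) (p w)) :
    solidAngle p u = solidAngle p w := by
  obtain ⟨k, hku, hkw⟩ := exists_third hn u w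
  rw [solidAngle_eq_volume hn p u (measurableSet_cone hp u),
    solidAngle_eq_volume hn p w (measurableSet_cone hp w)]
  have : cone p u ∩ ball 0 1 = vertexReflection p u w ⁻¹' (cone p w ∩ ball 0 1) := by
    ext x
    simp only [Set.mem_inter_iff, Set.mem_preimage, mem_ball_zero_iff,
      LinearIsometryEquiv.norm_map]
    refine and_congr_left fun _ => ⟨fun hx => ?_, fun hx => ?_⟩
    · have := vertexReflection_mem_cone h hku hkw u hx
      rwa [Equiv.swap_apply_left] at this
    · have := vertexReflection_mem_cone h hku hkw w hx
      rw [Equiv.swap_apply_right] at this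
      rwa [vertexReflection, Submodule.reflection_reflection] at this
  rw [this, (vertexReflection p u w).measurePreserving.measure_preimage
    ((measurableSet_cone hp w).inter measurableSet_ball).nullMeasurableSet]

theorem IsPyramid.dist_apex (hn : 2 ≤ n) {v : Fin (n + 1)} (h : IsPyramid p v) (hu : u ≠ v)
    (hw : w ≠ v) : dist (p v) (p u) = dist (p v) (p w) := by
  have hg := gram_faceVec_of_regular hn h.1
  have key : ∀ {j}, j ≠ v → ‖p v - p j‖ ^ 2 =
      ‖p v - faceBarycenter p v‖ ^ 2 + 1 ^ 2 / 2 * (1 - faceProj v j j) := by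
    intro j hj
    have e1 : p v - p j = (p v - faceBarycenter p v) - faceVec p v j := by
      rw [faceVec, if_neg hj]; abel
    have e2 : inner ℝ (faceVec p v j) (p v - faceBarycenter p v) = 0 := by
      have := h.2.1
      rw [IsOverBarycenter, ← span_faceVec hn] at this
      exact this _ (Submodule.subset_span ⟨j, rfl⟩)
    have e3 : ‖faceVec p v j‖ ^ 2 = 1 ^ 2 / 2 * (1 - faceProj v j j) := by
      have := congrFun (congrFun hg j) j
      rw [gram_apply, real_inner_self_eq_norm_sq] at this
      rw [this]
      simp
    rw [e1, norm_sub_sq_real, real_inner_comm, e2, e3]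
    ring
  rw [dist_eq_norm, dist_eq_norm, ← sq_eq_sq₀ (norm_nonneg _) (norm_nonneg _), key hu, key hw]
  simp [faceProj, hu, hw]


/-- All base vertices of a nondegenerate pyramid have the same solid angle, by reflection. If one
were preferred, a second one would be too, against uniqueness. In a degenerate pyramid the apex is
the barycenter of the base. -/
theorem IsPyramid.isPreferredApex_eq (hn : 2 ≤ n) {v : Fin (n + 1)} (h : IsPyramid p v)
    (hp : IsLinearEmbedding p) (hu : IsPreferredApex p u) : u = v := by
  rcases affineIndependent_or_isInterior hn hp with ha | ⟨w, hw⟩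
  · by_contra hne
    obtain ⟨w, hwu, hwv⟩ := exists_third hn u v
    refine hwu (IsPreferredApex.eq hn hp (Or.inl ⟨ha, ?_⟩) hu)
    have hu' : halfSphere n / 2 < solidAngle p u := by
      rcases hu with hu | hu
      · exact hu.2
      · exact absurd ha hu.1
    rwa [← solidAngle_eq_of_equidistant (u := u) (w := w) hn ha]
    intro j hju hjw
    by_cases hj : j = v
    · rw [hj, h.dist_apex hn hne hwv]
    · rw [h.1 j u hj hne hju, h.1 j w hj hwv hjw]
  · have hna := hw.not_affineIndependent
    have hu' : IsInterior p u := by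
      rcases hu with hu | hu
      · exact absurd hu.1 hna
      · exact (mem_convexHull_iff_isInterior hn hp u).1 hu.2
    refine hu'.eq hn hp (isInterior_of_eq_faceBarycenter hn ?_)
    have hf := SkeletonConfig.faceIndep hn hp v
    rw [hf.affineIndependent_iff hn, not_not] at hna
    exact sub_eq_zero.1 ((Submodule.disjoint_def.1
      (Submodule.orthogonal_disjoint (faceDirection p v))) _ hna h.2.1)

end Symmetry

/-! ### Flatness: a choice of apex adapted to pyramids -/

section Flatness

open Matrix

variable {n : ℕ}

/-- The squared volume of the face opposite to the vertex `j`, up to a constant factor. -/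
def faceArea (p : Fin (n + 1) → Eucl n) (j : Fin (n + 1)) : ℝ :=
  ∑ k, coordVec p (EuclideanSpace.single k 1) j ^ 2

/-- The height over the face opposite to `v`, relative to that of a regular simplex. -/
def relHeight (p : Fin (n + 1) → Eucl n) (v : Fin (n + 1)) : ℝ :=
  ‖apexVec p v‖ / (faceScale p v * regHeight n)

/-- This number is positive if the face opposite to `v` is greater than the other faces and the
height over this face is small. On a pyramid with apex `v` it determines the height. -/
def flatness (p : Fin (n + 1) → Eucl n) (v : Fin (n + 1)) : ℝ :=
  max 0 (⨅ j, if j = v then 1 - relHeight p v else 2 * (1 - faceArea p j / faceArea p v))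

variable {p : Fin (n + 1) → Eucl n} {v : Fin (n + 1)}

theorem coordVec_eq_sum (p : Fin (n + 1) → Eucl n) (u : Eucl n) (j : Fin (n + 1)) :
    coordVec p u j = ∑ k, u k * coordVec p (EuclideanSpace.single k 1) j := by
  have h : u = ∑ k, u k • EuclideanSpace.single k (1 : ℝ) := by
    ext i
    simp [Pi.single_apply]
  conv_lhs => rw [h]
  change coordFun p j _ = _
  rw [map_sum]
  refine Finset.sum_congr rfl fun k _ => ?_
  rw [map_smul]
  rfl

theorem faceArea_pos (hn : 2 ≤ n) (h : FaceIndep p v) : 0 < faceArea p v := by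
  obtain ⟨u, hu⟩ := exists_coordVec_ne_zero hn h
  refine lt_of_le_of_ne (Finset.sum_nonneg fun k _ => sq_nonneg _) fun h0 => hu ?_
  rw [coordVec_eq_sum]
  refine Finset.sum_eq_zero fun k _ => ?_
  have := (Finset.sum_eq_zero_iff_of_nonneg fun k _ => sq_nonneg _).1 h0.symm k
    (Finset.mem_univ k)
  rw [pow_eq_zero_iff two_ne_zero] at this
  rw [this, mul_zero]

/-- Relabeling multiplies the determinant by the sign of the permutation, which disappears on
squaring. -/
theorem coordVec_comp_sq (p : Fin (n + 1) → Eucl n) (σ : Equiv.Perm (Fin (n + 1))) (u : Eucl n)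
    (j : Fin (n + 1)) : coordVec (p ∘ σ) u j ^ 2 = coordVec p u (σ j) ^ 2 := by
  have h : (homMatrix (p ∘ σ)).updateCol j (homVec u) =
      ((homMatrix p).updateCol (σ j) (homVec u)).submatrix id σ := by
    ext r i
    simp only [updateCol_apply, submatrix_apply, id, σ.injective.eq_iff]
    rfl
  rw [coordVec, coordVec, cramer_apply, cramer_apply, h, det_permute']
  have : ((Equiv.Perm.sign σ : ℤ) : ℝ) ^ 2 = 1 := by
    rcases Int.units_eq_one_or (Equiv.Perm.sign σ) with h | h <;> simp [h]
  rw [mul_pow, this, one_mul]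

theorem abs_det_homMatrix_comp (p : Fin (n + 1) → Eucl n) (σ : Equiv.Perm (Fin (n + 1))) :
    |(homMatrix (p ∘ σ)).det| = |(homMatrix p).det| := by
  have h : homMatrix (p ∘ σ) = (homMatrix p).submatrix id σ := rfl
  rw [h, det_permute', abs_mul]
  rcases Int.units_eq_one_or (Equiv.Perm.sign σ) with h | h <;> simp [h]

theorem faceArea_comp (p : Fin (n + 1) → Eucl n) (σ : Equiv.Perm (Fin (n + 1)))
    (j : Fin (n + 1)) : faceArea (p ∘ σ) j = faceArea p (σ j) :=
  Finset.sum_congr rfl fun _ _ => coordVec_comp_sq p σ _ j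

theorem flatness_comp (p : Fin (n + 1) → Eucl n) (σ : Equiv.Perm (Fin (n + 1)))
    (v : Fin (n + 1)) : flatness (p ∘ σ) v = flatness p (σ v) := by
  rw [flatness, flatness, relHeight, apexVec_comp, faceScale_comp]
  congr 1
  refine Eq.trans ?_ (σ.iInf_comp (g := fun j => if j = σ v then 1 - relHeight p (σ v) else
    2 * (1 - faceArea p j / faceArea p (σ v))))
  simp only [faceArea_comp, σ.injective.eq_iff]
  rfl

theorem continuous_faceArea (j : Fin (n + 1)) : Continuous fun p : EK n => faceArea p.1 j :=
  continuous_finsetSum _ fun _ _ => (continuous_coordVec _ j).pow 2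

theorem continuous_relHeight (hn : 2 ≤ n) (v : Fin (n + 1)) :
    Continuous fun p : EK n => relHeight p.1 v :=
  (continuous_apexVec v hn).norm.div ((continuous_faceScale v).mul continuous_const) fun p =>
    (mul_pos (faceScale_pos hn (faceIndep hn p.2 v)) (regHeight_pos hn)).ne'

theorem continuous_flatness (hn : 2 ≤ n) (v : Fin (n + 1)) :
    Continuous fun p : EK n => flatness p.1 v := by
  refine continuous_const.max ?_
  have : ∀ j, Continuous fun p : EK n => if j = v then 1 - relHeight p.1 v else
      2 * (1 - faceArea p.1 j / faceArea p.1 v) := by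
    intro j
    by_cases h : j = v
    · simp only [if_pos h]
      exact continuous_const.sub (continuous_relHeight hn v)
    · simp only [if_neg h]
      exact continuous_const.mul (continuous_const.sub ((continuous_faceArea j).div
        (continuous_faceArea v) fun p => (faceArea_pos hn (faceIndep hn p.2 v)).ne'))
  have h := Continuous.finset_inf'_apply Finset.univ_nonempty fun j _ => this j
  simpa only [Finset.inf'_univ_eq_ciInf] using h

theorem flatness_nonneg (p : Fin (n + 1) → Eucl n) (v : Fin (n + 1)) : 0 ≤ flatness p v :=
  le_max_left _ _

theorem lt_flatness {a : ℝ} (ha : 0 ≤ a) (h : a < flatness p v) :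
    a < 1 - relHeight p v ∧ ∀ j, j ≠ v → a < 2 * (1 - faceArea p j / faceArea p v) := by
  have h' := (lt_max_iff.1 h).resolve_left ha.not_gt
  have := fun j => h'.trans_le (ciInf_le (Set.finite_range _).bddBelow j)
  refine ⟨?_, fun j hj => ?_⟩
  · have := this v
    rwa [if_pos rfl] at this
  · have := this j
    rwa [if_neg hj] at this

theorem faceArea_lt_of_flatness_pos (hn : 2 ≤ n) (hp : IsLinearEmbedding p)
    (h : 0 < flatness p v) {j : Fin (n + 1)} (hj : j ≠ v) : faceArea p j < faceArea p v := by
  have := (lt_flatness le_rfl h).2 j hj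
  have h1 : faceArea p j / faceArea p v < 1 := by linarith
  rwa [div_lt_one (faceArea_pos hn (faceIndep hn hp v))] at h1

/-- Positive flatness at `v` makes the face opposite to `v` strictly the largest. -/
theorem eq_of_flatness_pos (hn : 2 ≤ n) (hp : IsLinearEmbedding p) {w : Fin (n + 1)}
    (hv : 0 < flatness p v) (hw : 0 < flatness p w) : v = w := by
  by_contra h
  exact lt_asymm (faceArea_lt_of_flatness_pos hn hp hv (Ne.symm h))
    (faceArea_lt_of_flatness_pos hn hp hw h)

theorem apexVec_eq_zero_iff (hn : 2 ≤ n) (h : FaceIndep p v) :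
    apexVec p v = 0 ↔ ¬ AffineIndependent ℝ p := by
  have e : apexVec p v = (p v - faceBarycenter p v) + (apexTarget p v - p v) := by
    rw [apexVec]; abel
  rw [h.affineIndependent_iff hn, not_not,
    ← (faceDirection p v).add_mem_iff_left (apexTarget_sub_mem p v), ← e]
  refine ⟨fun h => h ▸ zero_mem _, fun h => ?_⟩
  exact Submodule.disjoint_def.1 (Submodule.orthogonal_disjoint _) _ h (apexVec_mem p v)

theorem flatness_lt_one (hn : 2 ≤ n) (hp : AffineIndependent ℝ p) (v : Fin (n + 1)) :
    flatness p v < 1 := by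
  have hf := faceIndep hn (isLinearEmbedding_of_affineIndependent hn hp) v
  by_contra! h
  have hpos : 0 < relHeight p v := by
    refine div_pos (norm_pos_iff.2 fun h0 => ?_) (mul_pos (faceScale_pos hn hf) (regHeight_pos hn))
    exact (apexVec_eq_zero_iff hn hf).1 h0 hp
  have := (lt_flatness (a := 1 - relHeight p v) (p := p) (v := v))
  by_cases h1 : relHeight p v ≤ 1
  · exact lt_irrefl _ (this (by linarith) (by linarith)).1
  · exact (lt_flatness le_rfl (zero_lt_one.trans_le h)).1.not_ge (by linarith)

/-- The face areas of a degenerate configuration are proportional to the squared coefficients of its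
dependency. These are less than one off `v`, because at least two positive coefficients add up to at
most one; and the height is zero. -/
theorem flatness_pos_of_isInterior (hn : 2 ≤ n) (hp : IsLinearEmbedding p)
    (h : IsInterior p v) : 0 < flatness p v := by
  have hna := h.not_affineIndependent
  have hdet : (homMatrix p).det = 0 := by
    by_contra h0
    exact hna (homMatrix_det_ne_zero_iff.1 h0)
  obtain ⟨c, hc, hcv, hpos⟩ := h
  have hlt : ∀ j, j ≠ v → c j < 1 := by
    intro j hj
    obtain ⟨k, hkj, hkv⟩ := exists_third hn j v
    have h0 := hc.1
    rw [sum_eq_add_sum_ne v, hcv] at h0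
    have : c j + c k ≤ ∑ i ∈ Finset.univ.erase v, c i := by
      rw [← Finset.sum_pair hkj.symm]
      refine Finset.sum_le_sum_of_subset_of_nonneg ?_ fun i hi _ =>
        (hpos i (Finset.ne_of_mem_erase hi)).le
      intro i hi
      rw [Finset.mem_insert, Finset.mem_singleton] at hi
      rcases hi with rfl | rfl
      · exact Finset.mem_erase.2 ⟨hj, Finset.mem_univ _⟩
      · exact Finset.mem_erase.2 ⟨hkv, Finset.mem_univ _⟩
    linarith [hpos k hkv]
  have hq : ∀ j, faceArea p j = c j ^ 2 * faceArea p v := by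
    intro j
    rw [faceArea, faceArea, Finset.mul_sum]
    refine Finset.sum_congr rfl fun k _ => ?_
    obtain ⟨h1, h2⟩ := sum_coordVec p (EuclideanSpace.single k 1)
    rw [hdet, zero_smul] at h2
    have e := (faceIndep hn hp v).eq_smul hc ⟨h1, h2⟩ hcv
    rw [congrFun e j, Pi.smul_apply, smul_eq_mul]
    ring
  have hqv := faceArea_pos hn (faceIndep hn hp v)
  refine lt_max_of_lt_right ?_
  obtain ⟨j, hj⟩ := exists_eq_ciInf_of_finite (f := fun j =>
    if j = v then 1 - relHeight p v else 2 * (1 - faceArea p j / faceArea p v))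
  rw [← hj]
  clear hj
  by_cases hj : j = v
  · rw [if_pos hj, relHeight, (apexVec_eq_zero_iff hn (faceIndep hn hp v)).2 hna]
    simp
  · rw [if_neg hj, hq j, mul_div_cancel_right₀ _ hqv.ne']
    have := hlt j hj
    have := hpos j hj
    nlinarith

/-- The hypothesis says that `w` is the gradient of the `j`-th barycentric coordinate, and
`faceArea` is the squared norm of this gradient times the squared determinant. -/
theorem faceArea_eq_of_inner {w : Eucl n} {j : Fin (n + 1)} {c : ℝ}
    (h : ∀ i, inner ℝ w (p i) = (if i = j then 1 else 0) + c) :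
    faceArea p j = (homMatrix p).det ^ 2 * ‖w‖ ^ 2 := by
  have key : ∀ u, coordVec p u j = (homMatrix p).det * inner ℝ w u := by
    intro u
    obtain ⟨h1, h2⟩ := sum_coordVec p u
    rw [← real_inner_smul_right, ← h2, inner_sum]
    simp only [real_inner_smul_right, h, mul_add, Finset.sum_add_distrib, ← Finset.sum_mul, h1]
    simp
  rw [faceArea, EuclideanSpace.norm_sq_eq, Finset.mul_sum]
  refine Finset.sum_congr rfl fun k _ => ?_
  rw [key, mul_pow, EuclideanSpace.inner_single_right]
  simp

/-- The faces of a pyramid that contain its apex. -/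
theorem IsPyramid.faceArea_div (hn : 2 ≤ n) (h : IsPyramid p v) (hp : AffineIndependent ℝ p)
    {j : Fin (n + 1)} (hj : j ≠ v) : faceArea p j / faceArea p v =
      2 * (1 - (n : ℝ)⁻¹) * ‖p v - faceBarycenter p v‖ ^ 2 + ((n : ℝ)⁻¹) ^ 2 := by
  have hn0 : (n : ℝ) ≠ 0 := by positivity
  set a := p v - faceBarycenter p v with ha
  set f := faceVec p v with hf
  have ha0 : a ≠ 0 := by
    intro h0
    exact (isInterior_of_eq_faceBarycenter hn (sub_eq_zero.1 h0)).not_affineIndependent hp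
  have ha2 : ‖a‖ ^ 2 ≠ 0 := by positivity
  have hg : ∀ i k, inner ℝ (f i) (f k) = 1 / 2 * ((if i = k then 1 else 0) - faceProj v i k) := by
    intro i k
    have := congrFun (congrFun (gram_faceVec_of_regular hn h.1) i) k
    rw [gram_apply] at this
    rw [hf, this]
    simp [Matrix.one_apply]
  have hfa : ∀ i, inner ℝ (f i) a = 0 := by
    intro i
    have := h.2.1
    rw [IsOverBarycenter, ← span_faceVec hn] at this
    exact this _ (Submodule.subset_span ⟨i, rfl⟩)
  have hpe : ∀ i, p i = faceBarycenter p v + f i + (if i = v then a else 0) := by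
    intro i
    by_cases hi : i = v
    · rw [if_pos hi, hi, hf, faceVec_self, ha]; abel
    · rw [if_neg hi, hf, faceVec, if_neg hi]; abel
  have hv : faceArea p v = (homMatrix p).det ^ 2 * ‖(‖a‖ ^ 2)⁻¹ • a‖ ^ 2 := by
    refine faceArea_eq_of_inner (c := inner ℝ ((‖a‖ ^ 2)⁻¹ • a) (faceBarycenter p v)) fun i => ?_
    rw [hpe i, inner_add_right, inner_add_right, real_inner_smul_left _ (f i),
      real_inner_comm (f i) a, hfa]
    by_cases hi : i = v
    · rw [if_pos hi, if_pos hi, real_inner_smul_left _ a, real_inner_self_eq_norm_sq,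
        inv_mul_cancel₀ ha2]
      ring
    · rw [if_neg hi, if_neg hi, inner_zero_right]
      ring
  -- The vector `2 • f j` has inner product `δ - 1/n` with the base vectors. The multiple of `a`
  -- produces the same constant `-1/n` at the apex.
  have hj' : faceArea p j = (homMatrix p).det ^ 2 *
      ‖(2 : ℝ) • f j + (-((n : ℝ)⁻¹ * (‖a‖ ^ 2)⁻¹)) • a‖ ^ 2 := by
    refine faceArea_eq_of_inner (c := -(n : ℝ)⁻¹ + inner ℝ ((2 : ℝ) • f j +
      (-((n : ℝ)⁻¹ * (‖a‖ ^ 2)⁻¹)) • a) (faceBarycenter p v)) fun i => ?_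
    rw [hpe i, inner_add_right, inner_add_right, inner_add_left _ _ (f i), real_inner_smul_left,
      real_inner_smul_left, hg, real_inner_comm (f i) a, hfa]
    by_cases hi : i = v
    · rw [if_pos hi, inner_add_left _ _ a, real_inner_smul_left, real_inner_smul_left, hfa,
        real_inner_self_eq_norm_sq, hi, if_neg hj, if_neg (Ne.symm hj), faceProj]
      field_simp
      simp [hj]
      ring
    · rw [if_neg hi, inner_zero_right]
      simp only [faceProj, hj, hi, if_false, eq_comm (a := j) (b := i)]
      ring
  have hd := pow_ne_zero 2 (homMatrix_det_ne_zero_iff.2 hp)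
  rw [hj', hv, mul_div_mul_left _ _ hd, norm_add_sq_real, real_inner_smul_left,
    real_inner_smul_right, hfa, norm_smul, norm_smul, norm_smul, mul_pow, mul_pow, mul_pow,
    ← real_inner_self_eq_norm_sq (f j), hg, Real.norm_eq_abs, Real.norm_eq_abs, Real.norm_eq_abs,
    sq_abs, sq_abs, sq_abs]
  simp only [faceProj, hj, if_false]
  have : ‖a‖ ≠ 0 := norm_ne_zero_iff.2 ha0
  field_simp
  simp
  ring

end Flatness

/-! ### The frame of a simplex and its flattening -/

section Frame

open Matrix

variable {n : ℕ}

/-- The projection onto the constant vectors. -/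
def meanProj (n : ℕ) : Matrix (Fin (n + 1)) (Fin (n + 1)) ℝ := fun _ _ => ((n : ℝ) + 1)⁻¹

/-- The projection onto the line spanned by `axisCoeff v`. -/
def axisProj (v : Fin (n + 1)) : Matrix (Fin (n + 1)) (Fin (n + 1)) ℝ := fun i j =>
  ((n : ℝ) + 1) / n * (axisCoeff v i * axisCoeff v j)

/-- The vertices of `p`, relative to its barycenter. -/
def centered (p : Fin (n + 1) → Eucl n) : Fin (n + 1) → Eucl n := fun j =>
  p j - ((n : ℝ) + 1)⁻¹ • ∑ i, p i

/-- The orthonormalization of `centered p`. -/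
def simplexFrame (p : Fin (n + 1) → Eucl n) : Fin (n + 1) → Eucl n :=
  polar (meanProj n) (centered p)

/-- The matrix that flattens the regular simplex with unit edges according to the flatness
of `p`. -/
def flattening (p : Fin (n + 1) → Eucl n) : Matrix (Fin (n + 1)) (Fin (n + 1)) ℝ :=
  (Real.sqrt 2)⁻¹ • (1 - ∑ v, flatness p v • axisProj v)

/-- This weight is zero at degenerate configurations, and one where no vertex has positive
flatness. -/
def simplexWeight (p : Fin (n + 1) → Eucl n) : ℝ :=
  |(homMatrix p).det| / (|(homMatrix p).det| + ∑ v, flatness p v)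

variable {p : Fin (n + 1) → Eucl n} {v : Fin (n + 1)}

theorem natCast_add_one_pos (n : ℕ) : 0 < (n : ℝ) + 1 := by positivity

theorem meanProj_transpose : (meanProj n)ᵀ = meanProj n := rfl

theorem meanProj_mul_self : meanProj n * meanProj n = meanProj n := by
  ext i j
  have := (natCast_add_one_pos n).ne'
  simp [mul_apply, meanProj]
  field_simp

theorem meanProj_mulVec_eq_zero {x : Fin (n + 1) → ℝ} :
    meanProj n *ᵥ x = 0 ↔ ∑ j, x j = 0 := by
  have h : ∀ i, (meanProj n *ᵥ x) i = ((n : ℝ) + 1)⁻¹ * ∑ j, x j := fun i => by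
    simp [mulVec, dotProduct, meanProj, Finset.mul_sum]
  constructor
  · intro h0
    have := congrFun h0 0
    rw [h, Pi.zero_apply, mul_eq_zero] at this
    exact this.resolve_left (inv_ne_zero (natCast_add_one_pos n).ne')
  · intro h0
    funext i
    rw [h, h0, mul_zero, Pi.zero_apply]

theorem act_meanProj {f : Fin (n + 1) → Eucl n} (h : ∑ j, f j = 0) : act f (meanProj n) = 0 := by
  funext j
  simp [act, meanProj, ← Finset.smul_sum, h]

theorem sum_axisCoeff_mul (x : Fin (n + 1) → ℝ) :
    ∑ j, axisCoeff v j * x j = x v - ((n : ℝ) + 1)⁻¹ * ∑ j, x j := by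
  simp [axisCoeff, sub_mul, Finset.sum_sub_distrib, Finset.mul_sum]

theorem axisProj_transpose (v : Fin (n + 1)) : (axisProj v)ᵀ = axisProj v := by
  ext i j
  simp [axisProj, mul_comm (axisCoeff v i)]

theorem sum_axisCoeff_mul_self (hn : 2 ≤ n) (v : Fin (n + 1)) :
    ∑ j, axisCoeff v j * axisCoeff v j = n / ((n : ℝ) + 1) := by
  have := natCast_add_one_pos n
  rw [sum_axisCoeff_mul, sum_axisCoeff, axisCoeff, if_pos rfl]
  field_simp
  ring

theorem sum_axisCoeff_mul_axisProj (hn : 2 ≤ n) (v j : Fin (n + 1)) :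
    ∑ i, axisProj v i j * axisCoeff v i = axisCoeff v j := by
  have h0 := natCast_add_one_pos n
  have hn0 : (n : ℝ) ≠ 0 := by positivity
  have : ∀ i, axisProj v i j * axisCoeff v i =
      ((n : ℝ) + 1) / n * axisCoeff v j * (axisCoeff v i * axisCoeff v i) := fun i => by
    rw [axisProj]; ring
  rw [Finset.sum_congr rfl fun i _ => this i, ← Finset.mul_sum, sum_axisCoeff_mul_self hn]
  field_simp

theorem axisProj_mul_self (hn : 2 ≤ n) (v : Fin (n + 1)) :
    axisProj v * axisProj v = axisProj v := by
  ext i j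
  rw [mul_apply]
  have : ∀ k, axisProj v i k * axisProj v k j =
      ((n : ℝ) + 1) / n * axisCoeff v i * (axisProj v k j * axisCoeff v k) := fun k => by
    rw [axisProj]; ring
  rw [Finset.sum_congr rfl fun k _ => this k, ← Finset.mul_sum, sum_axisCoeff_mul_axisProj hn,
    axisProj]
  ring

theorem axisProj_mul_meanProj (v : Fin (n + 1)) : axisProj v * meanProj n = 0 := by
  ext i j
  rw [mul_apply]
  simp only [axisProj, meanProj]
  rw [← Finset.sum_mul, ← Finset.mul_sum, ← Finset.mul_sum, sum_axisCoeff]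
  simp

theorem faceProj_eq (hn : 2 ≤ n) (v : Fin (n + 1)) : faceProj v = meanProj n + axisProj v := by
  have h0 := natCast_add_one_pos n
  have hn0 : (n : ℝ) ≠ 0 := by positivity
  ext i j
  rw [Matrix.add_apply, faceProj, meanProj, axisProj, axisCoeff, axisCoeff]
  split_ifs <;> field_simp <;> ring

theorem axisProj_submatrix (σ : Equiv.Perm (Fin (n + 1))) (v : Fin (n + 1)) :
    (axisProj (σ v)).submatrix σ σ = axisProj v := by
  ext i j
  simp [axisProj, axisCoeff]

theorem sum_centered (p : Fin (n + 1) → Eucl n) : ∑ j, centered p j = 0 := by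
  simp only [centered, Finset.sum_sub_distrib, Finset.sum_const, Finset.card_univ,
    Fintype.card_fin, ← Nat.cast_smul_eq_nsmul ℝ, smul_smul]
  push_cast
  rw [mul_inv_cancel₀ (natCast_add_one_pos n).ne', one_smul, sub_self]

theorem isRelationProj_centered (hp : AffineIndependent ℝ p) :
    IsRelationProj (meanProj n) (centered p) where
  symm := meanProj_transpose
  idem := meanProj_mul_self
  act_eq := act_meanProj (sum_centered p)
  posDef := posDef_gram_add meanProj_transpose meanProj_mul_self fun x hx h0 => by
    rw [meanProj_mulVec_eq_zero] at h0
    refine affineIndependent_iff_isDep.1 hp x ⟨h0, ?_⟩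
    simp only [centered, smul_sub, Finset.sum_sub_distrib, ← Finset.sum_smul, h0, zero_smul,
      sub_zero] at hx
    exact hx

theorem gram_simplexFrame (hp : AffineIndependent ℝ p) :
    gram ℝ (simplexFrame p) = 1 - meanProj n := (isRelationProj_centered hp).gram_polar

theorem norm_simplexFrame_le (hp : AffineIndependent ℝ p) (j : Fin (n + 1)) :
    ‖simplexFrame p j‖ ≤ 1 := by
  have := congrFun (congrFun (gram_simplexFrame hp) j) j
  rw [gram_apply, real_inner_self_eq_norm_sq] at this
  rw [← sq_le_one_iff₀ (norm_nonneg _), this]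
  simp [meanProj]
  exact (natCast_add_one_pos n).le

theorem flattening_eq (h : ∀ w, w ≠ v → flatness p w = 0) :
    flattening p = (Real.sqrt 2)⁻¹ • (1 - flatness p v • axisProj v) := by
  rw [flattening, Finset.sum_eq_single v (fun w _ hw => by rw [h w hw, zero_smul])]
  simp

theorem exists_flatness_eq_zero (hn : 2 ≤ n) (hp : IsLinearEmbedding p) :
    ∃ v, ∀ w, w ≠ v → flatness p w = 0 := by
  by_cases h : ∃ v, 0 < flatness p v
  · obtain ⟨v, hv⟩ := h
    refine ⟨v, fun w hw => le_antisymm (not_lt.1 fun h => ?_) (flatness_nonneg p w)⟩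
    exact hw (eq_of_flatness_pos hn hp h hv)
  · push Not at h
    exact ⟨0, fun w _ => le_antisymm (h w) (flatness_nonneg p w)⟩

theorem flattening_mul_meanProj : flattening p * meanProj n = (Real.sqrt 2)⁻¹ • meanProj n := by
  rw [flattening, smul_mul_assoc, sub_mul, Finset.sum_mul]
  simp [axisProj_mul_meanProj]

theorem posDef_one_sub_smul_axisProj (hn : 2 ≤ n) {e : ℝ} (he : e < 1) (v : Fin (n + 1)) :
    (1 - e • axisProj v).PosDef := by
  -- The eigenvalues are `1 - e` on the axis and `1` on its complement, so the complementary
  -- projection plays the role of `N`.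
  have h := posDef_smul_one_sub_add (N := 1 - axisProj v) (a := 1 - e)
    (by rw [transpose_sub, transpose_one, axisProj_transpose])
    (by rw [mul_sub, sub_mul, sub_mul, axisProj_mul_self hn]; simp) (by linarith)
  convert h using 1
  rw [sub_sub_cancel, sub_smul, one_smul]
  abel

theorem posDef_flattening (hn : 2 ≤ n) (hp : AffineIndependent ℝ p) : (flattening p).PosDef := by
  obtain ⟨v, hv⟩ := exists_flatness_eq_zero hn (isLinearEmbedding_of_affineIndependent hn hp)
  rw [flattening_eq hv]
  exact (posDef_one_sub_smul_axisProj hn (flatness_lt_one hn hp v) v).smul (by positivity)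

theorem flattening_comp (σ : Equiv.Perm (Fin (n + 1))) :
    flattening (p ∘ σ) = (flattening p).submatrix σ σ := by
  have h : ∑ v, flatness (p ∘ σ) v • axisProj v =
      (∑ v, flatness p v • axisProj v).submatrix σ σ := by
    ext i j
    rw [Matrix.sum_apply, submatrix_apply, Matrix.sum_apply,
      ← Equiv.sum_comp σ fun v => (flatness p v • axisProj v) (σ i) (σ j)]
    refine Finset.sum_congr rfl fun v _ => ?_
    rw [flatness_comp, ← axisProj_submatrix σ v]
    rfl
  rw [flattening, flattening, h]
  ext i j
  simp [Matrix.one_apply]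

theorem centered_comp (σ : Equiv.Perm (Fin (n + 1))) : centered (p ∘ σ) = centered p ∘ σ := by
  funext j
  have := Equiv.sum_comp σ p
  simp only [centered, Function.comp_apply, this]

theorem simplexFrame_comp (hp : AffineIndependent ℝ p) (σ : Equiv.Perm (Fin (n + 1))) :
    simplexFrame (p ∘ σ) = simplexFrame p ∘ σ := by
  rw [simplexFrame, centered_comp]
  exact polar_comp (isRelationProj_centered hp) σ

theorem simplexWeight_comp (σ : Equiv.Perm (Fin (n + 1))) :
    simplexWeight (p ∘ σ) = simplexWeight p := by
  rw [simplexWeight, simplexWeight, abs_det_homMatrix_comp]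
  simp only [flatness_comp]
  rw [Equiv.sum_comp σ (fun v => flatness p v)]

theorem simplexWeight_nonneg : 0 ≤ simplexWeight p :=
  div_nonneg (abs_nonneg _)
    (add_nonneg (abs_nonneg _) (Finset.sum_nonneg fun v _ => flatness_nonneg p v))

theorem simplexWeight_le_one : simplexWeight p ≤ 1 :=
  div_le_one_of_le₀ (le_add_of_nonneg_right (Finset.sum_nonneg fun v _ => flatness_nonneg p v))
    (add_nonneg (abs_nonneg _) (Finset.sum_nonneg fun v _ => flatness_nonneg p v))

theorem simplexWeight_of_not_affineIndependent (hp : ¬ AffineIndependent ℝ p) :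
    simplexWeight p = 0 := by
  rw [← homMatrix_det_ne_zero_iff, not_not] at hp
  rw [simplexWeight, hp, abs_zero, zero_div]

theorem simplexWeight_of_flatness_eq_zero (hp : AffineIndependent ℝ p)
    (h : ∀ v, flatness p v = 0) : simplexWeight p = 1 := by
  have := abs_pos.2 (homMatrix_det_ne_zero_iff.2 hp)
  rw [simplexWeight, Finset.sum_eq_zero fun v _ => h v, add_zero, div_self this.ne']

/-- The denominator never vanishes: the determinant is nonzero on simplices, and some flatness is
positive on degenerate configurations. -/
theorem continuous_simplexWeight (hn : 2 ≤ n) : Continuous fun p : EK n => simplexWeight p.1 := by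
  have hd : Continuous fun p : EK n => |(homMatrix p.1).det| := continuous_homMatrix.matrix_det.abs
  refine hd.div (hd.add (continuous_finsetSum _ fun v _ => continuous_flatness hn v)) fun p => ?_
  have h0 : 0 ≤ ∑ v, flatness p.1 v := Finset.sum_nonneg fun v _ => flatness_nonneg _ v
  rcases affineIndependent_or_isInterior hn p.2 with h | ⟨v, h⟩
  · exact (add_pos_of_pos_of_nonneg (abs_pos.2 (homMatrix_det_ne_zero_iff.2 h)) h0).ne'
  · have h1 : 0 < ∑ v, flatness p.1 v :=
      Finset.sum_pos' (fun v _ => flatness_nonneg _ v)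
        ⟨v, Finset.mem_univ v, flatness_pos_of_isInterior hn p.2 h⟩
    exact (add_pos_of_nonneg_of_pos (abs_nonneg _) h1).ne'

theorem continuous_flattening (hn : 2 ≤ n) : Continuous fun p : EK n => flattening p.1 := by
  have h : Continuous fun p : EK n => ∑ v, flatness p.1 v • axisProj v :=
    continuous_finsetSum _ fun v _ => (continuous_flatness hn v).smul continuous_const
  unfold flattening
  fun_prop

theorem isOpen_affineIndependent : IsOpen {p : EK n | AffineIndependent ℝ p.1} := by
  simp only [← homMatrix_det_ne_zero_iff]
  exact isOpen_ne_fun continuous_homMatrix.matrix_det continuous_const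

theorem continuous_centered : Continuous fun p : EK n => centered p.1 := by
  have h : Continuous fun p : EK n => ∑ i, p.1 i :=
    continuous_finsetSum _ fun i _ => continuous_vertex i
  refine continuous_pi fun j => ?_
  exact (continuous_vertex j).sub (h.const_smul ((n : ℝ) + 1)⁻¹)

/-- The frame has no reason to converge at degenerate configurations, but its vectors have norm at
most one and the weight tends to zero there. -/
theorem continuous_simplexWeight_smul_simplexFrame (hn : 2 ≤ n) :
    Continuous fun p : EK n => simplexWeight p.1 • simplexFrame p.1 := by
  rw [continuous_iff_continuousAt]
  intro p
  by_cases hp : AffineIndependent ℝ p.1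
  · have hc : ContinuousOn (fun p : EK n => simplexFrame p.1)
        {p : EK n | AffineIndependent ℝ p.1} := by
      rw [continuousOn_iff_continuous_domRestrict]
      exact continuous_polar (continuous_centered.comp continuous_subtype_val)
        fun q => (isRelationProj_centered q.2).posDef
    exact (continuous_simplexWeight hn).continuousAt.smul
      (hc.continuousAt (isOpen_affineIndependent.mem_nhds hp))
  · rw [ContinuousAt, simplexWeight_of_not_affineIndependent hp, zero_smul]
    have hb := (continuous_simplexWeight hn).tendsto p
    rw [simplexWeight_of_not_affineIndependent hp] at hb
    refine squeeze_zero_norm (fun q => ?_) hb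
    rw [pi_norm_le_iff_of_nonneg simplexWeight_nonneg]
    intro j
    by_cases hq : AffineIndependent ℝ q.1
    · rw [Pi.smul_apply, norm_smul, Real.norm_of_nonneg simplexWeight_nonneg]
      exact mul_le_of_le_one_right simplexWeight_nonneg (norm_simplexFrame_le hq j)
    · rw [simplexWeight_of_not_affineIndependent hq]
      simp

end Frame

/-! ### A strong deformation retraction onto the pyramids -/

section Regularization

open Matrix

variable {n : ℕ}

/-- The straight-line deformation of `p` towards the flattened regular simplex, slowed down near
degenerate configurations. -/
def flattenedReg (s : ℝ) (p : Fin (n + 1) → Eucl n) : Fin (n + 1) → Eucl n :=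
  (1 - s * simplexWeight p) • p +
    s • act (simplexWeight p • simplexFrame p) (flattening p)

variable {p : Fin (n + 1) → Eucl n} {v : Fin (n + 1)} {s : ℝ}

theorem flattenedReg_eq (s : ℝ) (p : Fin (n + 1) → Eucl n) :
    flattenedReg s p = (1 - s * simplexWeight p) • p +
      (s * simplexWeight p) • act (simplexFrame p) (flattening p) := by
  rw [flattenedReg, smul_act, smul_smul]

theorem flattenedReg_zero (p : Fin (n + 1) → Eucl n) : flattenedReg 0 p = p := by
  simp [flattenedReg]

theorem flattenedReg_of_not_affineIndependent (hp : ¬ AffineIndependent ℝ p) (s : ℝ) :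
    flattenedReg s p = p := by
  simp [flattenedReg_eq, simplexWeight_of_not_affineIndependent hp]

theorem flattenedReg_comp (σ : Equiv.Perm (Fin (n + 1))) (s : ℝ) :
    flattenedReg s (p ∘ σ) = flattenedReg s p ∘ σ := by
  by_cases hp : AffineIndependent ℝ p
  · rw [flattenedReg_eq, flattenedReg_eq, simplexWeight_comp, simplexFrame_comp hp,
      flattening_comp, act_comp]
    rfl
  · rw [flattenedReg_of_not_affineIndependent hp,
      flattenedReg_of_not_affineIndependent ((affineIndependent_equiv σ).not.2 hp)]

-- Up to translation, both the simplex and the flattened regular one are positive definite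
-- recombinations of the same frame, hence so are all points of the segment between them.
open scoped MatrixOrder in
theorem affineIndependent_flattenedReg (hn : 2 ≤ n) (hp : AffineIndependent ℝ p) (h0 : 0 ≤ s)
    (h1 : s ≤ 1) : AffineIndependent ℝ (flattenedReg s p) := by
  have hR := isRelationProj_centered hp
  set a := s * simplexWeight p with ha
  have ha0 : 0 ≤ a := mul_nonneg h0 simplexWeight_nonneg
  have ha1 : a ≤ 1 := mul_le_one₀ h1 simplexWeight_nonneg simplexWeight_le_one
  set S := CFC.sqrt (gram ℝ (centered p) + meanProj n) with hS
  have hS' : S.PosDef := posDef_sqrt hR.posDef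
  have hF := posDef_flattening hn hp
  have hB : ((1 - a) • S + a • flattening p).PosDef := by
    rcases ha0.eq_or_lt with h | h
    · rw [← h, sub_zero, one_smul, zero_smul, add_zero]
      exact hS'
    · exact Matrix.PosDef.posSemidef_add (hS'.posSemidef.smul (sub_nonneg.2 ha1)) (hF.smul h)
  have hBN : ((1 - a) • S + a • flattening p) * meanProj n =
      ((1 - a) + a * (Real.sqrt 2)⁻¹) • meanProj n := by
    rw [add_mul, smul_mul_assoc, smul_mul_assoc, hR.sqrt_mul, flattening_mul_meanProj, smul_smul,
      add_smul]
  have hact : act (simplexFrame p) ((1 - a) • S + a • flattening p) =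
      (1 - a) • centered p + a • act (simplexFrame p) (flattening p) := by
    rw [act_add, act_smul, act_smul]
    congr 2
    exact hR.act_polar_sqrt
  rw [affineIndependent_iff_isDep]
  intro x hx
  refine eq_zero_of_sum_smul_act hB meanProj_transpose hBN (gram_simplexFrame hp)
    (meanProj_mulVec_eq_zero.2 hx.1) ?_
  rw [hact, ← hx.2, flattenedReg_eq, ← ha]
  simp only [Pi.add_apply, Pi.smul_apply, centered, smul_sub, smul_add, Finset.sum_add_distrib,
    Finset.sum_sub_distrib, ← Finset.sum_smul, hx.1, zero_smul, sub_zero]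

theorem isLinearEmbedding_flattenedReg (hn : 2 ≤ n) (hp : IsLinearEmbedding p) (h0 : 0 ≤ s)
    (h1 : s ≤ 1) : IsLinearEmbedding (flattenedReg s p) := by
  by_cases ha : AffineIndependent ℝ p
  · exact isLinearEmbedding_of_affineIndependent hn (affineIndependent_flattenedReg hn ha h0 h1)
  · rwa [flattenedReg_of_not_affineIndependent ha]

theorem continuous_flattenedReg (hn : 2 ≤ n) :
    Continuous fun x : unitInterval × EK n => flattenedReg x.1 x.2.1 := by
  have hs : Continuous fun x : unitInterval × EK n => (x.1 : ℝ) :=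
    continuous_subtype_val.comp continuous_fst
  have hw : Continuous fun x : unitInterval × EK n => simplexWeight x.2.1 :=
    (continuous_simplexWeight hn).comp continuous_snd
  have hy : Continuous fun x : unitInterval × EK n => simplexWeight x.2.1 • simplexFrame x.2.1 :=
    (continuous_simplexWeight_smul_simplexFrame hn).comp continuous_snd
  have hB : Continuous fun x : unitInterval × EK n => flattening x.2.1 :=
    (continuous_flattening hn).comp continuous_snd
  have ha : Continuous fun x : unitInterval × EK n =>
      act (simplexWeight x.2.1 • simplexFrame x.2.1) (flattening x.2.1) := by
    refine continuous_pi fun j => continuous_finsetSum _ fun i _ => ?_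
    exact (hB.matrix_elem i j).smul ((continuous_apply i).comp hy)
  have hp : Continuous fun x : unitInterval × EK n => x.2.1 :=
    continuous_subtype_val.comp continuous_snd
  exact ((continuous_const.sub (hs.mul hw)).smul hp).add (hs.smul ha)

/-- The deformation `flattenedReg` of the space of embeddings. -/
def flattenReg (hn : 2 ≤ n) (t : unitInterval) (p : EK n) : EK n :=
  ⟨flattenedReg t p.1, isLinearEmbedding_flattenedReg hn p.2 t.2.1 t.2.2⟩

/-- Where no flatness is positive, the weight is one and the flattening trivial, so the deformation
ends in a regular simplex with unit edges. Degenerate configurations rest, and their interior vertex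
has positive flatness. -/
theorem isApexChoice_flattenReg (hn : 2 ≤ n) :
    IsApexChoice (flattenReg hn) fun p v => 0 < flatness p.1 v where
  continuous := (continuous_flattenedReg hn).subtype_mk _
  zero p := Subtype.ext (flattenedReg_zero p.1)
  equivariant t p σ := Subtype.ext (flattenedReg_comp σ t)
  isOpen v := isOpen_lt continuous_const (continuous_flatness hn v)
  unique p v w hv hw := eq_of_flatness_pos hn p.2 hv hw
  relabel p σ v := by
    change 0 < flatness (p.1 ∘ σ) v ↔ _
    rw [flatness_comp]
  domain p v hv s := by
    refine ⟨faceIndep hn (flattenReg hn s p).2 v, ?_⟩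
    rcases affineIndependent_or_isInterior hn p.2 with h | ⟨w, h⟩
    · exact Or.inl (affineIndependent_flattenedReg hn h s.2.1 s.2.2)
    · rw [eq_of_flatness_pos hn p.2 hv (flatness_pos_of_isInterior hn p.2 h)]
      right
      change IsInterior (flattenedReg s p.1) w
      rwa [flattenedReg_of_not_affineIndependent h.not_affineIndependent]
  indep p h s := by
    rcases affineIndependent_or_isInterior hn p.2 with h' | ⟨w, h'⟩
    · exact affineIndependent_flattenedReg hn h' s.2.1 s.2.2
    · exact absurd (flatness_pos_of_isInterior hn p.2 h') (h w)
  equilateral p h := by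
    have hp : AffineIndependent ℝ p.1 := by
      rcases affineIndependent_or_isInterior hn p.2 with h' | ⟨w, h'⟩
      · exact h'
      · exact absurd (flatness_pos_of_isInterior hn p.2 h') (h w)
    have h0 : ∀ v, flatness p.1 v = 0 := fun v =>
      le_antisymm (not_lt.1 (h v)) (flatness_nonneg _ v)
    have e : (flattenReg hn 1 p).1 = (Real.sqrt 2)⁻¹ • simplexFrame p.1 := by
      change flattenedReg ((1 : unitInterval) : ℝ) p.1 = _
      rw [flattenedReg_eq, simplexWeight_of_flatness_eq_zero hp h0,
        flattening_eq (v := 0) fun w _ => h0 w, h0, zero_smul, sub_zero, act_smul, act_one]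
      simp
    refine ⟨1, one_pos, fun i j hij => ?_⟩
    have hg : ∀ i j, inner ℝ (simplexFrame p.1 i) (simplexFrame p.1 j) =
        (if i = j then 1 else 0) - ((n : ℝ) + 1)⁻¹ := fun i j => by
      have := congrFun (congrFun (gram_simplexFrame hp) i) j
      rwa [gram_apply, Matrix.sub_apply, Matrix.one_apply] at this
    rw [e, Pi.smul_apply, Pi.smul_apply, dist_eq_norm, ← smul_sub, norm_smul,
      ← sq_eq_sq₀ (by positivity) zero_le_one, mul_pow, norm_sub_sq_real,
      ← real_inner_self_eq_norm_sq (simplexFrame p.1 i),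
      ← real_inner_self_eq_norm_sq (simplexFrame p.1 j), hg, hg, hg, if_neg hij,
      if_pos rfl, if_pos rfl, norm_inv, Real.norm_of_nonneg (Real.sqrt_nonneg 2), inv_pow,
      Real.sq_sqrt zero_le_two]
    ring

/-! ### Pyramids are fixed -/

theorem IsPyramid.relHeight_eq (hn : 2 ≤ n) (h : IsPyramid p v) :
    relHeight p v = ‖p v - faceBarycenter p v‖ / regHeight n := by
  rw [relHeight, faceScale_of_regular hn one_pos h.1, one_mul, apexVec,
    apexTarget_of_isOverBarycenter h.2.1]

theorem regHeight_sq (hn : 2 ≤ n) : regHeight n ^ 2 = ((n : ℝ) + 1) / (2 * n) :=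
  Real.sq_sqrt (by positivity)

theorem IsPyramid.relHeight_le_one (hn : 2 ≤ n) (h : IsPyramid p v) : relHeight p v ≤ 1 := by
  rw [h.relHeight_eq hn, div_le_one (regHeight_pos hn), ← dist_eq_norm]
  exact h.2.2.2

theorem IsPyramid.relHeight_pos (hn : 2 ≤ n) (h : IsPyramid p v) (hp : AffineIndependent ℝ p) :
    0 < relHeight p v := by
  rw [h.relHeight_eq hn]
  refine div_pos (norm_pos_iff.2 fun h0 => ?_) (regHeight_pos hn)
  exact (isInterior_of_eq_faceBarycenter hn (sub_eq_zero.1 h0)).not_affineIndependent hp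

/-- With `θ` the relative height, the ratio of areas is `θ ^ 2 + (1 - θ ^ 2) / n ^ 2`. Twice its
distance from one is at least `3 / 2 * (1 - θ ^ 2)`, hence at least `1 - θ`. So the factor two in
`flatness` makes the height decisive on pyramids. -/
theorem IsPyramid.two_mul_faceArea (hn : 2 ≤ n) (h : IsPyramid p v) (hp : AffineIndependent ℝ p)
    {j : Fin (n + 1)} (hj : j ≠ v) :
    1 - relHeight p v ≤ 2 * (1 - faceArea p j / faceArea p v) := by
  have h0 := (h.relHeight_pos hn hp).le
  have h1 := h.relHeight_le_one hn
  have e : ‖p v - faceBarycenter p v‖ = relHeight p v * regHeight n := by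
    rw [h.relHeight_eq hn, div_mul_cancel₀ _ (regHeight_pos hn).ne']
  have hn2 : (2 : ℝ) ≤ n := by exact_mod_cast hn
  have hi : ((n : ℝ)⁻¹) ^ 2 ≤ 1 / 4 := by
    have : (n : ℝ)⁻¹ ≤ 2⁻¹ := inv_anti₀ two_pos hn2
    nlinarith [inv_nonneg.2 (zero_le_two.trans hn2)]
  rw [h.faceArea_div hn hp hj, e, mul_pow, regHeight_sq hn]
  have e2 : 2 * (1 - (n : ℝ)⁻¹) * (relHeight p v ^ 2 * (((n : ℝ) + 1) / (2 * n))) + (n : ℝ)⁻¹ ^ 2 =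
      relHeight p v ^ 2 + (1 - relHeight p v ^ 2) * (n : ℝ)⁻¹ ^ 2 := by
    field_simp
    ring
  rw [e2]
  nlinarith [mul_le_mul_of_nonneg_left hi (sub_nonneg.2 (pow_le_one₀ h0 h1 : relHeight p v ^ 2 ≤ 1))]

theorem IsPyramid.flatness_eq (hn : 2 ≤ n) (h : IsPyramid p v) (hp : AffineIndependent ℝ p) :
    flatness p v = 1 - relHeight p v := by
  have h1 := h.relHeight_le_one hn
  have : (⨅ j, if j = v then 1 - relHeight p v else 2 * (1 - faceArea p j / faceArea p v)) =
      1 - relHeight p v := by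
    refine le_antisymm ?_ (le_ciInf fun j => ?_)
    · refine (ciInf_le (Set.finite_range _).bddBelow v).trans ?_
      rw [if_pos rfl]
    · split_ifs with hj
      · exact le_rfl
      · exact h.two_mul_faceArea hn hp hj
  rw [flatness, this, max_eq_right (sub_nonneg.2 h1)]

theorem IsPyramid.flatness_eq_zero (hn : 2 ≤ n) (h : IsPyramid p v) (hp : AffineIndependent ℝ p)
    {w : Fin (n + 1)} (hw : w ≠ v) : flatness p w = 0 := by
  refine le_antisymm (not_lt.1 fun hpos => ?_) (flatness_nonneg p w)
  have hl := isLinearEmbedding_of_affineIndependent hn hp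
  have h1 := faceArea_lt_of_flatness_pos hn hl hpos hw.symm
  have h2 := (sub_nonneg.2 (h.relHeight_le_one hn)).trans (h.two_mul_faceArea hn hp hw)
  have h3 : faceArea p w / faceArea p v ≤ 1 := by linarith
  rw [div_le_one (faceArea_pos hn (faceIndep hn hl v))] at h3
  exact h1.not_ge h3

/-- A pyramid of relative height `θ` has flatness `1 - θ`, and the flattening multiplies the axis of
the regular simplex by `θ`. It remains to recognize the frame, by `polar_act`. -/
theorem act_simplexFrame_of_isPyramid (hn : 2 ≤ n) (h : IsPyramid p v)
    (hp : AffineIndependent ℝ p) : act (simplexFrame p) (flattening p) = p := by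
  have hn0 : (n : ℝ) ≠ 0 := by positivity
  have hn1 := (natCast_add_one_pos n).ne'
  have hs : Real.sqrt 2 ≠ 0 := by positivity
  have hs2 : Real.sqrt 2 ^ 2 = 2 := Real.sq_sqrt zero_le_two
  set θ := relHeight p v with hθ
  have hθ0 : 0 < θ := h.relHeight_pos hn hp
  set a := p v - faceBarycenter p v with ha
  set f := faceVec p v with hf
  have ha2 : inner ℝ a a = θ ^ 2 * (((n : ℝ) + 1) / (2 * n)) := by
    rw [real_inner_self_eq_norm_sq, ← regHeight_sq hn, ← mul_pow, hθ, h.relHeight_eq hn,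
      div_mul_cancel₀ _ (regHeight_pos hn).ne']
  have hg : ∀ i k, inner ℝ (f i) (f k) = 1 / 2 * ((if i = k then 1 else 0) - faceProj v i k) := by
    intro i k
    have := congrFun (congrFun (gram_faceVec_of_regular hn h.1) i) k
    rw [gram_apply] at this
    rw [hf, this]
    simp [Matrix.one_apply]
  have hfa : ∀ i, inner ℝ (f i) a = 0 := by
    intro i
    have := h.2.1
    rw [IsOverBarycenter, ← span_faceVec hn] at this
    exact this _ (Submodule.subset_span ⟨i, rfl⟩)
  have hpe : ∀ j, p j = f j + axisCoeff v j • a := by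
    intro j
    have h0 := sum_eq_smul hn p v
    rw [h.2.2.1, eq_comm, smul_eq_zero, or_iff_right hn1] at h0
    have := congrFun (eq_pyr p v) j
    rwa [h0, pyr, zero_add] at this
  -- The candidate is the pyramid with its axis stretched by `θ⁻¹` to a regular simplex, scaled by
  -- `√2` to have the Gram matrix of a frame.
  set z : Fin (n + 1) → Eucl n := fun j => Real.sqrt 2 • (f j + (θ⁻¹ * axisCoeff v j) • a) with hz
  have hgz : gram ℝ z = 1 - meanProj n := by
    have e : (1 : Matrix (Fin (n + 1)) (Fin (n + 1)) ℝ) - meanProj n =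
        1 - faceProj v + axisProj v := by
      rw [faceProj_eq hn]; abel
    ext i j
    rw [e, Matrix.add_apply, Matrix.sub_apply, Matrix.one_apply, gram_apply]
    simp only [hz, real_inner_smul_left, real_inner_smul_right, inner_add_left, inner_add_right,
      hg, hfa, real_inner_comm (f _) a, ha2, axisProj]
    field_simp
    rw [hs2]
    ring
  have hact : ∀ j, act z (axisProj v) j = (Real.sqrt 2 * θ⁻¹ * axisCoeff v j) • a := by
    intro j
    have h1 : act f (axisProj v) = 0 := by
      have := act_faceProj (faceVec_self p v) (sum_faceVec hn p v)
      rwa [faceProj_eq hn, act_add, act_meanProj (sum_faceVec hn p v), zero_add] at this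
    have h1j : ∑ i, axisProj v i j • f i = 0 := congrFun h1 j
    have h2 : ∀ i, axisProj v i j • z i = Real.sqrt 2 • axisProj v i j • f i +
        (Real.sqrt 2 * θ⁻¹ * (axisProj v i j * axisCoeff v i)) • a := fun i => by
      rw [hz]
      module
    rw [act, Finset.sum_congr rfl fun i _ => h2 i, Finset.sum_add_distrib, ← Finset.smul_sum, h1j,
      smul_zero, zero_add, ← Finset.sum_smul, ← Finset.mul_sum, sum_axisCoeff_mul_axisProj hn]
  have hB := flattening_eq fun w hw => h.flatness_eq_zero hn hp hw
  rw [h.flatness_eq hn hp, ← hθ] at hB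
  have hzp : act z (flattening p) = p := by
    funext j
    rw [hB, act_smul, sub_eq_add_neg, ← neg_smul, act_add, act_one, act_smul, Pi.smul_apply,
      Pi.add_apply, Pi.smul_apply, hact, hpe j, hz]
    match_scalars <;> field_simp <;> ring
  have hact0 : act z (meanProj n) = 0 := by
    refine act_meanProj ?_
    rw [hz, ← Finset.smul_sum, Finset.sum_add_distrib, ← Finset.sum_smul, ← Finset.mul_sum,
      sum_axisCoeff, hf, sum_faceVec hn]
    simp
  -- The multiple of `meanProj n` acts as zero on `z`; it corrects the eigenvalue on constant
  -- vectors from `1 / √2` to the `1` that `polar_act` demands.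
  have hc : centered p = act z (flattening p + (1 - (Real.sqrt 2)⁻¹) • meanProj n) := by
    rw [act_add, act_smul, hact0, smul_zero, add_zero, hzp]
    funext j
    rw [centered, h.2.2.1, smul_zero, sub_zero]
  have hy : simplexFrame p = z := by
    rw [simplexFrame, hc]
    refine polar_act ?_ meanProj_transpose ?_ hgz
    · refine (posDef_flattening hn hp).add_posSemidef
        ((posSemidef_of_symm_idem meanProj_transpose meanProj_mul_self).smul ?_)
      rw [sub_nonneg]
      refine inv_le_one_of_one_le₀ ?_
      rw [Real.one_le_sqrt]
      norm_num
    · rw [add_mul, flattening_mul_meanProj, smul_mul_assoc, meanProj_mul_self, ← add_smul]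
      simp
  rw [hy, hzp]

theorem flattenedReg_of_isPyramid (hn : 2 ≤ n) (h : IsPyramid p v) (s : ℝ) :
    flattenedReg s p = p := by
  by_cases hp : AffineIndependent ℝ p
  · rw [flattenedReg_eq, act_simplexFrame_of_isPyramid hn h hp, ← add_smul, sub_add_cancel,
      one_smul]
  · exact flattenedReg_of_not_affineIndependent hp s

theorem isAllowed_of_isPyramid (hn : 2 ≤ n) {p : EK n} (h : IsPyramid p.1 v) :
    IsAllowed (fun (p : EK n) v => 0 < flatness p.1 v) p v := by
  by_cases hv : 0 < flatness p.1 v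
  · exact Or.inl hv
  · right
    intro w hw
    have hp : AffineIndependent ℝ p.1 := by
      by_contra hp
      refine hv (flatness_pos_of_isInterior hn p.2 (isInterior_of_eq_faceBarycenter hn ?_))
      rw [(faceIndep hn p.2 v).affineIndependent_iff hn, not_not] at hp
      exact sub_eq_zero.1 (Submodule.disjoint_def.1
        (Submodule.orthogonal_disjoint (faceDirection p.1 v)) _ hp h.2.1)
    by_cases hwv : w = v
    · exact hv (hwv ▸ hw)
    · exact hw.ne' (h.flatness_eq_zero hn hp hwv)

theorem exists_strong_deformation_retraction (hn : 2 ≤ n) :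
    ∃ D : unitInterval → CK n → CK n, IsDeformationRetraction (PK n) D := by
  obtain ⟨D, hD, hDu⟩ := (isApexChoice_flattenReg hn).exists_deformation hn
  refine ⟨D, hD, ?_⟩
  rintro t _ ⟨p, v, rfl, h⟩
  rw [hDu]
  congr 1
  refine Subtype.ext ?_
  rw [IsApexChoice.glue_eq hn _ (isAllowed_of_isPyramid hn h)]
  change phi t (flattenedReg _ p.1) v = p.1
  rw [flattenedReg_of_isPyramid hn h, phi_of_isPyramid hn h]

end Regularization

/-! ### Slowing down `R`, the gluing `H` and its repair `G` -/

section Main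

variable {n : ℕ} {p : EK n} {v : Fin (n + 1)} {R : unitInterval → SimplexSpace n → SimplexSpace n}

theorem isSimplex_unlabel_iff : IsSimplex (unlabel p) ↔ AffineIndependent ℝ p.1 := by
  refine ⟨?_, fun h => ⟨p, rfl, h⟩⟩
  rintro ⟨q, hq, h⟩
  obtain ⟨σ, rfl⟩ := unlabel_eq_unlabel_iff.1 hq
  exact (affineIndependent_equiv σ).2 h

theorem isOpen_isSimplex (hn : 2 ≤ n) : IsOpen {x : CK n | IsSimplex x} := by
  rw [← (isOpenQuotientMap_unlabel hn).isQuotientMap.isOpen_preimage]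
  convert isOpen_affineIndependent (n := n) using 1
  ext p
  exact isSimplex_unlabel_iff

theorem beta_of_not_isSimplex (hn : 2 ≤ n) {x : CK n} (hx : ¬ IsSimplex x) : beta x = -1 := by
  obtain ⟨p, rfl⟩ := unlabel_surjective x
  rw [isSimplex_unlabel_iff] at hx
  rw [beta, alpha_of_not_affineIndependent hx, mul_div_cancel_right₀ _ (halfSphere_pos hn).ne']
  norm_num

theorem continuous_beta (hn : 2 ≤ n) : Continuous (beta : CK n → ℝ) :=
  continuous_const.sub ((continuous_const.mul (continuous_alpha hn)).div_const _)

theorem one_le_beta_iff (hn : 2 ≤ n) {x : CK n} : 1 ≤ beta x ↔ alpha x ≤ halfSphere n / 2 := by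
  have := halfSphere_pos hn
  rw [beta, le_sub_comm, div_le_iff₀ this]
  constructor <;> intro h <;> linarith

theorem exists_isPreferredApex_of_beta_nonpos (hn : 2 ≤ n) (h : beta (unlabel p) ≤ 0) :
    ∃ v, IsPreferredApex p.1 v := by
  rw [← half_lt_alpha_iff hn]
  by_contra! h'
  linarith [(one_le_beta_iff hn).2 h']

theorem alpha_le_iff (hn : 2 ≤ n) :
    alpha (unlabel p) ≤ halfSphere n / 2 ↔ ∀ v, ¬ IsPreferredApex p.1 v := by
  rw [← not_lt, half_lt_alpha_iff hn, not_exists]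

theorem affineIndependent_of_forall_not_isPreferredApex (hn : 2 ≤ n)
    (h : ∀ v, ¬ IsPreferredApex p.1 v) : AffineIndependent ℝ p.1 := by
  by_contra hp
  obtain ⟨v, hv⟩ := (affineIndependent_or_isInterior hn p.2).resolve_left hp
  exact h v (Or.inr ⟨hp, (mem_convexHull_iff_isInterior hn p.2 v).2 hv⟩)

open Classical in
/-- The regularization `R`, slowed down by the factor `β` (clamped to `[0, 1]`). -/
def slowed (R : unitInterval → SimplexSpace n → SimplexSpace n) (s : unitInterval) (x : CK n) :
    CK n :=
  if h : IsSimplex x then (R (s * clampI (beta x)) ⟨x, h⟩).1 else x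

theorem slowed_of_beta_nonpos (hR : ∀ x, R 0 x = x) (s : unitInterval) {x : CK n}
    (h : beta x ≤ 0) : slowed R s x = x := by
  rw [slowed]
  split_ifs
  · rw [clampI_of_le h, mul_zero, hR]
  · rfl

theorem slowed_of_not_isSimplex (s : unitInterval) {x : CK n} (h : ¬ IsSimplex x) :
    slowed R s x = x := dif_neg h

theorem slowed_coe (s : unitInterval) (x : SimplexSpace n) :
    slowed R s x.1 = (R (s * clampI (beta x.1)) x).1 := dif_pos x.2

theorem slowed_zero (hR : ∀ x, R 0 x = x) (x : CK n) : slowed R 0 x = x := by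
  rw [slowed]
  split_ifs
  · rw [zero_mul, hR]
  · rfl

/-- Simplices form an open set, where the formula is continuous. A degenerate configuration has `β =
-1`, so `β` is negative on a whole neighborhood and nothing moves there. -/
theorem continuous_slowed (hn : 2 ≤ n) (hR : ∀ x, R 0 x = x)
    (hc : Continuous (Function.uncurry R)) : Continuous (Function.uncurry (slowed R)) := by
  rw [continuous_iff_continuousAt]
  rintro ⟨s, x⟩
  by_cases hx : IsSimplex x
  · have he : IsOpenEmbedding (Prod.map id Subtype.val : unitInterval × SimplexSpace n → _) :=
      IsOpenEmbedding.id.prodMap (isOpen_isSimplex hn).isOpenEmbedding_subtypeVal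
    refine (he.continuousAt_iff (x := (s, ⟨x, hx⟩))).1 ?_
    have e : Function.uncurry (slowed R) ∘ Prod.map id Subtype.val =
        fun y : unitInterval × SimplexSpace n =>
          (Function.uncurry R (y.1 * clampI (beta y.2.1), y.2)).1 :=
      funext fun y => slowed_coe y.1 y.2
    rw [e]
    refine (continuous_subtype_val.comp (hc.comp (Continuous.prodMk ?_ continuous_snd))).continuousAt
    exact continuous_fst.mul (continuous_clampI.comp ((continuous_beta hn).comp
      (continuous_subtype_val.comp continuous_snd)))
  · have hb : ∀ᶠ y : unitInterval × CK n in 𝓝 (s, x), beta y.2 < 0 := by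
      refine ((continuous_beta hn).comp continuous_snd).continuousAt.eventually_lt
        continuousAt_const ?_
      simp [beta_of_not_isSimplex hn hx]
    refine continuousAt_snd.congr ?_
    filter_upwards [hb] with y hy
    exact (slowed_of_beta_nonpos hR y.1 hy.le).symm

theorem eq_of_forall_unlabel_eq (hn : 2 ≤ n) {q : unitInterval → EK n} (hq : Continuous q)
    (h : ∀ s, unlabel (q s) = unlabel (q 0)) (s : unitInterval) : q s = q 0 :=
  congrFun ((isCoveringMap_unlabel hn).eq_of_comp_eq hq continuous_const (funext h) 0 rfl) s

/-- Lifts of the slowed-down regularization can be followed by the preferred-apex retraction. -/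
theorem isApexChoice_isPreferredApex (hn : 2 ≤ n)
    (hR : IsWeakDeformationRetraction (regularSimplices n) R) {F : unitInterval → EK n → EK n}
    (hF : Continuous (Function.uncurry F)) (h0 : ∀ p, F 0 p = p)
    (hf : ∀ t p, unlabel (F t p) = slowed R t (unlabel p)) (he : IsEquivariant F) :
    IsApexChoice F fun p v => IsPreferredApex p.1 v := by
  have hind : ∀ p : EK n, AffineIndependent ℝ p.1 → ∀ s, AffineIndependent ℝ (F s p).1 := by
    intro p hp s
    rw [← isSimplex_unlabel_iff, hf]
    have := slowed_coe (R := R) s ⟨unlabel p, isSimplex_unlabel_iff.2 hp⟩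
    rw [this]
    exact (R _ _).2
  refine ⟨hF, h0, he, isOpen_isPreferredApex hn, fun p v w hv hw => hv.eq hn p.2 hw,
    fun p σ v => isPreferredApex_comp p.1 σ v, fun p v hv s => ?_, fun p h s => ?_,
    fun p h => ?_⟩
  · refine ⟨faceIndep hn (F s p).2 v, ?_⟩
    by_cases hp : AffineIndependent ℝ p.1
    · exact Or.inl (hind p hp s)
    · right
      -- The path lifts a constant path of unlabeled configurations, so it is constant.
      have hq : F s p = p := by
        have := eq_of_forall_unlabel_eq hn (q := fun s => F s p)
          (hF.comp (continuous_id.prodMk continuous_const)) (fun s => by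
            rw [hf, h0, slowed_of_not_isSimplex s (isSimplex_unlabel_iff.not.2 hp)]) s
        rwa [h0] at this
      rw [hq]
      rcases hv with hv | hv
      · exact absurd hv.1 hp
      · exact (mem_convexHull_iff_isInterior hn p.2 v).1 hv.2
  · exact hind p (affineIndependent_of_forall_not_isPreferredApex hn h) s
  · have hp := affineIndependent_of_forall_not_isPreferredApex hn h
    have hb := (one_le_beta_iff hn).2 ((alpha_le_iff hn).2 h)
    have h1 := slowed_coe (R := R) 1 ⟨unlabel p, isSimplex_unlabel_iff.2 hp⟩
    rw [clampI_of_ge hb, mul_one] at h1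
    obtain ⟨q, hq, L, hL, hreg⟩ := hR.one ⟨unlabel p, isSimplex_unlabel_iff.2 hp⟩
    rw [← h1, ← hf] at hq
    obtain ⟨σ, hσ⟩ := unlabel_eq_unlabel_iff.1 hq
    refine ⟨L, hL, fun i j hij => ?_⟩
    rw [hσ]
    exact hreg _ _ (σ.injective.ne hij)

/-- Here the path is a straight line from the equilateral simplex to its centered copy scaled by
`L⁻¹`; the factor is a convex combination of `1` and `L⁻¹`. -/
theorem IsApexChoice.exists_glue_eq_smul_add (hn : 2 ≤ n) {F : unitInterval → EK n → EK n}
    {ap : EK n → Fin (n + 1) → Prop} (hF : IsApexChoice F ap) (h : ∀ v, ¬ ap p v)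
    {t : unitInterval} (ht : 1 / 2 ≤ (t : ℝ)) :
    ∃ (c : ℝ) (b : Eucl n), 0 < c ∧ ∀ i, (hF.glue hn t p).1 i = c • (F 1 p).1 i + b := by
  obtain ⟨L, hL, hreg⟩ := hF.equilateral p h
  have e := phi_of_isEquilateral hn hL hreg t 0
  set s : ℝ := (clampI (4 * (t : ℝ) - 3) : ℝ) with hs
  have hs0 : 0 ≤ s := (clampI _).2.1
  have hs1 : s ≤ 1 := (clampI _).2.2
  refine ⟨(1 - s) + s * L⁻¹, -((s * L⁻¹ * ((n : ℝ) + 1)⁻¹) • ∑ i, (F 1 p).1 i), ?_, fun i => ?_⟩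
  · have : 0 < L⁻¹ := inv_pos.2 hL
    rcases hs1.eq_or_lt with h | h
    · rw [h]; linarith
    · exact add_pos_of_pos_of_nonneg (sub_pos.2 h) (by positivity)
  · rw [hF.glue_eq hn (v := 0) (Or.inr h), clampI_of_ge (by linarith), e,
      AffineMap.lineMap_apply_module]
    simp only [Pi.add_apply, Pi.smul_apply]
    module

theorem exists_gluing (hn : 2 ≤ n) (hR : IsWeakDeformationRetraction (regularSimplices n) R) :
    ∃ H : unitInterval → CK n → CK n, IsDeformationInto (PK n) H ∧ IsGluing R H := by
  obtain ⟨F, hFc, hF0, hFu, hFe⟩ := exists_lift hn (continuous_slowed hn hR.zero hR.continuous)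
    (slowed_zero hR.zero)
  have hF := isApexChoice_isPreferredApex hn hR hFc hF0 hFu hFe
  obtain ⟨H, hH, hHu⟩ := hF.exists_deformation hn
  have hle : ∀ (t : unitInterval) (x : CK n), (t : ℝ) ≤ 1 / 2 →
      H t x = slowed R (clampI (2 * (t : ℝ))) x := by
    intro t x ht
    obtain ⟨p, rfl⟩ := unlabel_surjective x
    rw [hHu, ← hFu]
    congr 1
    exact Subtype.ext (by rw [hF.glue_eq hn (isAllowed_apexOf p), phi_of_le t ht])
  refine ⟨H, hH, fun t x ht => ?_, fun t x ht hx => ?_, fun t x ht hx => ?_, fun p v hv => ?_,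
    fun t x hx hb => ?_⟩
  · rw [hle t x ht, slowed_coe]
    congr 2
    rw [← clampI_coe (clampI (2 * (t : ℝ)) * clampI (beta x.1)), Set.Icc.coe_mul,
      clampI_of_mem (s := 2 * (t : ℝ)) (by linarith [t.2.1]) (by linarith)]
  · rw [hle t x ht, slowed_of_not_isSimplex _ hx]
  · obtain ⟨p, hpx⟩ := unlabel_surjective x.1
    have hna : ∀ v, ¬ IsPreferredApex p.1 v := by
      have := (one_le_beta_iff hn).1 hx
      rw [← hpx] at this
      exact (alpha_le_iff hn).1 this
    obtain ⟨c, b, hc, h⟩ := hF.exists_glue_eq_smul_add hn hna ht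
    refine ⟨F 1 p, hF.glue hn t p, c, b, ?_, ?_, hc, h⟩
    · rw [hFu, hpx, slowed_coe, clampI_of_ge hx, mul_one]
    · rw [← hHu, hpx]
  · refine ⟨fun t => hF.glue hn t p, ?_, hF.glue_zero hn p, fun t => (hHu t p).symm,
      hF.isPreferredApexPath_glue hn (Or.inl hv)⟩
    exact (hF.continuous_glue hn).uncurry_right p
  · obtain ⟨p, v, rfl, h⟩ := hx
    obtain ⟨u, hu⟩ := exists_isPreferredApex_of_beta_nonpos hn hb
    rw [hHu]
    congr 1
    refine Subtype.ext ?_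
    have huv := h.isPreferredApex_eq hn p.2 hu
    -- For `β ≤ 0` the slowed-down regularization rests, and so does its lift. The second half fixes
    -- the pyramid because its preferred apex is its apex.
    have hq : F (clampI (2 * (t : ℝ))) p = p := by
      have := eq_of_forall_unlabel_eq hn (q := fun s => F s p)
        (hFc.comp (continuous_id.prodMk continuous_const)) (fun s => by
          rw [hFu, hF0, slowed_of_beta_nonpos hR.zero s hb]) (clampI (2 * (t : ℝ)))
      rwa [hF0] at this
    rw [hF.glue_eq hn (Or.inl hu), hq, huv, phi_of_isPyramid hn h]

/-- Finitely many equations in continuous functions of `p`, as needed for closedness of the set of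
pyramids. -/
theorem isOverBarycenter_iff (hn : 2 ≤ n) {p : Fin (n + 1) → Eucl n} :
    IsOverBarycenter p v ↔ ∀ j, inner ℝ (faceVec p v j) (p v - faceBarycenter p v) = 0 := by
  rw [IsOverBarycenter, ← span_faceVec hn]
  refine ⟨fun h j => h _ (Submodule.subset_span ⟨j, rfl⟩), fun h => ?_⟩
  rw [← Submodule.span_singleton_le_iff_mem, Submodule.le_orthogonal_iff_le_orthogonal,
    Submodule.span_le]
  rintro _ ⟨j, rfl⟩
  rw [SetLike.mem_coe, Submodule.mem_orthogonal_singleton_iff_inner_left]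
  exact h j

theorem IsPyramid.comp {p : Fin (n + 1) → Eucl n} (σ : Equiv.Perm (Fin (n + 1)))
    (h : IsPyramid p (σ v)) : IsPyramid (p ∘ σ) v := by
  refine ⟨fun i j hi hj hij => h.1 _ _ (σ.injective.ne hi) (σ.injective.ne hj)
    (σ.injective.ne hij), ?_, (Equiv.sum_comp σ p).trans h.2.2.1, ?_⟩
  · rw [IsOverBarycenter, faceBarycenter_comp, faceDirection_comp]
    exact h.2.1
  · rw [faceBarycenter_comp]
    exact h.2.2.2

theorem isClosed_preimage_PK (hn : 2 ≤ n) : IsClosed (unlabel ⁻¹' PK n : Set (EK n)) := by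
  have e : (unlabel ⁻¹' PK n : Set (EK n)) = ⋃ v, {p : EK n | IsPyramid p.1 v} := by
    ext p
    rw [Set.mem_iUnion]
    constructor
    · rintro ⟨q, v, hq, h⟩
      obtain ⟨σ, rfl⟩ := unlabel_eq_unlabel_iff.1 hq
      refine ⟨σ⁻¹ v, IsPyramid.comp σ ?_⟩
      simpa using h
    · rintro ⟨v, hv⟩
      exact ⟨p, v, rfl, hv⟩
  rw [e]
  refine isClosed_iUnion_of_finite fun v => ?_
  have hb := continuous_faceBarycenter (n := n) v
  have hv := fun j => continuous_vertex (n := n) j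
  have hf : ∀ j, Continuous fun p : EK n => faceVec p.1 v j := fun j =>
    (continuous_apply j).comp (continuous_faceVec v)
  simp only [IsPyramid, isOverBarycenter_iff hn, Set.ofPred_and, Set.ofPred_forall]
  refine IsClosed.inter ?_ (IsClosed.inter ?_ (IsClosed.inter ?_ ?_))
  · exact isClosed_iInter fun i => isClosed_iInter fun j => isClosed_iInter fun _ =>
      isClosed_iInter fun _ => isClosed_iInter fun _ =>
        isClosed_eq ((hv i).dist (hv j)) continuous_const
  · exact isClosed_iInter fun j => isClosed_eq ((hf j).inner ((hv v).sub hb)) continuous_const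
  · exact isClosed_eq (continuous_finsetSum _ fun i _ => hv i) continuous_const
  · exact isClosed_le ((hv v).dist hb) continuous_const

/-- A Urysohn function on the configuration space. -/
theorem exists_continuous_zero_one (hn : 2 ≤ n) {U : Set (CK n)} (hU : IsOpen U)
    (hPU : PK n ⊆ U) : ∃ ρ : CK n → ℝ, Continuous ρ ∧ (∀ x ∉ U, ρ x = 0) ∧
      (∀ x ∈ PK n, ρ x = 1) := by
  have hq := (isOpenQuotientMap_unlabel hn).isQuotientMap
  obtain ⟨g, hg0, hg1, -⟩ := exists_continuous_zero_one_of_isClosed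
    (s := (unlabel ⁻¹' Uᶜ : Set (EK n))) (t := unlabel ⁻¹' PK n)
    (hU.isClosed_compl.preimage hq.continuous) (isClosed_preimage_PK hn)
    (Disjoint.preimage _ (Set.disjoint_compl_left_iff_subset.2 hPU))
  -- The product over all relabelings is invariant. It keeps the values zero and one, since both
  -- preimages are unions of orbits.
  let ρ : CK n → ℝ := Quotient.lift
    (fun p : EK n => ∏ σ : Equiv.Perm (Fin (n + 1)), g (relabel p σ)) (by
      intro p q h
      obtain ⟨τ, rfl⟩ := unlabel_eq_unlabel_iff.1 (Quotient.sound h)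
      exact (Equiv.prod_comp (Equiv.mulLeft τ) fun σ => g (relabel p σ)).symm)
  refine ⟨ρ, hq.continuous_iff.2 ?_, fun x hx => ?_, fun x hx => ?_⟩
  · exact continuous_finsetProd _ fun σ _ => g.continuous.comp (continuous_relabel σ)
  · obtain ⟨p, rfl⟩ := unlabel_surjective x
    refine Finset.prod_eq_zero (Finset.mem_univ 1) (hg0 ?_)
    rwa [Set.mem_preimage, unlabel_relabel]
  · obtain ⟨p, rfl⟩ := unlabel_surjective x
    refine Finset.prod_eq_one fun σ _ => hg1 ?_
    rwa [Set.mem_preimage, unlabel_relabel]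

/-- A deformation into `PK n` may be replaced by a strong deformation retraction near `PK n`. -/
theorem exists_repair (hn : 2 ≤ n) {H : unitInterval → CK n → CK n}
    (hH : IsDeformationInto (PK n) H) {U : Set (CK n)} (hU : IsOpen U) (hPU : PK n ⊆ U) :
    ∃ G : unitInterval → CK n → CK n, IsDeformationRetraction (PK n) G ∧
      ∀ t, ∀ x ∉ U, G t x = H t x := by
  obtain ⟨D, hD⟩ := exists_strong_deformation_retraction hn
  obtain ⟨ρ, hρ, hρ0, hρ1⟩ := exists_continuous_zero_one hn hU hPU
  -- Near `P(K)` the deformation `H` is cut short, and away from it `D` is. At least one of the two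
  -- is complete at every point: `D` where `ρ ≥ 1/2`, `H` where `ρ ≤ 1/2`. In the latter case `H`
  -- ends in `P(K)`, which `D` fixes.
  refine ⟨fun t x => D (clampI (2 * ρ x) * t) (H (clampI (2 - 2 * ρ x) * t) x),
    ⟨⟨?_, fun x => ?_, fun x => ?_⟩, fun t x hx => ?_⟩, fun t x hx => ?_⟩
  · have hc : ∀ g : CK n → ℝ, Continuous g →
        Continuous fun y : unitInterval × CK n => clampI (g y.2) * y.1 := fun g hg =>
      (continuous_clampI.comp (hg.comp continuous_snd)).mul continuous_fst
    exact hD.continuous.comp ((hc _ (continuous_const.mul hρ)).prodMk (hH.continuous.comp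
      ((hc _ (continuous_const.sub (continuous_const.mul hρ))).prodMk continuous_snd)))
  · simp only [mul_zero, hD.zero, hH.zero]
  · simp only [mul_one]
    rcases le_total (1 / 2) (ρ x) with h | h
    · rw [clampI_of_ge (by linarith)]
      exact hD.one _
    · rw [clampI_of_ge (s := 2 - 2 * ρ x) (by linarith), hD.fixed _ _ (hH.one x)]
      exact hH.one x
  · simp only [hρ1 x hx]
    rw [clampI_of_le (s := 2 - 2 * 1) (by norm_num), zero_mul, hH.zero, hD.fixed _ x hx]
  · simp only [hρ0 x hx]
    rw [clampI_of_le (s := 2 * 0) (by norm_num), zero_mul, hD.zero,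
      clampI_of_ge (by norm_num), one_mul]

end Main

end SkeletonConfig

theorem mainTheorem10 (n : ℕ) (hn : 2 ≤ n)
    (R : unitInterval → SkeletonConfig.SimplexSpace n → SkeletonConfig.SimplexSpace n)
    (hR : SkeletonConfig.IsWeakDeformationRetraction (SkeletonConfig.regularSimplices n) R) :
    ∃ H : unitInterval → SkeletonConfig.CK n → SkeletonConfig.CK n,
      SkeletonConfig.IsDeformationInto (SkeletonConfig.PK n) H ∧
      SkeletonConfig.IsGluing R H ∧
      (∀ (t : unitInterval) (x : SkeletonConfig.SimplexSpace n), (t : ℝ) ≤ 1 / 2 →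
        SkeletonConfig.alpha x.1 ≤ SkeletonConfig.halfSphere n / 2 →
        H t x.1 = (R (SkeletonConfig.clampI (2 * (t : ℝ))) x).1) ∧
      ∀ U : Set (SkeletonConfig.CK n), IsOpen U → SkeletonConfig.PK n ⊆ U →
        ∃ G : unitInterval → SkeletonConfig.CK n → SkeletonConfig.CK n,
          SkeletonConfig.IsDeformationRetraction (SkeletonConfig.PK n) G ∧
          ∀ t, ∀ x ∉ U, G t x = H t x := by
  obtain ⟨H, hH, hG⟩ := SkeletonConfig.exists_gluing hn hR
  refine ⟨H, hH, hG, fun t x ht hx => ?_,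
    fun U hU hPU => SkeletonConfig.exists_repair hn hH hU hPU⟩
  rw [hG.regularize t x ht,
    SkeletonConfig.clampI_of_ge ((SkeletonConfig.one_le_beta_iff hn).2 hx), Set.Icc.coe_one,
    mul_one]

end
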